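/- **Corollary 3.8 (permautos).** Let $n\ge 2$ and let $\mathcal O_n$ be the Cuntz algebra, i.e. a nonzero unital $C^*$-algebra generated by isometries $S_1,\dots,S_n$ with $\sum_{i=1}^n S_iS_i^*=1$. For a multi-index $\mu=(\mu_1,\dots,\mu_k)\in\{1,\dots,n\}^k$ put $|\mu|=k$, $S_\mu=S_{\mu_1}\cdots S_{\mu_k}$ (with $S_\emptyset=1$) and $P_\mu=S_\mu S_\mu^*$. Let $\mathcal F_n^k=\operatorname{span}\{S_\mu S_\nu^*:|\mu|=|\nu|=k\}$, let $\mathcal F_n$ be the norm closure of $\bigcup_{k\ge 0}\mathcal F_n^k$, let $\mathcal D_n$ be the $C^*$-subalgebra generated by all the projections $P_\mu$, and $\mathcal D_n^1=\mathcal D_n\cap\mathcal F_n^1$. Let $\varphi(x)=\sum_{i=1}^n S_ixS_i^*$ be the canonical shift, which maps $\mathcal D_n$ into itself. Automorphisms are $*$-automorphisms. Let $\mathcal P_n$ be the set of unitaries in $\mathcal F_n$ that are finite sums of words $S_\mu S_\nu^*$. Let $\lambda(\mathcal P_n)^{-1}$ be the set of automorphisms $\alpha$ of $\mathcal O_n$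 for which there is $u\in\mathcal P_n$ with $\alpha(S_i)=uS_i$ for all $i$. An automorphism $\alpha$ of $\mathcal D_n$ has property (P) if there is $m\ge 0$ such that $\alpha\varphi^k(x)=\varphi^{k-m}\alpha\varphi^m(x)$ for all $k\ge m$ and all $x\in\mathcal D_n^1$ (it eventually commutes with the shift). Let $\mathfrak G_n$ be the set of automorphisms $\alpha$ of $\mathcal D_n$ such that both $\alpha$ and $\alpha^{-1}$ have property (P). Then $\lambda(\mathcal P_n)^{-1}$ is a subgroup of $\operatorname{Aut}(\mathcal O_n)$, $\mathfrak G_n$ is a subgroup of $\operatorname{Aut}(\mathcal D_n)$, every $\alpha\in\lambda(\mathcal P_n)^{-1}$ satisfies $\alpha(\mathcal D_n)=\mathcal D_n$, and the restriction $\alpha\mapsto\alpha|_{\mathcal D_n}$ is a group isomorphism $$\lambda(\mathcal P_n)^{-1}\to\mathfrak G_n .$$ Moreover, write $\operatorname{Aut}(\mathcal O_n,B)=\{\alpha\in\operatorname{Aut}(\mathcal O_n):\alpha(B)=B\}$ for $B\subseteq\mathcal O_n$, and let $\operatorname{Aut}_{\mathcal D_n}(\mathcal O_n)$ be the group of automorphisms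 of $\mathcal O_n$ that fix $\mathcal D_n$ pointwise. Then $\operatorname{Aut}_{\mathcal D_n}(\mathcal O_n)$ is a (normal) subgroup of $\operatorname{Aut}(\mathcal O_n,\mathcal D_n)\cap\operatorname{Aut}(\mathcal O_n,\mathcal F_n)$, and restriction to $\mathcal D_n$ induces a group isomorphism of the restricted Weyl group $$\bigl(\operatorname{Aut}(\mathcal O_n,\mathcal D_n)\cap\operatorname{Aut}(\mathcal O_n,\mathcal F_n)\bigr)/\operatorname{Aut}_{\mathcal D_n}(\mathcal O_n)\;\cong\;\mathfrak G_n .$$ -/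

import Mathlib

namespace Cuntz

/-- The defining relations of the Cuntz algebra `𝒪ₙ`: the `C⋆`-algebra `A` is generated by the
isometries `S 0, …, S (n-1)`, whose range projections add up to `1`. For `n ≥ 2` and `A ≠ 0` this
says that `A`, with these generators, is `𝒪ₙ`. -/
structure IsCuntzFamily {n : ℕ} {A : Type*} [CStarAlgebra A] (S : Fin n → A) : Prop where
  isometry : ∀ i, star (S i) * S i = 1
  sum_range : ∑ i, S i * star (S i) = 1
  generates : (StarAlgebra.adjoin ℂ (Set.range S)).topologicalClosure = ⊤

section

variable {n : ℕ} {A : Type*} [CStarAlgebra A] (S : Fin n → A)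

/-- `S_μ = S_{μ₁} ⋯ S_{μₖ}` for a multi-index `μ`, with `S_∅ = 1`. -/
noncomputable def word (μ : List (Fin n)) : A := (μ.map S).prod

/-- The range projection `P_μ = S_μ S_μ⋆`. -/
noncomputable def proj (μ : List (Fin n)) : A := word S μ * star (word S μ)

/-- `ℱₙᵏ`, the span of the words `S_μ S_ν⋆` with `|μ| = |ν| = k`. -/
noncomputable def coreLevel (k : ℕ) : Submodule ℂ A :=
  Submodule.span ℂ
    {x | ∃ μ ν : List (Fin n), μ.length = k ∧ ν.length = k ∧ x = word S μ * star (word S ν)}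

/-- The core UHF-subalgebra `ℱₙ`, the norm closure of the union of all `ℱₙᵏ`. -/
noncomputable def core : Set A := closure (⋃ k, (coreLevel S k : Set A))

/-- The diagonal `𝒟ₙ`, the `C⋆`-subalgebra generated by the projections `P_μ`. -/
noncomputable def diagonal : StarSubalgebra ℂ A :=
  (StarAlgebra.adjoin ℂ (Set.range (proj S))).topologicalClosure

/-- `𝒮ₙ`: the unitaries that are finite sums of words `S_μ S_ν⋆`. -/
def wordUnitaries : Set A :=
  {u | u ∈ unitary A ∧ ∃ (m : ℕ) (μ ν : Fin m → List (Fin n)),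
    u = ∑ j, word S (μ j) * star (word S (ν j))}

/-- `𝒫ₙ`: the elements of `𝒮ₙ` that lie in `ℱₙ` (the permutation unitaries). -/
def permUnitaries : Set A := wordUnitaries S ∩ core S

/-- `λ(𝒫ₙ)⁻¹`: the automorphisms `α` of `𝒪ₙ` of the form `λ_u` with `u ∈ 𝒫ₙ`. Here `λ_u` is the
unital `⋆`-endomorphism that is determined by `λ_u(S_i) = u S_i`. -/
def permutativeAut : Set (A ≃⋆ₐ[ℂ] A) :=
  {α | ∃ u ∈ permUnitaries S, ∀ i, α (S i) = u * S i}

/-- The canonical shift `φ(x) = ∑ i, S_i x S_i⋆`. -/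
noncomputable def shift (x : A) : A := ∑ i, S i * x * star (S i)

variable {S}

open scoped ComplexOrder in
theorem IsCuntzFamily.orthogonal (hS : IsCuntzFamily S) {i j : Fin n} (hij : i ≠ j) :
    star (S i) * S j = 0 := by
  let _ := CStarAlgebra.spectralOrder A
  let _ := CStarAlgebra.spectralOrderedRing A
  have h1 : ∑ k, star (star (S k) * S j) * (star (S k) * S j) = 1 := by
    have : ∀ k, star (star (S k) * S j) * (star (S k) * S j)
        = star (S j) * (S k * star (S k)) * S j := by
      intro k; simp only [star_mul, star_star, mul_assoc]
    simp_rw [this]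
    rw [← Finset.sum_mul, ← Finset.mul_sum, hS.sum_range, mul_one, hS.isometry]
  rw [← Finset.add_sum_erase _ _ (Finset.mem_univ j), hS.isometry] at h1
  have h2 : ∑ k ∈ Finset.univ.erase j, star (star (S k) * S j) * (star (S k) * S j) = 0 := by
    simpa using h1
  rw [Finset.sum_eq_zero_iff_of_nonneg (fun k _ => star_mul_self_nonneg _)] at h2
  exact CStarRing.star_mul_self_eq_zero_iff _ |>.1 (h2 i (by simp [hij]))

theorem shift_mul (hS : IsCuntzFamily S) (x y : A) :
    shift S (x * y) = shift S x * shift S y := by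
  unfold shift
  rw [Finset.sum_mul_sum]
  refine Finset.sum_congr rfl fun i _ => ?_
  rw [Finset.sum_eq_single i]
  · calc S i * (x * y) * star (S i) = S i * x * (1 : A) * y * star (S i) := by
          simp only [mul_assoc, one_mul]
      _ = _ := by rw [← hS.isometry i]; simp only [mul_assoc]
  · intro j _ hj
    calc S i * x * star (S i) * (S j * y * star (S j))
        = S i * x * (star (S i) * S j) * y * star (S j) := by simp only [mul_assoc]
      _ = 0 := by rw [hS.orthogonal hj.symm]; simp
  · simp

/-- The shift as a unital `⋆`-endomorphism. -/
noncomputable def shiftHom (hS : IsCuntzFamily S) : A →⋆ₐ[ℂ] A where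
  toFun := shift S
  map_one' := by simp [shift, hS.sum_range]
  map_mul' := shift_mul hS
  map_zero' := by simp [shift]
  map_add' x y := by simp [shift, mul_add, add_mul, Finset.sum_add_distrib]
  commutes' c := by
    simp only [shift, Algebra.algebraMap_eq_smul_one, mul_smul_comm, smul_mul_assoc, mul_one]
    rw [← Finset.smul_sum, hS.sum_range]
  map_star' x := by simp [shift, star_sum, mul_assoc]

theorem shift_mem_diagonal (hS : IsCuntzFamily S) {x : A} (hx : x ∈ diagonal S) :
    shift S x ∈ diagonal S := by
  have hcont : Continuous (shift S) := by unfold shift; fun_prop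
  have hle : StarAlgebra.adjoin ℂ (Set.range (proj S)) ≤ (diagonal S).comap (shiftHom hS) := by
    rw [StarAlgebra.adjoin_le_iff]
    rintro _ ⟨μ, rfl⟩
    change shift S (proj S μ) ∈ diagonal S
    refine sum_mem fun i _ => ?_
    have : S i * proj S μ * star (S i) = proj S (i :: μ) := by
      simp [proj, word, mul_assoc]
    rw [this]
    exact StarSubalgebra.le_topologicalClosure _
      (StarAlgebra.subset_adjoin ℂ _ ⟨_, rfl⟩)
  have hcl : IsClosed (((diagonal S).comap (shiftHom hS) : StarSubalgebra ℂ A) : Set A) :=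
    (StarSubalgebra.isClosed_topologicalClosure _).preimage hcont
  exact StarSubalgebra.topologicalClosure_minimal hle hcl hx

/-- The restriction of the shift to the diagonal. -/
noncomputable def diagShift (hS : IsCuntzFamily S) (x : diagonal S) : diagonal S :=
  ⟨shift S x, shift_mem_diagonal hS x.2⟩

/-- Property (P): there is `m` with `α φᵏ(x) = φᵏ⁻ᵐ α φᵐ(x)` for all `k ≥ m` and all
`x ∈ 𝒟ₙ¹ = 𝒟ₙ ∩ ℱₙ¹`; that is, `α` eventually commutes with the shift. -/
def PropertyP (hS : IsCuntzFamily S) (α : diagonal S ≃⋆ₐ[ℂ] diagonal S) : Prop :=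
  ∃ m : ℕ, ∀ k ≥ m, ∀ x : diagonal S, (x : A) ∈ coreLevel S 1 →
    α ((diagShift hS)^[k] x) = (diagShift hS)^[k - m] (α ((diagShift hS)^[m] x))

/-- `𝔊ₙ`: the automorphisms `α` of `𝒟ₙ` such that both `α` and `α⁻¹` have property (P). -/
def eventuallyShiftCommuting (hS : IsCuntzFamily S) :
    Set (diagonal S ≃⋆ₐ[ℂ] diagonal S) :=
  {α | PropertyP hS α ∧ PropertyP hS α⁻¹}

end

section

variable {A : Type*} [CStarAlgebra A]

/-- `Aut(A, B)`: the automorphisms `α` of `A` with `α(B) = B`. -/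
def autPreserving (B : Set A) : Subgroup (A ≃⋆ₐ[ℂ] A) where
  carrier := {α | α '' B = B}
  one_mem' := by
    change (fun x : A => x) '' B = B
    simp
  mul_mem' {α β} hα hβ := by
    change (fun x : A => α (β x)) '' B = B
    rw [← Set.image_image, hβ, hα]
  inv_mem' {α} hα := by
    change (fun x : A => α.symm x) '' B = B
    conv_lhs => rw [← show α '' B = B from hα]
    rw [Set.image_image]
    simp

/-- `Aut_B(A)`: the automorphisms of `A` that fix `B` pointwise. -/
def autFixing (B : Set A) : Subgroup (A ≃⋆ₐ[ℂ] A) where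
  carrier := {α | ∀ x ∈ B, α x = x}
  one_mem' := fun _ _ => rfl
  mul_mem' {α β} hα hβ x hx := by
    change α (β x) = x
    rw [hβ x hx, hα x hx]
  inv_mem' {α} hα x hx := by
    change α.symm x = x
    conv_lhs => rw [← hα x hx]
    exact α.symm_apply_apply x

/-- Pointwise fixing automorphisms form a normal subgroup of any group of automorphisms that
preserve `B`. -/
instance autFixing_normal (B C : Set A) :
    ((autFixing B).subgroupOf (autPreserving B ⊓ autPreserving C)).Normal where
  conj_mem α hα β := by
    rw [Subgroup.mem_subgroupOf] at hα ⊢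
    intro x hx
    have hβ : (β : A ≃⋆ₐ[ℂ] A) '' B = B := β.2.1
    rw [← hβ] at hx
    obtain ⟨y, hy, rfl⟩ := hx
    change (β : A ≃⋆ₐ[ℂ] A) ((α : A ≃⋆ₐ[ℂ] A)
      ((β : A ≃⋆ₐ[ℂ] A).symm ((β : A ≃⋆ₐ[ℂ] A) y))) = (β : A ≃⋆ₐ[ℂ] A) y
    rw [StarAlgEquiv.symm_apply_apply, hα y hy]

end

/-- The restricted Weyl group of `𝒪ₙ`: the quotient of `Aut(𝒪ₙ, 𝒟ₙ) ∩ Aut(𝒪ₙ, ℱₙ)` by its normal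
subgroup of those automorphisms that fix `𝒟ₙ` pointwise. -/
abbrev RestrictedWeylGroup {n : ℕ} {A : Type*} [CStarAlgebra A] (S : Fin n → A) :=
  (autPreserving (diagonal S : Set A) ⊓ autPreserving (core S) : Subgroup (A ≃⋆ₐ[ℂ] A)) ⧸
    (autFixing (diagonal S : Set A)).subgroupOf
      (autPreserving (diagonal S : Set A) ⊓ autPreserving (core S))

end Cuntz

/-!
The proof has three ingredients.

**The core inside the Cuntz algebra.** The isometries `spread`, of the form `φᵏ(S_ν)` with `ν` free
of self-overlaps, commute with the `k`-th level of the core, and compressing by them kills all words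
`S_μ S_κ⋆` with `|μ| ≠ |κ|`, `|μ|, |κ| ≤ k`. In the algebra generated by the functions
`t ↦ e^{2πit} S_i` on the circle, these compressions thus compute averages over the circle. As the
average is faithful and `⋆`-homomorphisms are isometric on the core, every unital `⋆`-homomorphism of
the Cuntz algebra is injective (`injective_of_isCuntzFamily`). The universal property follows
(`exists_starAlgHom`), and with it the gauge action, whose fixed point algebra is the core
(`mem_core_iff_gauge`). On the commutant of the diagonal the compressions are multiplicative in the
limit, so the diagonal is maximal abelian (`mem_diagonal_of_commute`), and the core has trivial
relative commutant (`exists_eq_smul_one_of_commute`).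

**From automorphisms to property (P).** An endomorphism `α` has a unitary `u` with
`α(S_i) = u S_i`. If `α` is an automorphism that preserves the core, then `u⋆ γ_t(u)` commutes with
the core for each gauge automorphism `γ_t`, so that `u` is homogeneous for the gauge action. Since
the core is finite, the degree of `u` is zero and `u` lies in the core
(`mem_core_of_autPreserving`). Then so does `α⁻¹(u⋆)`, which therefore asymptotically commutes with
`φᵏ(P_i)`. If `α` also preserves the diagonal, the commuting projections `α(φᵏ⁺¹(P_i))` and
`φ(α(φᵏ(P_i)))` are at distance less than `1` for large `k`, hence equal
(`exists_map_shiftPow_proj`). This is property (P).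

**From property (P) to permutation unitaries.** Let `α` be an automorphism of the diagonal whose
inverse commutes with the shift on the range of `φᵐ`. If `α` extends to an endomorphism with
unitary `u`, then `u` conjugates `P_κ`, `κ = iμ` of length `m + 1`, to `Q_κ = α(P_i φ(α⁻¹(P_μ)))`,
and commutes with `φᵐ⁺¹(𝒟ₙ)`. Such a `u` exists: the `Q_κ` are locally constant, and a
count of cylinders shows that each `Q_κ φᵐ⁺¹(P_ρ)`, with `|ρ|` large, is one projection `P_{κ'ρ}`, so
`u` is found as a permutation of words (`exists_unitary_of_propertyP`, `exists_extension`).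

Permutation unitaries that commute with the diagonal are trivial (`PermutesWords.eq_one`). Hence an
element of `λ(𝒫ₙ)⁻¹` is determined by its restriction to the diagonal, the extensions of an
automorphism and of its inverse are inverse to each other, and `λ(𝒫ₙ)⁻¹` is closed under inverses.
Restriction therefore maps both `λ(𝒫ₙ)⁻¹` and `Aut(𝒪ₙ, 𝒟ₙ) ∩ Aut(𝒪ₙ, ℱₙ)` onto `𝔊ₙ`, injectively on
the former and with kernel `Aut_{𝒟ₙ}(𝒪ₙ)` on the latter.
-/

namespace Cuntz

/-! ### Words, the shift and the levels of the core -/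

section Words

variable {n : ℕ} {A : Type*} [CStarAlgebra A] {S : Fin n → A}

@[simp] theorem word_nil : word S [] = 1 := by simp [word]

theorem word_cons (i : Fin n) (μ : List (Fin n)) : word S (i :: μ) = S i * word S μ := by
  simp [word]

theorem word_append (μ ν : List (Fin n)) : word S (μ ++ ν) = word S μ * word S ν := by
  simp [word]

theorem star_word_mul_self (hS : IsCuntzFamily S) (μ : List (Fin n)) :
    star (word S μ) * word S μ = 1 := by
  induction μ with
  | nil => simp
  | cons i μ ih =>
    rw [word_cons, star_mul, mul_assoc, ← mul_assoc (star (S i)), hS.isometry, one_mul, ih]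

theorem star_word_mul_self_assoc (hS : IsCuntzFamily S) (μ : List (Fin n)) (x : A) :
    star (word S μ) * (word S μ * x) = x := by
  rw [← mul_assoc, star_word_mul_self hS, one_mul]

theorem star_word_mul_word_of_ne (hS : IsCuntzFamily S) {μ ν : List (Fin n)}
    (hl : μ.length = ν.length) (hne : μ ≠ ν) : star (word S μ) * word S ν = 0 := by
  induction μ generalizing ν with
  | nil => simp_all [eq_comm]
  | cons i μ ih =>
    match ν with
    | [] => simp at hl
    | j :: ν =>
      rw [word_cons, word_cons, star_mul, mul_assoc, ← mul_assoc (star (S i))]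
      by_cases hij : i = j
      · subst hij
        rw [hS.isometry, one_mul]
        exact ih (by simpa using hl) (by rintro rfl; exact hne rfl)
      · rw [hS.orthogonal hij, zero_mul, mul_zero]

theorem star_word_mul_word_of_ne_assoc (hS : IsCuntzFamily S) {μ ν : List (Fin n)}
    (hl : μ.length = ν.length) (hne : μ ≠ ν) (x : A) :
    star (word S μ) * (word S ν * x) = 0 := by
  rw [← mul_assoc, star_word_mul_word_of_ne hS hl hne, zero_mul]

theorem shift_mul_gen (hS : IsCuntzFamily S) (x : A) (i : Fin n) :
    shift S x * S i = S i * x := by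
  unfold shift
  rw [Finset.sum_mul, Finset.sum_eq_single i]
  · rw [mul_assoc, hS.isometry, mul_one]
  · intro j _ hj
    rw [mul_assoc, hS.orthogonal hj, mul_zero]
  · simp

/-- The power `φᵏ` of the canonical shift as a unital `⋆`-endomorphism. -/
noncomputable def shiftPow (hS : IsCuntzFamily S) : ℕ → A →⋆ₐ[ℂ] A
  | 0 => StarAlgHom.id ℂ A
  | k + 1 => (shiftHom hS).comp (shiftPow hS k)

@[simp] theorem shiftPow_zero (hS : IsCuntzFamily S) (x : A) : shiftPow hS 0 x = x := rfl

theorem shiftPow_succ (hS : IsCuntzFamily S) (k : ℕ) (x : A) :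
    shiftPow hS (k + 1) x = shift S (shiftPow hS k x) := rfl

theorem shiftPow_add (hS : IsCuntzFamily S) (j k : ℕ) (x : A) :
    shiftPow hS (j + k) x = shiftPow hS j (shiftPow hS k x) := by
  induction j with
  | zero => simp
  | succ j ih => rw [Nat.succ_add, shiftPow_succ, ih, shiftPow_succ]

theorem shiftPow_mul_word (hS : IsCuntzFamily S) (μ : List (Fin n)) (j : ℕ) (x : A) :
    shiftPow hS (μ.length + j) x * word S μ = word S μ * shiftPow hS j x := by
  induction μ with
  | nil => simp
  | cons i μ ih =>
    rw [List.length_cons, Nat.add_right_comm, shiftPow_succ, word_cons, ← mul_assoc,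
      shift_mul_gen hS, mul_assoc, ih, mul_assoc]

theorem shiftPow_mul_word_eq (hS : IsCuntzFamily S) {μ : List (Fin n)} {k : ℕ}
    (hμ : μ.length = k) (x : A) :
    shiftPow hS k x * word S μ = word S μ * x := by
  subst hμ; simpa using shiftPow_mul_word hS μ 0 x

theorem star_word_mul_shiftPow (hS : IsCuntzFamily S) (μ : List (Fin n)) (j : ℕ) (x : A) :
    star (word S μ) * shiftPow hS (μ.length + j) x = shiftPow hS j x * star (word S μ) := by
  have := congrArg star (shiftPow_mul_word hS μ j (star x))
  simpa only [star_mul, map_star, star_star] using this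

theorem star_word_mul_shiftPow_eq (hS : IsCuntzFamily S) {μ : List (Fin n)} {k : ℕ}
    (hμ : μ.length = k) (x : A) :
    star (word S μ) * shiftPow hS k x = x * star (word S μ) := by
  subst hμ; simpa using star_word_mul_shiftPow hS μ 0 x

/-- An element is determined by its products with the isometries `S_μ`, `|μ| = k`. -/
theorem eq_of_mul_word_eq (hS : IsCuntzFamily S) (k : ℕ) {x y : A}
    (h : ∀ μ : List (Fin n), μ.length = k → x * word S μ = y * word S μ) : x = y := by
  induction k generalizing x y with
  | zero => simpa using h [] rfl
  | succ k ih =>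
    have hi : ∀ i, x * S i = y * S i := fun i => ih fun μ hμ => by
      have := h (i :: μ) (by simp [hμ])
      simpa only [word_cons, mul_assoc] using this
    calc x = x * ∑ i, S i * star (S i) := by rw [hS.sum_range, mul_one]
      _ = y * ∑ i, S i * star (S i) := by
        simp only [Finset.mul_sum, ← mul_assoc, hi]
      _ = y := by rw [hS.sum_range, mul_one]

theorem eq_of_star_word_mul_eq (hS : IsCuntzFamily S) (k : ℕ) {x y : A}
    (h : ∀ μ : List (Fin n), μ.length = k → star (word S μ) * x = star (word S μ) * y) :
    x = y := by
  refine star_injective (eq_of_mul_word_eq hS k fun μ hμ => ?_)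
  have := congrArg star (h μ hμ)
  simpa only [star_mul, star_star] using this

theorem eq_of_star_word_mul_mul_word_eq (hS : IsCuntzFamily S) (k : ℕ) {x y : A}
    (h : ∀ μ ν : List (Fin n), μ.length = k → ν.length = k →
      star (word S μ) * x * word S ν = star (word S μ) * y * word S ν) : x = y :=
  eq_of_mul_word_eq hS k fun ν hν => eq_of_star_word_mul_eq hS k fun μ hμ => by
    simpa only [mul_assoc] using h μ ν hμ hν

variable (n) in
/-- The finite set of multi-indices of length `k`. -/
def words (k : ℕ) : Finset (List (Fin n)) :=
  Finset.univ.image fun f : Fin k → Fin n => List.ofFn f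

@[simp] theorem mem_words {k : ℕ} {μ : List (Fin n)} : μ ∈ words n k ↔ μ.length = k := by
  constructor
  · intro h
    obtain ⟨f, -, rfl⟩ := Finset.mem_image.1 h
    simp
  · rintro rfl
    exact Finset.mem_image.2 ⟨μ.get, Finset.mem_univ _, List.ofFn_get μ⟩

theorem sum_words_mul_word (hS : IsCuntzFamily S) (k : ℕ) (f : List (Fin n) → A)
    {ν : List (Fin n)} (hν : ν.length = k) :
    (∑ μ ∈ words n k, f μ * star (word S μ)) * word S ν = f ν := by
  rw [Finset.sum_mul, Finset.sum_eq_single ν]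
  · rw [mul_assoc, star_word_mul_self hS, mul_one]
  · intro μ hμ hne
    rw [mul_assoc, star_word_mul_word_of_ne hS ((mem_words.1 hμ).trans hν.symm) hne, mul_zero]
  · simp [hν]

theorem eq_sum_words (hS : IsCuntzFamily S) (k : ℕ) (x : A) :
    x = ∑ μ ∈ words n k, x * word S μ * star (word S μ) :=
  eq_of_mul_word_eq hS k fun _ hν =>
    (sum_words_mul_word hS k (fun μ => x * word S μ) hν).symm

theorem sum_words_conj (hS : IsCuntzFamily S) (k : ℕ) (x : A) :
    ∑ μ ∈ words n k, word S μ * x * star (word S μ) = shiftPow hS k x :=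
  eq_of_mul_word_eq hS k fun ν hν => by
    rw [sum_words_mul_word hS k (fun μ => word S μ * x) hν, shiftPow_mul_word_eq hS hν]

theorem sum_words_proj (hS : IsCuntzFamily S) (k : ℕ) :
    ∑ μ ∈ words n k, proj S μ = 1 := by
  have := sum_words_conj hS k 1
  simpa [proj] using this

theorem word_mul_star_word_mem_coreLevel {k : ℕ} {μ ν : List (Fin n)} (hμ : μ.length = k)
    (hν : ν.length = k) : word S μ * star (word S ν) ∈ coreLevel S k :=
  Submodule.subset_span ⟨μ, ν, hμ, hν, rfl⟩

/-- An element lies in the `k`-th level iff all its matrix coefficients `S_μ⋆ x S_ν` are scalar. -/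
theorem mem_coreLevel_iff (hS : IsCuntzFamily S) {k : ℕ} {x : A} :
    x ∈ coreLevel S k ↔ ∀ μ ν : List (Fin n), μ.length = k → ν.length = k →
      ∃ c : ℂ, star (word S μ) * x * word S ν = c • 1 := by
  constructor
  · intro hx μ ν hμ hν
    induction hx using Submodule.span_induction with
    | mem x hx =>
      obtain ⟨κ, ρ, hκ, hρ, rfl⟩ := hx
      rw [mul_assoc, mul_assoc]
      by_cases h1 : μ = κ
      · subst h1
        rw [star_word_mul_self_assoc hS]
        by_cases h2 : ρ = ν
        · subst h2
          exact ⟨1, by rw [star_word_mul_self hS, one_smul]⟩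
        · exact ⟨0, by rw [star_word_mul_word_of_ne hS (hρ.trans hν.symm) h2, zero_smul]⟩
      · exact ⟨0, by rw [star_word_mul_word_of_ne_assoc hS (hμ.trans hκ.symm) h1, zero_smul]⟩
    | zero => exact ⟨0, by simp⟩
    | add x y _ _ hx hy =>
      obtain ⟨c, hc⟩ := hx
      obtain ⟨d, hd⟩ := hy
      exact ⟨c + d, by rw [mul_add, add_mul, hc, hd, add_smul]⟩
    | smul a x _ hx =>
      obtain ⟨c, hc⟩ := hx
      exact ⟨a * c, by rw [mul_smul_comm, smul_mul_assoc, hc, mul_smul]⟩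
  · intro h
    choose! c hc using h
    have : x = ∑ μ ∈ words n k, ∑ ν ∈ words n k, c μ ν • (word S μ * star (word S ν)) := by
      refine eq_of_star_word_mul_mul_word_eq hS k fun μ ν hμ hν => ?_
      have key : (∑ μ ∈ words n k, ∑ ν ∈ words n k, c μ ν • (word S μ * star (word S ν)))
          * word S ν = ∑ μ ∈ words n k, c μ ν • word S μ := by
        rw [Finset.sum_mul]
        refine Finset.sum_congr rfl fun κ _ => ?_
        simpa only [smul_mul_assoc] using
          sum_words_mul_word hS k (c κ · • word S κ) hν
      rw [hc μ ν hμ hν, mul_assoc, key, Finset.mul_sum, Finset.sum_eq_single μ]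
      · rw [mul_smul_comm, star_word_mul_self hS]
      · intro κ hκ hne
        rw [mul_smul_comm, star_word_mul_word_of_ne hS (hμ.trans (mem_words.1 hκ).symm) hne.symm,
          smul_zero]
      · simp [hμ]
    rw [this]
    refine sum_mem fun μ hμ => sum_mem fun ν hν => Submodule.smul_mem _ _ ?_
    exact word_mul_star_word_mem_coreLevel (mem_words.1 hμ) (mem_words.1 hν)

theorem coreLevel_succ_mono (hS : IsCuntzFamily S) (k : ℕ) :
    coreLevel S k ≤ coreLevel S (k + 1) := by
  refine Submodule.span_le.2 ?_
  rintro _ ⟨μ, ν, hμ, hν, rfl⟩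
  have : word S μ * star (word S ν)
      = ∑ i, word S (μ ++ [i]) * star (word S (ν ++ [i])) := by
    calc word S μ * star (word S ν)
        = word S μ * (∑ i, S i * star (S i)) * star (word S ν) := by rw [hS.sum_range, mul_one]
      _ = _ := by
        simp only [Finset.mul_sum, Finset.sum_mul, word_append, word_cons, word_nil, mul_one,
          star_mul, mul_assoc]
  rw [this]
  exact sum_mem fun i _ => word_mul_star_word_mem_coreLevel (by simp [hμ]) (by simp [hν])

theorem coreLevel_mono (hS : IsCuntzFamily S) : Monotone (coreLevel S) :=
  monotone_nat_of_le_succ (coreLevel_succ_mono hS)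

/-- The `k`-th level of the core as a `⋆`-subalgebra. -/
noncomputable def coreLevelAlg (hS : IsCuntzFamily S) (k : ℕ) : StarSubalgebra ℂ A where
  carrier := coreLevel S k
  mul_mem' {x y} hx hy := by
    induction hx using Submodule.span_induction with
    | mem x hx =>
      obtain ⟨κ, ρ, hκ, hρ, rfl⟩ := hx
      induction hy using Submodule.span_induction with
      | mem y hy =>
        obtain ⟨σ, τ, hσ, hτ, rfl⟩ := hy
        rw [mul_assoc]
        by_cases h : ρ = σ
        · subst h
          rw [star_word_mul_self_assoc hS]
          exact word_mul_star_word_mem_coreLevel hκ hτ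
        · rw [star_word_mul_word_of_ne_assoc hS (hρ.trans hσ.symm) h, mul_zero]
          exact zero_mem _
      | zero => rw [mul_zero]; exact zero_mem _
      | add y z _ _ hy hz => rw [mul_add]; exact add_mem hy hz
      | smul a y _ hy => rw [mul_smul_comm]; exact Submodule.smul_mem _ _ hy
    | zero => rw [zero_mul]; exact zero_mem _
    | add y z _ _ hy hz => rw [add_mul]; exact add_mem hy hz
    | smul a y _ hy => rw [smul_mul_assoc]; exact Submodule.smul_mem _ _ hy
  add_mem' hx hy := add_mem hx hy
  algebraMap_mem' c := by
    rw [Algebra.algebraMap_eq_smul_one, ← sum_words_proj hS k]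
    exact Submodule.smul_mem _ _ (sum_mem fun μ hμ =>
      word_mul_star_word_mem_coreLevel (mem_words.1 hμ) (mem_words.1 hμ))
  star_mem' {x} hx := by
    induction hx using Submodule.span_induction with
    | mem x hx =>
      obtain ⟨κ, ρ, hκ, hρ, rfl⟩ := hx
      rw [star_mul, star_star]
      exact word_mul_star_word_mem_coreLevel hρ hκ
    | zero => rw [star_zero]; exact zero_mem _
    | add y z _ _ hy hz => rw [star_add]; exact add_mem hy hz
    | smul a y _ hy => rw [star_smul]; exact Submodule.smul_mem _ _ hy

/-- The levels of the core commute with the range of high powers of the shift. -/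
theorem commute_coreLevel_shiftPow (hS : IsCuntzFamily S) {k j : ℕ} (hkj : k ≤ j) {x : A}
    (hx : x ∈ coreLevel S k) (y : A) : Commute x (shiftPow hS j y) := by
  obtain ⟨j, rfl⟩ := Nat.exists_eq_add_of_le hkj
  induction hx using Submodule.span_induction with
  | mem x hx =>
    obtain ⟨κ, ρ, hκ, hρ, rfl⟩ := hx
    have h1 := star_word_mul_shiftPow hS ρ j y
    have h2 := shiftPow_mul_word hS κ j y
    rw [hρ] at h1
    rw [hκ] at h2
    rw [commute_iff_eq, mul_assoc, h1, ← mul_assoc, ← h2, mul_assoc]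
  | zero => exact Commute.zero_left _
  | add y z _ _ hy hz => exact hy.add_left hz
  | smul a y _ hy => exact hy.smul_left a

/-- The union of the levels of the core as a `⋆`-subalgebra. -/
noncomputable def coreUnion (hS : IsCuntzFamily S) : StarSubalgebra ℂ A where
  carrier := ⋃ k, (coreLevel S k : Set A)
  mul_mem' {x y} hx hy := by
    obtain ⟨k, hk⟩ := Set.mem_iUnion.1 hx
    obtain ⟨l, hl⟩ := Set.mem_iUnion.1 hy
    exact Set.mem_iUnion.2 ⟨max k l, (coreLevelAlg hS _).mul_mem
      (coreLevel_mono hS (le_max_left k l) hk) (coreLevel_mono hS (le_max_right k l) hl)⟩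
  add_mem' {x y} hx hy := by
    obtain ⟨k, hk⟩ := Set.mem_iUnion.1 hx
    obtain ⟨l, hl⟩ := Set.mem_iUnion.1 hy
    exact Set.mem_iUnion.2 ⟨max k l, (coreLevelAlg hS _).add_mem
      (coreLevel_mono hS (le_max_left k l) hk) (coreLevel_mono hS (le_max_right k l) hl)⟩
  algebraMap_mem' c := Set.mem_iUnion.2 ⟨0, (coreLevelAlg hS 0).algebraMap_mem c⟩
  star_mem' {x} hx := by
    obtain ⟨k, hk⟩ := Set.mem_iUnion.1 hx
    exact Set.mem_iUnion.2 ⟨k, (coreLevelAlg hS k).star_mem' hk⟩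

/-- The core `ℱₙ` as a closed `⋆`-subalgebra. -/
noncomputable def coreAlg (hS : IsCuntzFamily S) : StarSubalgebra ℂ A :=
  (coreUnion hS).topologicalClosure

theorem isClosed_coreAlg (hS : IsCuntzFamily S) : IsClosed (coreAlg hS : Set A) :=
  isClosed_closure

theorem coreLevel_subset_core {k : ℕ} {x : A} (hx : x ∈ coreLevel S k) : x ∈ core S :=
  subset_closure (Set.mem_iUnion.2 ⟨k, hx⟩)

theorem exists_coreLevel_norm_sub_lt {x : A} (hx : x ∈ core S) {ε : ℝ} (hε : 0 < ε) :
    ∃ k, ∃ y ∈ coreLevel S k, ‖x - y‖ < ε := by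
  obtain ⟨y, hy, hxy⟩ := Metric.mem_closure_iff.1 hx ε hε
  obtain ⟨k, hk⟩ := Set.mem_iUnion.1 hy
  exact ⟨k, y, hk, by rwa [← dist_eq_norm]⟩

theorem proj_mem_diagonal (μ : List (Fin n)) : proj S μ ∈ diagonal S :=
  StarSubalgebra.le_topologicalClosure _ (StarAlgebra.subset_adjoin ℂ _ ⟨_, rfl⟩)

theorem isClosed_diagonal : IsClosed (diagonal S : Set A) :=
  StarSubalgebra.isClosed_topologicalClosure _

theorem diagonal_le {B : StarSubalgebra ℂ A} (hB : IsClosed (B : Set A))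
    (h : ∀ μ, proj S μ ∈ B) : diagonal S ≤ B :=
  StarSubalgebra.topologicalClosure_minimal
    (StarAlgebra.adjoin_le (by rintro _ ⟨μ, rfl⟩; exact h μ)) hB

theorem diagonal_le_coreAlg (hS : IsCuntzFamily S) : diagonal S ≤ coreAlg hS :=
  diagonal_le (isClosed_coreAlg hS) fun _ =>
    coreLevel_subset_core (word_mul_star_word_mem_coreLevel rfl rfl)

theorem star_proj (μ : List (Fin n)) : star (proj S μ) = proj S μ := by
  simp [proj]

theorem proj_mul_word_append (hS : IsCuntzFamily S) (μ ν : List (Fin n)) :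
    proj S μ * word S (μ ++ ν) = word S (μ ++ ν) := by
  rw [proj, word_append, mul_assoc, star_word_mul_self_assoc hS]

theorem proj_mul_word_append_of_ne (hS : IsCuntzFamily S) {μ κ : List (Fin n)}
    (hl : μ.length = κ.length) (hne : μ ≠ κ) (ν : List (Fin n)) :
    proj S μ * word S (κ ++ ν) = 0 := by
  rw [proj, word_append, mul_assoc, star_word_mul_word_of_ne_assoc hS hl hne, mul_zero]

theorem commute_proj_proj (hS : IsCuntzFamily S) (μ ν : List (Fin n)) :
    Commute (proj S μ) (proj S ν) := by
  wlog h : μ.length ≤ ν.length generalizing μ ν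
  · exact (this ν μ (le_of_not_ge h)).symm
  obtain ⟨κ, ρ, rfl, hκ⟩ : ∃ κ ρ, ν = κ ++ ρ ∧ μ.length = κ.length :=
    ⟨ν.take μ.length, ν.drop μ.length, (List.take_append_drop _ _).symm, by simp [h]⟩
  have key : proj S μ * proj S (κ ++ ρ) = proj S (κ ++ ρ) ∨
      proj S μ * proj S (κ ++ ρ) = 0 := by
    by_cases hne : μ = κ
    · subst hne
      exact Or.inl (by
        rw [proj, proj, ← mul_assoc]; exact congrArg (· * _) (proj_mul_word_append hS μ ρ))
    · right
      change proj S μ * (word S (κ ++ ρ) * _) = 0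
      rw [← mul_assoc, proj_mul_word_append_of_ne hS hκ hne, zero_mul]
  rcases key with h1 | h1
  · have h2 := congrArg star h1
    rw [star_mul, star_proj, star_proj] at h2
    exact h1.trans h2.symm
  · have h2 := congrArg star h1
    rw [star_mul, star_proj, star_proj, star_zero] at h2
    exact h1.trans h2.symm

theorem diagonal_commute (hS : IsCuntzFamily S) {x y : A} (hx : x ∈ diagonal S)
    (hy : y ∈ diagonal S) : Commute x y := by
  have hc : ∀ s : Set A, IsClosed (StarSubalgebra.centralizer ℂ s : Set A) := fun s => by
    rw [StarSubalgebra.coe_centralizer]; exact Set.isClosed_centralizer _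
  have h1 : diagonal S ≤ StarSubalgebra.centralizer ℂ (Set.range (proj S)) :=
    diagonal_le (hc _) fun μ => by
      rw [StarSubalgebra.mem_centralizer_iff]
      rintro _ ⟨ν, rfl⟩
      rw [star_proj]
      exact ⟨commute_proj_proj hS ν μ, commute_proj_proj hS ν μ⟩
  have h2 : diagonal S ≤ StarSubalgebra.centralizer ℂ (diagonal S : Set A) :=
    diagonal_le (hc _) fun μ => by
      rw [StarSubalgebra.mem_centralizer_iff]
      intro z hz
      have hz' := (StarSubalgebra.mem_centralizer_iff ℂ).1 (h1 hz) _ ⟨μ, rfl⟩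
      have hzs := (StarSubalgebra.mem_centralizer_iff ℂ).1 (h1 (star_mem hz)) _ ⟨μ, rfl⟩
      exact ⟨hz'.1.symm, hzs.1.symm⟩
  exact ((StarSubalgebra.mem_centralizer_iff ℂ).1 (h2 hy) x hx).1

/-- The isometry `φᵏ(S_ν)` with `ν = o⋯oe` (`k` letters `o`, then one letter `e`). It commutes with
the `k`-th level of the core. As `ν` does not overlap with its proper translates, the compression
by it kills all words `S_μ S_κ⋆` with `|μ| ≠ |κ|`, `|μ|, |κ| ≤ k`. -/
noncomputable def spread (hS : IsCuntzFamily S) (o e : Fin n) (k : ℕ) : A :=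
  shiftPow hS k (word S (List.replicate k o ++ [e]))

theorem star_spread_mul_self (hS : IsCuntzFamily S) (o e : Fin n) (k : ℕ) :
    star (spread hS o e k) * spread hS o e k = 1 := by
  rw [spread, ← map_star, ← map_mul, star_word_mul_self hS, map_one]

theorem norm_le_one_of_isometry {v : A} (hv : star v * v = 1) : ‖v‖ ≤ 1 := by
  rcases subsingleton_or_nontrivial A with _ | _
  · simp [Subsingleton.elim v 0]
  · have h := CStarRing.norm_star_mul_self (x := v)
    rw [hv, norm_one] at h
    nlinarith [norm_nonneg v]

theorem norm_star_mul_mul_le {v : A} (hv : ‖v‖ ≤ 1) (x : A) : ‖star v * x * v‖ ≤ ‖x‖ := by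
  calc ‖star v * x * v‖ ≤ ‖star v‖ * ‖x‖ * ‖v‖ :=
        (norm_mul_le _ _).trans (by gcongr; exact norm_mul_le _ _)
    _ ≤ 1 * ‖x‖ * 1 := by
        have := norm_star v
        gcongr
        rw [this]; exact hv
    _ = ‖x‖ := by ring

theorem norm_mul_mul_star_le {v : A} (hv : ‖v‖ ≤ 1) (x : A) : ‖v * x * star v‖ ≤ ‖x‖ := by
  have := norm_star_mul_mul_le (v := star v) (by rwa [norm_star]) x
  rwa [star_star] at this

theorem star_word_mul_shiftPow_word (hS : IsCuntzFamily S) {o e : Fin n} (hoe : o ≠ e) {k d : ℕ}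
    (hd : d + 1 ≤ k) :
    star (word S (List.replicate k o ++ [e])) *
      shiftPow hS (d + 1) (word S (List.replicate k o ++ [e])) = 0 := by
  obtain ⟨r, rfl⟩ := Nat.exists_eq_add_of_le hd
  have hsplit : List.replicate (d + 1 + r) o ++ [e]
      = List.replicate (d + 1) o ++ (List.replicate r o ++ [e]) := by
    rw [← List.append_assoc, List.replicate_append_replicate]
  have hsplit2 : List.replicate (d + 1 + r) o ++ [e]
      = (List.replicate r o ++ [o]) ++ (List.replicate d o ++ [e]) := by
    have h1 : d + 1 + r = r + (1 + d) := by ring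
    rw [h1, List.append_assoc, ← List.append_assoc [o], ← List.replicate_append_replicate,
      ← List.replicate_append_replicate, List.append_assoc]
    rfl
  have hlen : (List.replicate (d + 1) o).length = d + 1 := by simp
  conv_lhs => enter [1, 1]; rw [hsplit, word_append]
  rw [star_mul, mul_assoc, star_word_mul_shiftPow_eq hS hlen, ← mul_assoc, hsplit2,
    word_append (List.replicate r o ++ [o]), ← mul_assoc,
    star_word_mul_word_of_ne hS (by simp) (by simp [hoe.symm]), zero_mul, zero_mul]

theorem star_spread_mul_coreLevel (hS : IsCuntzFamily S) (o e : Fin n) {k : ℕ} {x : A}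
    (hx : x ∈ coreLevel S k) :
    star (spread hS o e k) * x * spread hS o e k = x := by
  have h : x * spread hS o e k = spread hS o e k * x :=
    commute_coreLevel_shiftPow hS le_rfl hx _
  rw [mul_assoc, h, ← mul_assoc, star_spread_mul_self, one_mul]

theorem star_spread_mul_word_mul_spread (hS : IsCuntzFamily S) {o e : Fin n} (hoe : o ≠ e)
    {k : ℕ} {μ ν : List (Fin n)} (hμ : μ.length ≤ k) (hν : ν.length ≤ k)
    (hne : μ.length ≠ ν.length) :
    star (spread hS o e k) * (word S μ * star (word S ν)) * spread hS o e k = 0 := by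
  wlog h : ν.length < μ.length generalizing μ ν
  · have := congrArg star (this hν hμ hne.symm (by omega))
    simpa only [star_mul, star_star, star_zero, mul_assoc] using this
  obtain ⟨w, hw⟩ : ∃ w, w = word S (List.replicate k o ++ [e]) := ⟨_, rfl⟩
  have hsp : spread hS o e k = shiftPow hS k w := by rw [hw]; rfl
  obtain ⟨i, hi⟩ := Nat.exists_eq_add_of_le hμ
  obtain ⟨d, hd⟩ := Nat.exists_eq_add_of_lt h
  have h0 : star w * shiftPow hS (d + 1) w = 0 := by
    rw [hw]; exact star_word_mul_shiftPow_word hS hoe (by omega)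
  have hj : k = ν.length + (i + (d + 1)) := by omega
  have h1 : star (shiftPow hS k w) * word S μ = word S μ * star (shiftPow hS i w) := by
    rw [← map_star, ← map_star, hi, shiftPow_mul_word]
  have h2 : star (word S ν) * shiftPow hS k w
      = shiftPow hS (i + (d + 1)) w * star (word S ν) := by
    rw [hj, star_word_mul_shiftPow]
  rw [hsp, ← mul_assoc, h1, mul_assoc, h2, mul_assoc, ← mul_assoc (star _), shiftPow_add,
    ← map_star, ← map_mul, h0]
  simp

/-- The linear span of all words `S_μ S_ν⋆` is dense. -/
theorem mem_of_word_mem (hS : IsCuntzFamily S) {M : Submodule ℂ A} (hM : IsClosed (M : Set A))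
    (h : ∀ μ ν, word S μ * star (word S ν) ∈ M) (x : A) : x ∈ M := by
  set W : Submodule ℂ A :=
    Submodule.span ℂ (Set.range fun p : List (Fin n) × List (Fin n) =>
      word S p.1 * star (word S p.2)) with hW
  have hword : ∀ μ ν, word S μ * star (word S ν) ∈ W := fun μ ν =>
    Submodule.subset_span ⟨(μ, ν), rfl⟩
  have hWM : W ≤ M := Submodule.span_le.2 (by rintro _ ⟨p, rfl⟩; exact h _ _)
  have hww : ∀ μ ν κ ρ : List (Fin n),
      word S μ * star (word S ν) * (word S κ * star (word S ρ)) ∈ W := by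
    intro μ ν κ ρ
    rcases le_total ν.length κ.length with hl | hl
    · obtain ⟨κ, σ, rfl, hκ⟩ : ∃ κ' σ, κ = κ' ++ σ ∧ ν.length = κ'.length :=
        ⟨κ.take ν.length, κ.drop ν.length, (List.take_append_drop _ _).symm, by simp [hl]⟩
      rw [word_append, mul_assoc, mul_assoc]
      by_cases hne : ν = κ
      · subst hne
        rw [star_word_mul_self_assoc hS, ← mul_assoc, ← word_append]
        exact hword _ _
      · rw [star_word_mul_word_of_ne_assoc hS hκ hne, mul_zero]
        exact zero_mem _
    · obtain ⟨ν, σ, rfl, hν⟩ : ∃ ν' σ, ν = ν' ++ σ ∧ ν'.length = κ.length :=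
        ⟨ν.take κ.length, ν.drop κ.length, (List.take_append_drop _ _).symm, by simp [hl]⟩
      rw [word_append, star_mul, mul_assoc, mul_assoc]
      by_cases hne : ν = κ
      · subst hne
        rw [star_word_mul_self_assoc hS, ← star_mul, ← word_append]
        exact hword _ _
      · rw [star_word_mul_word_of_ne_assoc hS hν hne, mul_zero, mul_zero]
        exact zero_mem _
  have hmul : ∀ y ∈ W, ∀ z ∈ W, y * z ∈ W := by
    intro y hy z hz
    induction hy using Submodule.span_induction with
    | mem y hy =>
      obtain ⟨p, rfl⟩ := hy
      induction hz using Submodule.span_induction with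
      | mem z hz =>
        obtain ⟨q, rfl⟩ := hz
        exact hww _ _ _ _
      | zero => rw [mul_zero]; exact zero_mem _
      | add y z _ _ hy hz => rw [mul_add]; exact add_mem hy hz
      | smul a y _ hy => rw [mul_smul_comm]; exact Submodule.smul_mem _ _ hy
    | zero => rw [zero_mul]; exact zero_mem _
    | add y z _ _ hy hz => rw [add_mul]; exact add_mem hy hz
    | smul a y _ hy => rw [smul_mul_assoc]; exact Submodule.smul_mem _ _ hy
  have hstar : ∀ y ∈ W, star y ∈ W := by
    intro y hy
    induction hy using Submodule.span_induction with
    | mem y hy =>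
      obtain ⟨p, rfl⟩ := hy
      simp only [star_mul, star_star]
      exact hword _ _
    | zero => rw [star_zero]; exact zero_mem _
    | add y z _ _ hy hz => rw [star_add]; exact add_mem hy hz
    | smul a y _ hy => rw [star_smul]; exact Submodule.smul_mem _ _ hy
  have hx : x ∈ (StarAlgebra.adjoin ℂ (Set.range S)).topologicalClosure := by
    rw [hS.generates]; trivial
  refine closure_minimal (s := (StarAlgebra.adjoin ℂ (Set.range S) : Set A)) ?_ hM hx
  intro y hy
  refine hWM ?_
  induction hy using StarAlgebra.adjoin_induction with
  | mem y hy =>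
    obtain ⟨i, rfl⟩ := hy
    simpa [word_cons] using hword [i] []
  | algebraMap c =>
    rw [Algebra.algebraMap_eq_smul_one]
    exact Submodule.smul_mem _ _ (by simpa using hword [] [])
  | add y z _ _ hy hz => exact add_mem hy hz
  | mul y z _ _ hy hz => exact hmul y hy z hz
  | star y _ hy => exact hstar y hy

end Words

/-! ### Averaging over the circle -/

section Average

open MeasureTheory AddCircle

variable {A : Type*} [CStarAlgebra A]

/-- The average of a continuous function on the circle `ℝ / ℤ`. -/
noncomputable def circleAverage (f : C(AddCircle (1 : ℝ), A)) : A :=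
  ∫ t, f t ∂haarAddCircle

theorem integrable_circle (f : C(AddCircle (1 : ℝ), A)) : Integrable f haarAddCircle :=
  f.continuous.integrable_of_hasCompactSupport (HasCompactSupport.of_compactSpace _)

theorem circleAverage_add (f g : C(AddCircle (1 : ℝ), A)) :
    circleAverage (f + g) = circleAverage f + circleAverage g :=
  integral_add (integrable_circle f) (integrable_circle g)

theorem circleAverage_smul (c : ℂ) (f : C(AddCircle (1 : ℝ), A)) :
    circleAverage (c • f) = c • circleAverage f :=
  integral_smul c f

theorem norm_circleAverage_le (f : C(AddCircle (1 : ℝ), A)) : ‖circleAverage f‖ ≤ ‖f‖ := by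
  have h := norm_integral_le_of_norm_le_const (μ := haarAddCircle (T := (1 : ℝ)))
    (f := f) (C := ‖f‖) (Filter.Eventually.of_forall f.norm_coe_le_norm)
  simpa [circleAverage] using h

theorem circleAverage_sub (f g : C(AddCircle (1 : ℝ), A)) :
    circleAverage (f - g) = circleAverage f - circleAverage g :=
  integral_sub (integrable_circle f) (integrable_circle g)

theorem continuous_circleAverage :
    Continuous (circleAverage : C(AddCircle (1 : ℝ), A) → A) := by
  refine LipschitzWith.continuous (K := 1) (LipschitzWith.of_dist_le_mul fun f g => ?_)
  rw [dist_eq_norm, dist_eq_norm, ← circleAverage_sub, NNReal.coe_one, one_mul]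
  exact norm_circleAverage_le _

theorem circleAverage_const_of_forall_eq {f : C(AddCircle (1 : ℝ), A)} {x : A}
    (h : ∀ t, f t = x) : circleAverage f = x := by
  simp [circleAverage, h]

theorem integral_fourier_of_ne_zero {d : ℤ} (hd : d ≠ 0) :
    ∫ t : AddCircle (1 : ℝ), (fourier d t : ℂ) ∂haarAddCircle = 0 := by
  have h1 := integral_add_right_eq_self (μ := haarAddCircle (T := (1 : ℝ)))
    (fun t => (fourier d t : ℂ)) (((1 : ℝ) / 2 / d : ℝ) : AddCircle (1 : ℝ))
  simp only [fourier_add_half_inv_index hd one_pos, integral_neg] at h1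
  exact self_eq_neg.1 h1.symm

/-- A continuous function with values in a `C⋆`-algebra vanishes if the average of `f⋆ f` does. -/
theorem eq_zero_of_circleAverage_star_mul_self {f : C(AddCircle (1 : ℝ), A)}
    (h : circleAverage (star f * f) = 0) : f = 0 := by
  let _ := CStarAlgebra.spectralOrder A
  let _ := CStarAlgebra.spectralOrderedRing A
  ext t₀
  set g : C(AddCircle (1 : ℝ), A) := star f * f with hg
  have hpos : ∀ t, 0 ≤ g t := fun t => star_mul_self_nonneg (f t)
  suffices hz : g t₀ = 0 from CStarRing.star_mul_self_eq_zero_iff _ |>.1 hz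
  have hset : ∀ U : Set (AddCircle (1 : ℝ)), MeasurableSet U →
      ∫ t in U, g t ∂haarAddCircle = 0 := by
    intro U hU
    have h1 : 0 ≤ ∫ t in U, g t ∂haarAddCircle := integral_nonneg fun t => hpos t
    have h2 : 0 ≤ ∫ t in Uᶜ, g t ∂haarAddCircle := integral_nonneg fun t => hpos t
    have h3 := integral_add_compl hU (integrable_circle g)
    have h4 : ∫ t, g t ∂haarAddCircle = 0 := h
    rw [h4] at h3
    exact le_antisymm (by rw [← h3]; exact le_add_of_nonneg_right h2) h1
  have hae : (g : AddCircle (1 : ℝ) → A) =ᵐ[haarAddCircle] 0 :=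
    (integrable_circle g).ae_eq_zero_of_forall_setIntegral_eq_zero fun s hs _ => hset s hs
  have : (g : AddCircle (1 : ℝ) → A) = 0 :=
    Continuous.ae_eq_iff_eq haarAddCircle g.continuous continuous_zero |>.1 hae
  exact congrFun this t₀

end Average

/-! ### Simplicity and the universal property -/

section Simple

open Filter Topology AddCircle

variable {n : ℕ} {A : Type*} [CStarAlgebra A] {S : Fin n → A}

theorem continuous_starAlgHom {B : Type*} [CStarAlgebra B] (ρ : A →⋆ₐ[ℂ] B) : Continuous ρ :=
  AddMonoidHomClass.continuous_of_bound ρ 1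
    (by simpa only [one_mul] using NonUnitalStarAlgHom.norm_apply_le ρ)

/-- A unital `⋆`-homomorphism is isometric on the core, because its levels are full matrix
algebras, on which it is injective. -/
theorem norm_map_of_mem_core (hS : IsCuntzFamily S) {B : Type*} [CStarAlgebra B] [Nontrivial B]
    (ρ : A →⋆ₐ[ℂ] B) {x : A} (hx : x ∈ core S) : ‖ρ x‖ = ‖x‖ := by
  have hcont := continuous_starAlgHom ρ
  refine closure_minimal (t := {x | ‖ρ x‖ = ‖x‖}) ?_
    (isClosed_eq hcont.norm continuous_norm) hx
  refine Set.iUnion_subset fun k y hy => ?_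
  have : FiniteDimensional ℂ (coreLevel S k) := by
    refine FiniteDimensional.span_of_finite ℂ
      (((words n k).finite_toSet.prod (words n k).finite_toSet).image
        (fun p => word S p.1 * star (word S p.2)) |>.subset ?_)
    rintro _ ⟨μ, ν, hμ, hν, rfl⟩
    exact ⟨(μ, ν), ⟨by simpa using hμ, by simpa using hν⟩, rfl⟩
  have : IsClosed (coreLevelAlg hS k : Set A) :=
    Submodule.closed_of_finiteDimensional (coreLevel S k)
  let ρk : coreLevelAlg hS k →⋆ₐ[ℂ] B := ρ.comp (coreLevelAlg hS k).subtype
  have hinj : Function.Injective ρk := by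
    rw [injective_iff_map_eq_zero]
    rintro ⟨z, hz⟩ hρz
    replace hρz : ρ z = 0 := hρz
    refine Subtype.ext (eq_of_star_word_mul_mul_word_eq hS k fun μ ν hμ hν => ?_)
    obtain ⟨c, hc⟩ := (mem_coreLevel_iff hS).1 hz μ ν hμ hν
    have h0 : ρ (star (word S μ) * z * word S ν) = 0 := by
      rw [map_mul, map_mul, hρz, mul_zero, zero_mul]
    rw [hc, map_smul, map_one, smul_eq_zero_iff_left one_ne_zero] at h0
    change star (word S μ) * z * word S ν = star (word S μ) * 0 * word S ν
    rw [hc, h0]; simp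
  exact NonUnitalStarAlgHom.norm_map ρk hinj ⟨y, hy⟩

/-- A family that satisfies the Cuntz relations, in the closed `⋆`-subalgebra it generates. -/
theorem isCuntzFamily_codRestrict {B : Type*} [CStarAlgebra B] {T : Fin n → B}
    (h1 : ∀ i, star (T i) * T i = 1) (h2 : ∑ i, T i * star (T i) = 1)
    {C : StarSubalgebra ℂ B} [hCc : IsClosed (C : Set B)]
    (hC : C = (StarAlgebra.adjoin ℂ (Set.range T)).topologicalClosure)
    (hT : ∀ i, T i ∈ C) : IsCuntzFamily (fun i => (⟨T i, hT i⟩ : C)) where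
  isometry i := Subtype.ext (h1 i)
  sum_range := Subtype.ext (by simpa using h2)
  generates := by
    refine StarSubalgebra.eq_top_iff.2 fun x => ?_
    have hx : (x : B) ∈ closure (StarAlgebra.adjoin ℂ (Set.range T) : Set B) := by
      have h : ∀ y ∈ C, y ∈ (StarAlgebra.adjoin ℂ (Set.range T)).topologicalClosure :=
        fun y hy => hC ▸ hy
      exact h x x.2
    have hmap := StarAlgHom.map_adjoin C.subtype (Set.range fun i => (⟨T i, hT i⟩ : C))
    rw [← Set.range_comp] at hmap
    change x ∈ closure (StarAlgebra.adjoin ℂ (Set.range fun i => (⟨T i, hT i⟩ : C)) : Set C)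
    rw [closure_subtype]
    convert hx using 2
    exact congrArg (SetLike.coe) hmap

/-- The isometries `t ↦ e^{2πit} S_i` in the `C⋆`-algebra of continuous functions on the circle. -/
noncomputable def gaugeFamily (S : Fin n → A) (i : Fin n) : C(AddCircle (1 : ℝ), A) :=
  ⟨fun t => (fourier 1 t : ℂ) • S i, by fun_prop⟩

theorem gaugeFamily_apply (i : Fin n) (t : AddCircle (1 : ℝ)) :
    gaugeFamily S i t = (fourier 1 t : ℂ) • S i := rfl

theorem star_fourier_mul_self (d : ℤ) (t : AddCircle (1 : ℝ)) :
    star (fourier d t : ℂ) * fourier d t = 1 := by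
  rw [← starRingEnd_apply, ← fourier_neg, ← fourier_add, neg_add_cancel, fourier_zero]

theorem mul_star_fourier_self (d : ℤ) (t : AddCircle (1 : ℝ)) :
    (fourier d t : ℂ) * star (fourier d t : ℂ) = 1 := by
  rw [mul_comm, star_fourier_mul_self]

theorem star_gaugeFamily_mul_self (hS : IsCuntzFamily S) (i : Fin n) :
    star (gaugeFamily S i) * gaugeFamily S i = 1 := by
  ext t
  change star ((fourier 1 t : ℂ) • S i) * ((fourier 1 t : ℂ) • S i) = 1
  rw [star_smul, smul_mul_smul_comm, star_fourier_mul_self, hS.isometry, one_smul]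

theorem sum_gaugeFamily_mul_star (hS : IsCuntzFamily S) :
    ∑ i, gaugeFamily S i * star (gaugeFamily S i) = 1 := by
  ext t
  have : ∀ i, (gaugeFamily S i * star (gaugeFamily S i)) t = S i * star (S i) := fun i => by
    change ((fourier 1 t : ℂ) • S i) * star ((fourier 1 t : ℂ) • S i) = _
    rw [star_smul, smul_mul_smul_comm, mul_star_fourier_self, one_smul]
  rw [ContinuousMap.sum_apply]
  simp only [this, hS.sum_range, ContinuousMap.one_apply]

theorem word_gaugeFamily_apply (μ : List (Fin n)) (t : AddCircle (1 : ℝ)) :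
    word (gaugeFamily S) μ t = (fourier (μ.length : ℤ) t : ℂ) • word S μ := by
  induction μ with
  | nil => simp
  | cons i μ ih =>
    rw [word_cons, ContinuousMap.mul_apply, ih, gaugeFamily_apply, word_cons, smul_mul_smul_comm,
      ← fourier_add, List.length_cons]
    congr 3; push_cast; ring

theorem word_mul_star_word_gaugeFamily_apply (μ ν : List (Fin n)) (t : AddCircle (1 : ℝ)) :
    (word (gaugeFamily S) μ * star (word (gaugeFamily S) ν)) t
      = (fourier ((μ.length : ℤ) - ν.length) t : ℂ) • (word S μ * star (word S ν)) := by
  rw [ContinuousMap.mul_apply, ContinuousMap.star_apply, word_gaugeFamily_apply,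
    word_gaugeFamily_apply, star_smul, smul_mul_smul_comm, sub_eq_add_neg, fourier_add,
    fourier_neg, starRingEnd_apply]

/-- The `C⋆`-algebra generated by the isometries `t ↦ e^{2πit} S_i`. -/
noncomputable def gaugeAlg (S : Fin n → A) : StarSubalgebra ℂ C(AddCircle (1 : ℝ), A) :=
  (StarAlgebra.adjoin ℂ (Set.range (gaugeFamily S))).topologicalClosure

instance : IsClosed (gaugeAlg S : Set C(AddCircle (1 : ℝ), A)) :=
  StarSubalgebra.isClosed_topologicalClosure _

theorem gaugeFamily_mem_gaugeAlg (i : Fin n) : gaugeFamily S i ∈ gaugeAlg S :=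
  StarSubalgebra.le_topologicalClosure _ (StarAlgebra.subset_adjoin ℂ _ ⟨i, rfl⟩)

theorem isCuntzFamily_gaugeAlg (hS : IsCuntzFamily S) :
    IsCuntzFamily fun i => (⟨gaugeFamily S i, gaugeFamily_mem_gaugeAlg i⟩ : gaugeAlg S) :=
  isCuntzFamily_codRestrict (C := gaugeAlg S) (star_gaugeFamily_mul_self hS)
    (sum_gaugeFamily_mul_star hS) rfl gaugeFamily_mem_gaugeAlg

/-- The closed subspace of those functions `f` on the circle for which the compressions of any
value `f t` converge to the average of `f`, and the latter lies in the core. -/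
noncomputable def averageable (hS : IsCuntzFamily S) (o e : Fin n) :
    Submodule ℂ C(AddCircle (1 : ℝ), A) where
  carrier := {f | circleAverage f ∈ core S ∧ ∀ t, Tendsto
    (fun k => star (spread hS o e k) * f t * spread hS o e k) atTop (𝓝 (circleAverage f))}
  zero_mem' := by
    have h0 : circleAverage (0 : C(AddCircle (1 : ℝ), A)) = 0 :=
      circleAverage_const_of_forall_eq fun _ => rfl
    refine ⟨by rw [h0]; exact zero_mem (coreAlg hS), fun t => ?_⟩
    rw [h0]
    simp
  add_mem' {f g} hf hg := by
    refine ⟨by rw [circleAverage_add]; exact (coreAlg hS).add_mem hf.1 hg.1, fun t => ?_⟩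
    rw [circleAverage_add]
    simpa only [ContinuousMap.add_apply, mul_add, add_mul] using (hf.2 t).add (hg.2 t)
  smul_mem' c f hf := by
    refine ⟨by rw [circleAverage_smul]; exact SMulMemClass.smul_mem (s := coreAlg hS) c hf.1,
      fun t => ?_⟩
    rw [circleAverage_smul]
    simpa only [ContinuousMap.smul_apply, mul_smul_comm, smul_mul_assoc] using
      (hf.2 t).const_smul c

theorem norm_spread_le (hS : IsCuntzFamily S) (o e : Fin n) (k : ℕ) : ‖spread hS o e k‖ ≤ 1 :=
  norm_le_one_of_isometry (star_spread_mul_self hS o e k)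

theorem isClosed_averageable (hS : IsCuntzFamily S) (o e : Fin n) :
    IsClosed (averageable hS o e : Set C(AddCircle (1 : ℝ), A)) := by
  refine isClosed_of_closure_subset fun f hf => ⟨?_, fun t => ?_⟩
  · have hcl : IsClosed {f : C(AddCircle (1 : ℝ), A) | circleAverage f ∈ core S} :=
      (isClosed_coreAlg hS).preimage continuous_circleAverage
    exact closure_minimal (fun g hg => hg.1) hcl hf
  · rw [Metric.tendsto_atTop]
    intro ε hε
    obtain ⟨g, hg, hfg⟩ := Metric.mem_closure_iff.1 hf (ε / 3) (by positivity)
    obtain ⟨N, hN⟩ := Metric.tendsto_atTop.1 (hg.2 t) (ε / 3) (by positivity)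
    refine ⟨N, fun k hk => ?_⟩
    have h1 := hN k hk
    rw [dist_eq_norm] at h1 hfg ⊢
    have h2 : ‖star (spread hS o e k) * (f t - g t) * spread hS o e k‖ ≤ ‖f - g‖ :=
      (norm_star_mul_mul_le (norm_spread_le hS o e k) _).trans ((f - g).norm_coe_le_norm t)
    have h3 : ‖circleAverage (f - g)‖ ≤ ‖f - g‖ := norm_circleAverage_le _
    rw [circleAverage_sub] at h3
    have h4 : star (spread hS o e k) * f t * spread hS o e k - circleAverage f
        = star (spread hS o e k) * (f t - g t) * spread hS o e k
          + (star (spread hS o e k) * g t * spread hS o e k - circleAverage g)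
          - (circleAverage f - circleAverage g) := by
      rw [mul_sub, sub_mul]; abel
    rw [h4]
    refine (norm_sub_le _ _).trans_lt ?_
    have h5 := norm_add_le (star (spread hS o e k) * (f t - g t) * spread hS o e k)
      (star (spread hS o e k) * g t * spread hS o e k - circleAverage g)
    linarith

theorem mem_averageable_of_apply_word (hS : IsCuntzFamily S) {o e : Fin n} (hoe : o ≠ e)
    {f : C(AddCircle (1 : ℝ), A)} {μ ν : List (Fin n)}
    (hf : ∀ t, f t = (fourier ((μ.length : ℤ) - ν.length) t : ℂ) • (word S μ * star (word S ν))) :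
    f ∈ averageable hS o e := by
  by_cases hl : μ.length = ν.length
  · have hf' : ∀ t, f t = word S μ * star (word S ν) := fun t => by
      rw [hf, hl, sub_self, fourier_zero, one_smul]
    have havg := circleAverage_const_of_forall_eq hf'
    refine ⟨?_, fun t => ?_⟩
    · rw [havg]
      exact coreLevel_subset_core (word_mul_star_word_mem_coreLevel hl rfl)
    · rw [havg, hf']
      refine tendsto_const_nhds.congr' ?_
      filter_upwards [eventually_ge_atTop ν.length] with k hk
      exact (star_spread_mul_coreLevel hS o e
        (coreLevel_mono hS hk (word_mul_star_word_mem_coreLevel hl rfl))).symm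
  · have havg : circleAverage f = 0 := by
      rw [circleAverage]
      simp only [hf]
      rw [integral_smul_const, integral_fourier_of_ne_zero (by omega), zero_smul]
    refine ⟨?_, fun t => ?_⟩
    · rw [havg]
      exact zero_mem (coreAlg hS)
    · rw [havg, hf]
      refine tendsto_const_nhds.congr' ?_
      filter_upwards [eventually_ge_atTop ν.length, eventually_ge_atTop μ.length] with k hk hk'
      rw [mul_smul_comm, smul_mul_assoc, star_spread_mul_word_mul_spread hS hoe hk' hk hl,
        smul_zero]

theorem coe_word {C : StarSubalgebra ℂ A} [IsClosed (C : Set A)] {T : Fin n → C}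
    (μ : List (Fin n)) : ((word T μ : C) : A) = word (fun i => (T i : A)) μ := by
  induction μ with
  | nil => simp
  | cons i μ ih => rw [word_cons, word_cons, ← ih]; rfl

theorem gaugeAlg_subset_averageable (hS : IsCuntzFamily S) {o e : Fin n} (hoe : o ≠ e)
    {f : C(AddCircle (1 : ℝ), A)} (hf : f ∈ gaugeAlg S) : f ∈ averageable hS o e := by
  have key := mem_of_word_mem (isCuntzFamily_gaugeAlg hS)
    (M := (averageable hS o e).comap (gaugeAlg S).subtype.toAlgHom.toLinearMap)
    ((isClosed_averageable hS o e).preimage continuous_subtype_val) (fun μ ν => ?_) ⟨f, hf⟩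
  · exact key
  · refine mem_averageable_of_apply_word hS hoe (μ := μ) (ν := ν) fun t => ?_
    rw [← word_mul_star_word_gaugeFamily_apply]
    change (((word _ μ : gaugeAlg S) : C(AddCircle (1 : ℝ), A)) *
      star ((word _ ν : gaugeAlg S) : C(AddCircle (1 : ℝ), A))) t = _
    rw [coe_word, coe_word]

theorem eq_zero_of_map_apply_eq_zero (hS : IsCuntzFamily S) {o e : Fin n} (hoe : o ≠ e)
    {B : Type*} [CStarAlgebra B] [Nontrivial B] (ρ : A →⋆ₐ[ℂ] B)
    {f : C(AddCircle (1 : ℝ), A)} (hf : f ∈ gaugeAlg S) {t : AddCircle (1 : ℝ)}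
    (h : ρ (f t) = 0) : f = 0 := by
  refine eq_zero_of_circleAverage_star_mul_self ?_
  obtain ⟨h1, h2⟩ := gaugeAlg_subset_averageable hS hoe (mul_mem (star_mem hf) hf)
  have h3 := ((continuous_starAlgHom ρ).tendsto _).comp (h2 t)
  have h4 : (ρ ∘ fun k => star (spread hS o e k) * (star f * f) t * spread hS o e k)
      = fun _ => 0 := by
    funext k
    simp [h]
  rw [h4] at h3
  have h5 := tendsto_nhds_unique h3 tendsto_const_nhds
  rw [← norm_eq_zero, ← norm_map_of_mem_core hS ρ h1, h5, norm_zero]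

theorem surjective_of_injective (hS : IsCuntzFamily S) {C : Type*} [CStarAlgebra C]
    (φ : C →⋆ₐ[ℂ] A) (hinj : Function.Injective φ) (h : ∀ i, S i ∈ Set.range φ) :
    Function.Surjective φ := by
  have hcl : IsClosed (φ.range : Set A) := by
    have := (NonUnitalStarAlgHom.isometry φ hinj).isClosedEmbedding.isClosed_range
    exact this
  have hle : StarAlgebra.adjoin ℂ (Set.range S) ≤ φ.range :=
    StarAlgebra.adjoin_le (by rintro _ ⟨i, rfl⟩; exact h i)
  have := StarSubalgebra.topologicalClosure_minimal hle hcl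
  rw [hS.generates] at this
  exact fun x => this (StarSubalgebra.mem_top (x := x))

/-- Evaluation of continuous functions on the circle as a `⋆`-homomorphism. -/
def circleEval (A : Type*) [CStarAlgebra A] (t : AddCircle (1 : ℝ)) :
    C(AddCircle (1 : ℝ), A) →⋆ₐ[ℂ] A where
  toFun f := f t
  map_one' := rfl
  map_mul' _ _ := rfl
  map_zero' := rfl
  map_add' _ _ := rfl
  commutes' _ := rfl
  map_star' _ := rfl

/-- Simplicity of the Cuntz algebra, in the form: every unital `⋆`-homomorphism is injective. -/
theorem injective_of_isCuntzFamily [Nontrivial A] (hS : IsCuntzFamily S) {o e : Fin n}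
    (hoe : o ≠ e) {B : Type*} [CStarAlgebra B] [Nontrivial B] (ρ : A →⋆ₐ[ℂ] B) :
    Function.Injective ρ := by
  obtain ⟨ev, hev⟩ : ∃ ev : gaugeAlg S →⋆ₐ[ℂ] A, ∀ f, ev f = (f : C(AddCircle (1 : ℝ), A)) 0 :=
    ⟨(circleEval A 0).comp (gaugeAlg S).subtype, fun _ => rfl⟩
  have hinj : Function.Injective ev := by
    rw [injective_iff_map_eq_zero]
    intro f h
    rw [hev] at h
    exact Subtype.ext (eq_zero_of_map_apply_eq_zero hS hoe (StarAlgHom.id ℂ A) f.2 h)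
  have hsurj : Function.Surjective ev := surjective_of_injective (C := gaugeAlg S) hS ev hinj fun i =>
    ⟨⟨_, gaugeFamily_mem_gaugeAlg i⟩, by
      rw [hev, gaugeFamily_apply, fourier_eval_zero, one_smul]⟩
  rw [injective_iff_map_eq_zero]
  intro x hx
  obtain ⟨f, rfl⟩ := hsurj x
  rw [hev] at hx ⊢
  rw [eq_zero_of_map_apply_eq_zero hS hoe ρ f.2 hx, ContinuousMap.zero_apply]

/-- The universal property of the Cuntz algebra. -/
theorem exists_starAlgHom [Nontrivial A] (hS : IsCuntzFamily S) {o e : Fin n} (hoe : o ≠ e)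
    {B : Type*} [CStarAlgebra B] [Nontrivial B] {T : Fin n → B}
    (h1 : ∀ i, star (T i) * T i = 1) (h2 : ∑ i, T i * star (T i) = 1) :
    ∃ ρ : A →⋆ₐ[ℂ] B, ∀ i, ρ (S i) = T i := by
  -- the `C⋆`-algebra generated by the pairs `(S_i, T_i)` is the graph of the homomorphism
  let P : Fin n → A × B := fun i => (S i, T i)
  let C : StarSubalgebra ℂ (A × B) := (StarAlgebra.adjoin ℂ (Set.range P)).topologicalClosure
  have hCc : IsClosed (C : Set (A × B)) := StarSubalgebra.isClosed_topologicalClosure _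
  have hPC : ∀ i, P i ∈ C := fun i =>
    StarSubalgebra.le_topologicalClosure _ (StarAlgebra.subset_adjoin ℂ _ ⟨i, rfl⟩)
  have hP : IsCuntzFamily (fun i => (⟨P i, hPC i⟩ : C)) := by
    refine isCuntzFamily_codRestrict (fun i => Prod.ext (hS.isometry i) (h1 i)) ?_ rfl hPC
    refine Prod.ext ?_ ?_
    · rw [Prod.fst_sum]; exact hS.sum_range
    · rw [Prod.snd_sum]; exact h2
  have : Nontrivial C := ⟨⟨0, 1, fun h => zero_ne_one (congrArg (fun x : C => (x : A × B)) h)⟩⟩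
  let p : C →⋆ₐ[ℂ] A := (StarAlgHom.fst ℂ A B).comp C.subtype
  have hinj : Function.Injective p := injective_of_isCuntzFamily hP hoe p
  have hsurj : Function.Surjective p :=
    surjective_of_injective hS p hinj fun i => ⟨⟨P i, hPC i⟩, rfl⟩
  let q : C ≃⋆ₐ[ℂ] A := StarAlgEquiv.ofBijective p ⟨hinj, hsurj⟩
  refine ⟨((StarAlgHom.snd ℂ A B).comp C.subtype).comp (q.symm : A →⋆ₐ[ℂ] C), fun i => ?_⟩
  have : q.symm (S i) = ⟨P i, hPC i⟩ := by
    rw [StarAlgEquiv.symm_apply_eq]; rfl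
  change ((q.symm (S i) : C) : A × B).2 = T i
  rw [this]

theorem starAlgHom_ext (hS : IsCuntzFamily S) {B : Type*} [CStarAlgebra B] {ρ σ : A →⋆ₐ[ℂ] B}
    (h : ∀ i, ρ (S i) = σ (S i)) : ρ = σ := by
  have hcl : IsClosed (StarAlgHom.equalizer ρ σ : Set A) :=
    isClosed_eq (continuous_starAlgHom ρ) (continuous_starAlgHom σ)
  have hle : StarAlgebra.adjoin ℂ (Set.range S) ≤ StarAlgHom.equalizer ρ σ :=
    StarAlgebra.adjoin_le (by rintro _ ⟨i, rfl⟩; exact h i)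
  have := StarSubalgebra.topologicalClosure_minimal hle hcl
  rw [hS.generates] at this
  ext x
  exact this (StarSubalgebra.mem_top (x := x))

end Simple

/-! ### The gauge action and the expectation onto the core -/

section Gauge

open Filter Topology AddCircle

variable {n : ℕ} {A : Type*} [CStarAlgebra A] {S : Fin n → A}

theorem map_word {B : Type*} [CStarAlgebra B] (ρ : A →⋆ₐ[ℂ] B) (μ : List (Fin n)) :
    ρ (word S μ) = word (fun i => ρ (S i)) μ := by
  induction μ with
  | nil => simp
  | cons i μ ih => rw [word_cons, word_cons, map_mul, ih]

variable [Nontrivial A] (hS : IsCuntzFamily S) {o e : Fin n} (hoe : o ≠ e)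

/-- The gauge action of the circle as a homomorphism that sends `S_i` to `t ↦ e^{2πit} S_i`. -/
noncomputable def gaugeHom : A →⋆ₐ[ℂ] C(AddCircle (1 : ℝ), A) :=
  (exists_starAlgHom hS hoe (star_gaugeFamily_mul_self hS) (sum_gaugeFamily_mul_star hS)).choose

/-- The gauge automorphism `γ_t`, with `γ_t(S_i) = e^{2πit} S_i`. -/
noncomputable def gauge (t : AddCircle (1 : ℝ)) : A →⋆ₐ[ℂ] A :=
  (circleEval A t).comp (gaugeHom hS hoe)

/-- The conditional expectation onto the core, by averaging over the gauge action. -/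
noncomputable def coreExp (x : A) : A := circleAverage (gaugeHom hS hoe x)

theorem gaugeHom_gen (i : Fin n) : gaugeHom hS hoe (S i) = gaugeFamily S i :=
  (exists_starAlgHom hS hoe (star_gaugeFamily_mul_self hS)
    (sum_gaugeFamily_mul_star hS)).choose_spec i

theorem gaugeHom_apply (x : A) (t : AddCircle (1 : ℝ)) :
    gaugeHom hS hoe x t = gauge hS hoe t x := rfl

theorem gauge_gen (t : AddCircle (1 : ℝ)) (i : Fin n) :
    gauge hS hoe t (S i) = (fourier 1 t : ℂ) • S i := by
  rw [← gaugeHom_apply, gaugeHom_gen, gaugeFamily_apply]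

theorem gauge_word (t : AddCircle (1 : ℝ)) (μ ν : List (Fin n)) :
    gauge hS hoe t (word S μ * star (word S ν))
      = (fourier ((μ.length : ℤ) - ν.length) t : ℂ) • (word S μ * star (word S ν)) := by
  rw [← word_mul_star_word_gaugeFamily_apply, ← gaugeHom_apply, map_mul, map_star, map_word,
    map_word]
  simp only [gaugeHom_gen]

theorem gauge_zero (x : A) : gauge hS hoe 0 x = x := by
  have : gauge hS hoe 0 = StarAlgHom.id ℂ A := starAlgHom_ext hS fun i => by
    rw [gauge_gen, fourier_eval_zero, one_smul]; rfl
  rw [this]; rfl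

theorem gaugeHom_mem_averageable (x : A) : gaugeHom hS hoe x ∈ averageable hS o e :=
  mem_of_word_mem hS (M := (averageable hS o e).comap (gaugeHom hS hoe).toAlgHom.toLinearMap)
    ((isClosed_averageable hS o e).preimage (continuous_starAlgHom (gaugeHom hS hoe)))
    (fun μ ν => mem_averageable_of_apply_word hS hoe (μ := μ) (ν := ν) fun t =>
      gauge_word hS hoe t μ ν) x

theorem coreExp_mem_core (x : A) : coreExp hS hoe x ∈ core S :=
  (gaugeHom_mem_averageable hS hoe x).1

theorem tendsto_coreExp (x : A) : Tendsto
    (fun k => star (spread hS o e k) * x * spread hS o e k) atTop (𝓝 (coreExp hS hoe x)) := by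
  have := (gaugeHom_mem_averageable hS hoe x).2 0
  rwa [gaugeHom_apply, gauge_zero] at this

theorem coreExp_sub (x y : A) :
    coreExp hS hoe (x - y) = coreExp hS hoe x - coreExp hS hoe y := by
  rw [coreExp, map_sub, circleAverage_sub]; rfl

theorem gauge_of_mem_core {x : A} (hx : x ∈ core S) (t : AddCircle (1 : ℝ)) :
    gauge hS hoe t x = x := by
  have hcl : IsClosed {x : A | gauge hS hoe t x = x} :=
    isClosed_eq (continuous_starAlgHom _) continuous_id
  refine closure_minimal (Set.iUnion_subset fun k y hy => ?_) hcl hx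
  change gauge hS hoe t y = y
  induction hy using Submodule.span_induction with
  | mem y hy =>
    obtain ⟨μ, ν, hμ, hν, rfl⟩ := hy
    rw [gauge_word, hμ, hν, sub_self, fourier_zero, one_smul]
  | zero => rw [map_zero]
  | add y z _ _ hy hz => rw [map_add, hy, hz]
  | smul a y _ hy => rw [map_smul, hy]

theorem coreExp_of_gauge {x : A} (hx : ∀ t, gauge hS hoe t x = x) : coreExp hS hoe x = x :=
  circleAverage_const_of_forall_eq hx

/-- The core is the fixed point algebra of the gauge action. -/
theorem mem_core_iff_gauge {x : A} : x ∈ core S ↔ ∀ t, gauge hS hoe t x = x := by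
  refine ⟨fun hx t => gauge_of_mem_core hS hoe hx t, fun hx => ?_⟩
  rw [← coreExp_of_gauge hS hoe hx]
  exact coreExp_mem_core hS hoe x

theorem eq_zero_of_coreExp_star_mul_self {x : A} (hx : coreExp hS hoe (star x * x) = 0) :
    x = 0 := by
  rw [coreExp, map_mul, map_star] at hx
  have := eq_zero_of_circleAverage_star_mul_self hx
  rw [← gauge_zero hS hoe x, ← gaugeHom_apply, this]; rfl

end Gauge

/-! ### The diagonal is maximal abelian and the core has trivial relative commutant -/

section Masa

open Filter Topology

variable {n : ℕ} {A : Type*} [CStarAlgebra A] {S : Fin n → A}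

theorem sum_attach_conj_mul_word (hS : IsCuntzFamily S) {k : ℕ} (z : words n k → A)
    (ν : words n k) :
    (∑ μ : words n k, word S μ * z μ * star (word S μ)) * word S ν = word S ν * z ν := by
  rw [Finset.sum_mul, Finset.sum_eq_single ν]
  · rw [mul_assoc, star_word_mul_self hS, mul_one]
  · intro μ _ hne
    rw [mul_assoc, star_word_mul_word_of_ne hS ((mem_words.1 μ.2).trans (mem_words.1 ν.2).symm)
      (fun h => hne (Subtype.ext h)), mul_zero]
  · simp

/-- The norm of a block diagonal element is at most the largest norm of its blocks. -/
theorem norm_sum_conj_le (hS : IsCuntzFamily S) {k : ℕ} (z : words n k → A) {ε : ℝ} (hε : 0 ≤ ε)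
    (hz : ∀ μ, ‖z μ‖ ≤ ε) : ‖∑ μ : words n k, word S μ * z μ * star (word S μ)‖ ≤ ε := by
  let φ : (words n k → A) →⋆ₙₐ[ℂ] A :=
    { toFun := fun z => ∑ μ : words n k, word S μ * z μ * star (word S μ)
      map_smul' := fun c z => by simp [Finset.smul_sum]
      map_zero' := by simp
      map_add' := fun z w => by simp [mul_add, add_mul, Finset.sum_add_distrib]
      map_mul' := fun z w => eq_of_mul_word_eq hS k fun ν hν => by
        have h1 := sum_attach_conj_mul_word hS (z * w) ⟨ν, mem_words.2 hν⟩
        have h2 := sum_attach_conj_mul_word hS w ⟨ν, mem_words.2 hν⟩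
        have h3 := sum_attach_conj_mul_word hS z ⟨ν, mem_words.2 hν⟩
        rw [mul_assoc, h1, h2, ← mul_assoc, h3, mul_assoc]; rfl
      map_star' := fun z => by simp [star_sum, mul_assoc] }
  exact (NonUnitalStarAlgHom.norm_apply_le φ z).trans ((pi_norm_le_iff_of_nonneg hε).2 hz)

theorem mem_diagonal_of_mem_core (hS : IsCuntzFamily S) {x : A} (hx : x ∈ core S)
    (hc : ∀ μ, Commute x (proj S μ)) : x ∈ diagonal S := by
  have hcl : IsClosed (diagonal S : Set A) := isClosed_diagonal
  change x ∈ (diagonal S : Set A)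
  rw [← hcl.closure_eq, Metric.mem_closure_iff]
  intro ε hε
  obtain ⟨k, y, hy, hxy⟩ := exists_coreLevel_norm_sub_lt hx (half_pos hε)
  have hy' := fun μ : words n k => (mem_coreLevel_iff hS).1 hy μ μ (mem_words.1 μ.2)
    (mem_words.1 μ.2)
  choose c hc' using hy'
  refine ⟨∑ μ : words n k, word S μ * (c μ • 1) * star (word S μ), ?_, ?_⟩
  · refine sum_mem fun μ _ => ?_
    rw [mul_smul_comm, smul_mul_assoc, mul_one]
    exact SMulMemClass.smul_mem _ (proj_mem_diagonal _)
  · have hxd : x - ∑ μ : words n k, word S μ * (c μ • 1) * star (word S μ)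
        = ∑ μ : words n k, word S μ * (star (word S μ) * (x - y) * word S μ) *
          star (word S μ) := by
      refine eq_of_mul_word_eq hS k fun ν hν => ?_
      have h1 := sum_attach_conj_mul_word hS (fun μ => c μ • (1 : A)) ⟨ν, mem_words.2 hν⟩
      have h2 := sum_attach_conj_mul_word hS
        (fun μ : words n k => star (word S μ) * (x - y) * word S μ) ⟨ν, mem_words.2 hν⟩
      have h3 : word S ν * (star (word S ν) * x * word S ν) = x * word S ν := by
        rw [← mul_assoc, ← mul_assoc]
        change proj S ν * x * word S ν = _
        rw [← (hc ν).eq, mul_assoc, proj, mul_assoc, star_word_mul_self hS, mul_one]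
      rw [sub_mul, h1, h2, ← hc' ⟨ν, mem_words.2 hν⟩, mul_sub, sub_mul, mul_sub, h3]
    rw [dist_eq_norm, hxd]
    refine (norm_sum_conj_le hS _ (half_pos hε).le fun μ => ?_).trans_lt (half_lt_self hε)
    exact (norm_star_mul_mul_le (norm_le_one_of_isometry (star_word_mul_self hS _)) _).trans hxy.le

theorem shiftPow_proj (hS : IsCuntzFamily S) (k : ℕ) (ν : List (Fin n)) :
    shiftPow hS k (proj S ν) ∈ diagonal S := by
  induction k with
  | zero => exact proj_mem_diagonal ν
  | succ k ih => exact shift_mem_diagonal hS ih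

/-- The diagonal is a maximal abelian subalgebra. For `x` in its commutant, the expectation `E(x)`
onto the core is in the diagonal. The compressions are multiplicative on the commutant, and they
converge to `E`, so that `y = x - E(x)` has `E(y⋆ y) = E(y)⋆ E(y) = 0`. -/
theorem mem_diagonal_of_commute [Nontrivial A] (hS : IsCuntzFamily S) {o e : Fin n} (hoe : o ≠ e)
    {x : A} (hx : ∀ y ∈ diagonal S, Commute x y) : x ∈ diagonal S := by
  have hE : coreExp hS hoe x ∈ diagonal S := by
    refine mem_diagonal_of_mem_core hS (coreExp_mem_core hS hoe x) fun μ => ?_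
    have h1 := (tendsto_coreExp hS hoe x).mul_const (proj S μ)
    have h2 := (tendsto_coreExp hS hoe x).const_mul (proj S μ)
    refine tendsto_nhds_unique (h1.congr' ?_) h2
    filter_upwards [eventually_ge_atTop μ.length] with k hk
    have hP : proj S μ ∈ coreLevel S μ.length := word_mul_star_word_mem_coreLevel rfl rfl
    have hV : Commute (proj S μ) (spread hS o e k) := commute_coreLevel_shiftPow hS hk hP _
    have hV' : Commute (proj S μ) (star (spread hS o e k)) := by
      rw [spread, ← map_star]; exact commute_coreLevel_shiftPow hS hk hP _
    exact ((hV'.mul_right (hx _ (proj_mem_diagonal μ)).symm).mul_right hV).symm.eq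
  obtain ⟨y, hy⟩ : ∃ y, y = x - coreExp hS hoe x := ⟨_, rfl⟩
  have hyD : ∀ z ∈ diagonal S, Commute y z := fun z hz => by
    rw [hy]; exact (hx z hz).sub_left (diagonal_commute hS hE hz)
  have hEy : coreExp hS hoe y = 0 := by
    rw [hy, coreExp_sub, coreExp_of_gauge hS hoe
      ((mem_core_iff_gauge hS hoe).1 (coreExp_mem_core hS hoe x)), sub_self]
  have hlim := tendsto_coreExp hS hoe y
  rw [hEy] at hlim
  have hlim2 := hlim.star.mul hlim
  rw [star_zero, zero_mul] at hlim2
  have hlim3 : Tendsto (fun k => star (spread hS o e k) * (star y * y) * spread hS o e k)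
      atTop (𝓝 0) := by
    refine hlim2.congr fun k => ?_
    have hQ : Commute y (spread hS o e k * star (spread hS o e k)) := by
      refine hyD _ ?_
      rw [spread, ← map_star, ← map_mul]
      exact shiftPow_proj hS k _
    calc star (star (spread hS o e k) * y * spread hS o e k)
          * (star (spread hS o e k) * y * spread hS o e k)
        = star (spread hS o e k) * star y * ((spread hS o e k * star (spread hS o e k)) * y)
          * spread hS o e k := by simp only [star_mul, star_star, mul_assoc]
      _ = star (spread hS o e k) * star y * y * spread hS o e k
          * (star (spread hS o e k) * spread hS o e k) := by
          rw [← hQ.eq]; simp only [mul_assoc]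
      _ = _ := by rw [star_spread_mul_self, mul_one]; simp only [mul_assoc]
  have h0 := eq_zero_of_coreExp_star_mul_self hS hoe
    (tendsto_nhds_unique (tendsto_coreExp hS hoe (star y * y)) hlim3)
  rw [hy, sub_eq_zero] at h0
  rwa [h0]

/-- The core has trivial relative commutant. -/
theorem exists_eq_smul_one_of_commute [Nontrivial A] (hS : IsCuntzFamily S) {o e : Fin n}
    (hoe : o ≠ e) {x : A} (hx : ∀ y ∈ core S, Commute x y) : ∃ c : ℂ, x = c • 1 := by
  have hxc : x ∈ core S := diagonal_le_coreAlg hS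
    (mem_diagonal_of_commute hS hoe fun y hy => hx y (diagonal_le_coreAlg hS hy))
  have hcl : IsClosed ((ℂ ∙ (1 : A) : Submodule ℂ A) : Set A) :=
    Submodule.closed_of_finiteDimensional _
  suffices h : x ∈ (ℂ ∙ (1 : A)) by
    obtain ⟨c, rfl⟩ := Submodule.mem_span_singleton.1 h
    exact ⟨c, rfl⟩
  change x ∈ ((ℂ ∙ (1 : A) : Submodule ℂ A) : Set A)
  rw [← hcl.closure_eq, Metric.mem_closure_iff]
  intro ε hε
  obtain ⟨k, y, hy, hxy⟩ := exists_coreLevel_norm_sub_lt hxc hε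
  have hκ : (List.replicate k o).length = k := by simp
  obtain ⟨c, hc⟩ := (mem_coreLevel_iff hS).1 hy _ _ hκ hκ
  refine ⟨c • 1, Submodule.mem_span_singleton.2 ⟨c, rfl⟩, ?_⟩
  obtain ⟨w, hw⟩ : ∃ w, w = word S (List.replicate k o) := ⟨_, rfl⟩
  rw [← hw] at hc
  have hww : star w * w = 1 := by rw [hw]; exact star_word_mul_self hS _
  -- by commutation, all matrix coefficients `S_μ⋆ x S_μ` of `x` agree, so `x = φᵏ(S_μ⋆ x S_μ)`
  have hxt : x = shiftPow hS k (star w * x * w) := by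
    refine eq_of_mul_word_eq hS k fun ν hν => ?_
    have h1 : x * (word S ν * star w) = word S ν * star w * x :=
      hx _ (by rw [hw]; exact coreLevel_subset_core (word_mul_star_word_mem_coreLevel hν hκ))
    rw [shiftPow_mul_word_eq hS hν]
    calc x * word S ν = x * (word S ν * star w) * w := by
          rw [mul_assoc, mul_assoc, hww, mul_one]
      _ = _ := by rw [h1]; simp only [mul_assoc]
  have hxc' : x - c • 1 = shiftPow hS k (star w * (x - y) * w) := by
    rw [mul_sub, sub_mul, hc, map_sub, ← hxt, map_smul, map_one]
  rw [dist_eq_norm, hxc']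
  refine (NonUnitalStarAlgHom.norm_apply_le _ _).trans_lt (lt_of_le_of_lt ?_ hxy)
  exact norm_star_mul_mul_le (norm_le_one_of_isometry hww) _

end Masa

/-! ### Unitaries in the core and automorphisms that preserve the core -/

section CoreUnitary

open Filter Topology AddCircle

variable {n : ℕ} {A : Type*} [CStarAlgebra A] {S : Fin n → A}

/-- The normalized transfer operator `x ↦ n⁻¹ ∑ S_i⋆ x S_i`. Its powers converge to the trace on
the core. -/
noncomputable def transfer (S : Fin n → A) : Module.End ℂ A where
  toFun x := (n : ℂ)⁻¹ • ∑ i, star (S i) * x * S i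
  map_add' x y := by simp [mul_add, add_mul, Finset.sum_add_distrib]
  map_smul' c x := by
    simp only [mul_smul_comm, smul_mul_assoc, ← Finset.smul_sum, RingHom.id_apply]
    rw [smul_comm]

theorem transfer_apply (x : A) : transfer S x = (n : ℂ)⁻¹ • ∑ i, star (S i) * x * S i := rfl

theorem transfer_one (hS : IsCuntzFamily S) (hn : n ≠ 0) : transfer S 1 = 1 := by
  rw [transfer_apply]
  simp only [mul_one, hS.isometry, Finset.sum_const, Finset.card_univ, Fintype.card_fin]
  rw [← Nat.cast_smul_eq_nsmul ℂ, smul_smul, inv_mul_cancel₀ (by exact_mod_cast hn), one_smul]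

theorem transfer_pow_one (hS : IsCuntzFamily S) (hn : n ≠ 0) (k : ℕ) :
    (transfer S ^ k) 1 = 1 := by
  induction k with
  | zero => simp
  | succ k ih => rw [pow_succ, Module.End.mul_apply, transfer_one hS hn, ih]

theorem norm_transfer_le (hS : IsCuntzFamily S) (hn : n ≠ 0) (x : A) : ‖transfer S x‖ ≤ ‖x‖ := by
  have hn' : (0 : ℝ) < n := by exact_mod_cast Nat.pos_of_ne_zero hn
  rw [transfer_apply, norm_smul, norm_inv, Complex.norm_natCast, inv_mul_le_iff₀ hn']
  refine (norm_sum_le _ _).trans ?_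
  refine (Finset.sum_le_card_nsmul _ _ ‖x‖ fun i _ =>
    norm_star_mul_mul_le (norm_le_one_of_isometry (hS.isometry i)) x).trans ?_
  simp

theorem norm_transfer_pow_le (hS : IsCuntzFamily S) (hn : n ≠ 0) (k : ℕ) (x : A) :
    ‖(transfer S ^ k) x‖ ≤ ‖x‖ := by
  induction k generalizing x with
  | zero => simp
  | succ k ih =>
    rw [pow_succ, Module.End.mul_apply]
    exact (ih _).trans (norm_transfer_le hS hn x)

theorem transfer_word_cons (hS : IsCuntzFamily S) (i j : Fin n) (μ ν : List (Fin n)) :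
    transfer S (word S (i :: μ) * star (word S (j :: ν)))
      = if i = j then (n : ℂ)⁻¹ • (word S μ * star (word S ν)) else 0 := by
  rw [transfer_apply, Finset.sum_eq_single i]
  · rw [word_cons, word_cons, star_mul]
    have h1 : star (S i) * (S i * word S μ * (star (word S ν) * star (S j))) * S i
        = word S μ * star (word S ν) * (star (S j) * S i) := by
      calc _ = (star (S i) * S i) * word S μ * star (word S ν) * (star (S j) * S i) := by
            simp only [mul_assoc]
        _ = _ := by rw [hS.isometry, one_mul]
    rw [h1]
    split_ifs with h
    · rw [h, hS.isometry, mul_one]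
    · rw [hS.orthogonal (Ne.symm h), mul_zero, smul_zero]
  · intro k _ hk
    rw [word_cons, ← mul_assoc, ← mul_assoc, hS.orthogonal hk]
    simp
  · simp

theorem transfer_pow_word (hS : IsCuntzFamily S) {k : ℕ} {μ ν : List (Fin n)}
    (hμ : μ.length = k) (hν : ν.length = k) :
    (transfer S ^ k) (word S μ * star (word S ν))
      = if μ = ν then ((n : ℂ)⁻¹ ^ k) • (1 : A) else 0 := by
  induction k generalizing μ ν with
  | zero =>
    rw [List.length_eq_zero_iff] at hμ hν
    simp [hμ, hν]
  | succ k ih =>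
    match μ, ν with
    | i :: μ, j :: ν =>
      rw [pow_succ, Module.End.mul_apply, transfer_word_cons hS]
      by_cases hij : i = j
      · rw [if_pos hij, map_smul, ih (by simpa using hμ) (by simpa using hν)]
        by_cases h : μ = ν
        · rw [if_pos h, if_pos (by rw [hij, h]), smul_smul, pow_succ']
        · rw [if_neg h, if_neg (by simp [h]), smul_zero]
      · rw [if_neg hij, map_zero, if_neg (by simp [hij])]

theorem transfer_pow_mul_comm (hS : IsCuntzFamily S) {k : ℕ} {x y : A}
    (hx : x ∈ coreLevel S k) (hy : y ∈ coreLevel S k) :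
    (transfer S ^ k) (x * y) = (transfer S ^ k) (y * x) := by
  have key : ∀ κ ρ σ τ : List (Fin n), κ.length = k → ρ.length = k → σ.length = k →
      τ.length = k →
      (transfer S ^ k) (word S κ * star (word S ρ) * (word S σ * star (word S τ)))
        = if ρ = σ ∧ κ = τ then ((n : ℂ)⁻¹ ^ k) • (1 : A) else 0 := by
    intro κ ρ σ τ hκ hρ hσ hτ
    rw [mul_assoc]
    by_cases h : ρ = σ
    · subst h
      rw [star_word_mul_self_assoc hS, transfer_pow_word hS hκ hτ]
      simp
    · rw [star_word_mul_word_of_ne_assoc hS (hρ.trans hσ.symm) h]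
      simp [h]
  induction hx using Submodule.span_induction with
  | mem x hx =>
    obtain ⟨κ, ρ, hκ, hρ, rfl⟩ := hx
    induction hy using Submodule.span_induction with
    | mem y hy =>
      obtain ⟨σ, τ, hσ, hτ, rfl⟩ := hy
      rw [key κ ρ σ τ hκ hρ hσ hτ, key σ τ κ ρ hσ hτ hκ hρ]
      congr 1
      rw [eq_iff_iff, and_comm, eq_comm (a := κ), eq_comm (a := ρ)]
    | zero => simp
    | add y z _ _ hy hz => rw [mul_add, add_mul, map_add, map_add, hy, hz]
    | smul a y _ hy => rw [mul_smul_comm, smul_mul_assoc, map_smul, map_smul, hy]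
  | zero => simp
  | add y z _ _ hy hz => rw [mul_add, add_mul, map_add, map_add, hy, hz]
  | smul a y _ hy => rw [mul_smul_comm, smul_mul_assoc, map_smul, map_smul, hy]

variable [Nontrivial A]

/-- The core is finite: it contains no co-isometry with a proper initial projection `P_μ`. For large
`l`, the `l`-th power of the transfer operator is a trace on the levels up to `l`, and it separates
`1` from `P_μ`. -/
theorem not_mem_core_of_star_mul_self_eq_proj (hS : IsCuntzFamily S) (hn : 2 ≤ n) {v : A}
    {μ : List (Fin n)} (hμ : μ ≠ []) (h1 : v * star v = 1) (h2 : star v * v = proj S μ) :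
    v ∉ core S := by
  intro hv
  have hn0 : n ≠ 0 := by omega
  obtain ⟨k, y, hy, hvy⟩ := exists_coreLevel_norm_sub_lt hv (ε := 1 / 16) (by norm_num)
  obtain ⟨l, hl⟩ : ∃ l, l = max k μ.length := ⟨_, rfl⟩
  have hyl : y ∈ coreLevel S l := coreLevel_mono hS (by omega) hy
  have hys : star y ∈ coreLevel S l := (coreLevelAlg hS l).star_mem' hyl
  obtain ⟨r, hr⟩ : ∃ r, l = r + μ.length := ⟨l - μ.length, by omega⟩
  have hP : (transfer S ^ l) (proj S μ) = ((n : ℂ)⁻¹ ^ μ.length) • (1 : A) := by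
    rw [hr, pow_add, Module.End.mul_apply, proj, transfer_pow_word hS rfl rfl, if_pos rfl,
      map_smul, transfer_pow_one hS hn0]
  have hv1 : ‖v‖ ≤ 1 := by
    rw [← norm_star]; exact norm_le_one_of_isometry (by rwa [star_star])
  have hy1 : ‖y‖ ≤ 1 + 1 / 16 := by
    have := norm_sub_norm_le y v
    rw [norm_sub_rev] at this
    linarith
  have hsv : ‖star v - star y‖ < 1 / 16 := by rwa [← star_sub, norm_star]
  have e1 : ‖v * star v - y * star y‖ ≤ 33 / 256 := by
    have : v * star v - y * star y = (v - y) * star v + y * (star v - star y) := by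
      rw [sub_mul, mul_sub]; abel
    rw [this]
    have a1 := norm_mul_le (v - y) (star v)
    have a2 := norm_mul_le y (star v - star y)
    have a3 := norm_add_le ((v - y) * star v) (y * (star v - star y))
    rw [norm_star] at a1
    nlinarith [norm_nonneg v, norm_nonneg y, norm_nonneg (v - y), norm_nonneg (star v - star y)]
  have e2 : ‖star v * v - star y * y‖ ≤ 33 / 256 := by
    have : star v * v - star y * y = star v * (v - y) + (star v - star y) * y := by
      rw [sub_mul, mul_sub]; abel
    rw [this]
    have a1 := norm_mul_le (star v) (v - y)
    have a2 := norm_mul_le (star v - star y) y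
    have a3 := norm_add_le (star v * (v - y)) ((star v - star y) * y)
    rw [norm_star] at a1
    nlinarith [norm_nonneg v, norm_nonneg y, norm_nonneg (v - y), norm_nonneg (star v - star y)]
  have hdiff : (1 - (n : ℂ)⁻¹ ^ μ.length) • (1 : A)
      = (transfer S ^ l) (v * star v - y * star y)
        - (transfer S ^ l) (star v * v - star y * y) := by
    rw [map_sub, map_sub, transfer_pow_mul_comm hS hyl hys, h1, h2, hP, transfer_pow_one hS hn0,
      sub_smul, one_smul]
    abel
  have hnorm : ‖(1 - (n : ℂ)⁻¹ ^ μ.length) • (1 : A)‖ ≤ 66 / 256 := by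
    rw [hdiff]
    refine (norm_sub_le _ _).trans ?_
    have b1 := norm_transfer_pow_le hS hn0 l (v * star v - y * star y)
    have b2 := norm_transfer_pow_le hS hn0 l (star v * v - star y * y)
    linarith
  rw [norm_smul, norm_one, mul_one] at hnorm
  have hpow : ‖(n : ℂ)⁻¹ ^ μ.length‖ ≤ 1 / 2 := by
    rw [norm_pow, norm_inv, Complex.norm_natCast]
    have hn2 : (n : ℝ)⁻¹ ≤ 1 / 2 := by
      rw [one_div]
      exact inv_anti₀ two_pos (by exact_mod_cast hn)
    refine (pow_le_of_le_one (by positivity) (hn2.trans (by norm_num)) ?_).trans hn2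
    simpa using hμ
  have := norm_sub_norm_le (1 : ℂ) ((n : ℂ)⁻¹ ^ μ.length)
  rw [norm_one] at this
  linarith

/-- There are no unitaries of positive degree for the gauge action. -/
theorem not_gauge_eq_fourier_smul (hS : IsCuntzFamily S) {o e : Fin n} (hoe : o ≠ e)
    (hn : 2 ≤ n) {u : A} (h1 : star u * u = 1) (h2 : u * star u = 1)
    {d : ℕ} (hd : d ≠ 0) (hu : ∀ t, gauge hS hoe t u = (fourier (d : ℤ) t : ℂ) • u) : False := by
  obtain ⟨μ, hμ⟩ : ∃ μ : List (Fin n), μ = List.replicate d o := ⟨_, rfl⟩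
  have hl : μ.length = d := by simp [hμ]
  refine not_mem_core_of_star_mul_self_eq_proj hS hn (v := u * star (word S μ)) (μ := μ)
    (by rintro rfl; exact hd hl.symm) ?_ ?_ ?_
  · rw [star_mul, star_star, mul_assoc, star_word_mul_self_assoc hS, h2]
  · rw [star_mul, star_star, mul_assoc, ← mul_assoc (star u), h1, one_mul, proj]
  · rw [mem_core_iff_gauge hS hoe]
    intro t
    have hw : gauge hS hoe t (star (word S μ))
        = (fourier (-(d : ℤ)) t : ℂ) • star (word S μ) := by
      have := gauge_word hS hoe t [] μ
      simpa only [word_nil, one_mul, List.length_nil, hl, Nat.cast_zero, zero_sub] using this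
    rw [map_mul, hu, hw, smul_mul_smul_comm, ← fourier_add, add_neg_cancel, fourier_zero, one_smul]

/-- A unitary that spans a gauge-invariant line lies in the core. -/
theorem mem_core_of_gauge_eq_smul (hS : IsCuntzFamily S) {o e : Fin n} (hoe : o ≠ e)
    (hn : 2 ≤ n) {u : A} (h1 : star u * u = 1)
    (h2 : u * star u = 1) {c : AddCircle (1 : ℝ) → ℂ} (hu : ∀ t, gauge hS hoe t u = c t • u) :
    u ∈ core S := by
  -- some word `w` is not orthogonal to `u`, and then `u` has the same degree as `w`
  obtain ⟨μ, ν, hw⟩ : ∃ μ ν, coreExp hS hoe (star u * (word S μ * star (word S ν))) ≠ 0 := by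
    by_contra! hcon
    let M : Submodule ℂ A :=
      { carrier := {y | coreExp hS hoe (star u * y) = 0}
        zero_mem' := by
          change circleAverage _ = 0
          rw [mul_zero, map_zero]
          exact circleAverage_const_of_forall_eq fun _ => rfl
        add_mem' := fun {y z} hy hz => by
          change circleAverage _ = 0
          rw [mul_add, map_add, circleAverage_add]
          have hy' : circleAverage (gaugeHom hS hoe (star u * y)) = 0 := hy
          have hz' : circleAverage (gaugeHom hS hoe (star u * z)) = 0 := hz
          rw [hy', hz', add_zero]
        smul_mem' := fun a y hy => by
          change circleAverage _ = 0
          rw [mul_smul_comm, map_smul, circleAverage_smul]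
          have hy' : circleAverage (gaugeHom hS hoe (star u * y)) = 0 := hy
          rw [hy', smul_zero] }
    have hM : IsClosed (M : Set A) := by
      refine isClosed_eq ?_ continuous_const
      exact continuous_circleAverage.comp
        ((continuous_starAlgHom _).comp (continuous_const.mul continuous_id))
    have h0 : coreExp hS hoe (star u * u) = 0 := mem_of_word_mem hS hM hcon u
    rw [h1, coreExp_of_gauge hS hoe fun t => map_one _] at h0
    exact one_ne_zero h0
  obtain ⟨w, hwd⟩ : ∃ w, w = word S μ * star (word S ν) := ⟨_, rfl⟩
  rw [← hwd] at hw
  obtain ⟨d, hd⟩ : ∃ d : ℤ, d = (μ.length : ℤ) - ν.length := ⟨_, rfl⟩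
  have hg : ∀ t, gauge hS hoe t (star u * w)
      = (star (c t) * (fourier d t : ℂ)) • (star u * w) := fun t => by
    rw [map_mul, map_star, hu, star_smul, hwd, gauge_word, smul_mul_smul_comm, hd]
  have hint : coreExp hS hoe (star u * w)
      = (∫ t, star (c t) * (fourier d t : ℂ) ∂haarAddCircle) • (star u * w) := by
    rw [coreExp, circleAverage, ← integral_smul_const]
    exact MeasureTheory.integral_congr_ae (Eventually.of_forall hg)
  have hc : ∀ t, c t = (fourier d t : ℂ) := fun t => by
    have hne := hw
    have hinv := gauge_of_mem_core hS hoe (coreExp_mem_core hS hoe (star u * w)) t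
    rw [hint] at hinv hne
    rw [map_smul, hg, smul_comm] at hinv
    have h3 : star (c t) * (fourier d t : ℂ) = 1 := by
      refine smul_left_injective ℂ hne ?_
      simpa only [one_smul] using hinv
    have h4 := h3.trans (star_fourier_mul_self d t).symm
    exact star_injective (mul_right_cancel₀ (right_ne_zero_of_mul (by rw [h3]; exact one_ne_zero))
      h4)
  simp only [hc] at hu
  rcases lt_trichotomy d 0 with hlt | h0 | hgt
  · exfalso
    obtain ⟨m, hm⟩ := Int.eq_ofNat_of_zero_le (neg_nonneg.2 hlt.le)
    refine not_gauge_eq_fourier_smul hS hoe hn (u := star u) (by rwa [star_star])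
      (by rwa [star_star]) (d := m) (by omega) fun t => ?_
    rw [map_star, hu, star_smul, ← hm, fourier_neg, starRingEnd_apply]
  · rw [mem_core_iff_gauge hS hoe]
    intro t
    rw [hu, h0, fourier_zero, one_smul]
  · exfalso
    obtain ⟨m, hm⟩ := Int.eq_ofNat_of_zero_le hgt.le
    refine not_gauge_eq_fourier_smul hS hoe hn h1 h2 (d := m) (by omega) fun t => ?_
    rw [hu, ← hm]

end CoreUnitary

section Cocycle

variable {n : ℕ} {A : Type*} [CStarAlgebra A] {S : Fin n → A}

/-- The unitary `u = ∑ α(S_i) S_i⋆` with `α(S_i) = u S_i`. -/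
noncomputable def cocycle (S : Fin n → A) (α : A →⋆ₐ[ℂ] A) : A := ∑ i, α (S i) * star (S i)

theorem map_gen_eq_cocycle_mul (hS : IsCuntzFamily S) (α : A →⋆ₐ[ℂ] A) (i : Fin n) :
    α (S i) = cocycle S α * S i := by
  rw [cocycle, Finset.sum_mul, Finset.sum_eq_single i]
  · rw [mul_assoc, hS.isometry, mul_one]
  · intro j _ hj
    rw [mul_assoc, hS.orthogonal hj, mul_zero]
  · simp

theorem map_shift (α : A →⋆ₐ[ℂ] A) {u : A} (hu : ∀ i, α (S i) = u * S i) (x : A) :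
    α (shift S x) = u * shift S (α x) * star u := by
  simp only [shift, map_sum, map_mul, map_star, hu, Finset.mul_sum, Finset.sum_mul, star_mul,
    mul_assoc]

theorem mul_star_self_of_map_gen (hS : IsCuntzFamily S) {α : A →⋆ₐ[ℂ] A} {u : A}
    (hu : ∀ i, α (S i) = u * S i) : u * star u = 1 := by
  have := map_shift α hu 1
  have h1 : shift S 1 = 1 := map_one (shiftHom hS)
  rw [map_one, h1, map_one, mul_one] at this
  exact this.symm

theorem star_mul_self_of_map_gen (hS : IsCuntzFamily S) {α : A →⋆ₐ[ℂ] A} {u : A}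
    (hu : ∀ i, α (S i) = u * S i) : star u * u = 1 := by
  refine eq_of_star_word_mul_mul_word_eq hS 1 fun μ ν hμ hν => ?_
  obtain ⟨i, rfl⟩ := List.length_eq_one_iff.1 hμ
  obtain ⟨j, rfl⟩ := List.length_eq_one_iff.1 hν
  simp only [word_cons, word_nil, mul_one]
  calc star (S i) * (star u * u) * S j = star (u * S i) * (u * S j) := by
        simp only [star_mul, mul_assoc]
    _ = α (star (S i) * S j) := by rw [← hu, ← hu, map_mul, map_star]
    _ = star (S i) * S j := by
        by_cases h : i = j
        · rw [h, hS.isometry, map_one]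
        · rw [hS.orthogonal h, map_zero]

variable [Nontrivial A]

theorem gen_mul_mul_star_gen_mem_core (hS : IsCuntzFamily S) {o e : Fin n} (hoe : o ≠ e)
    {x : A} (hx : x ∈ core S) (i j : Fin n) :
    S i * x * star (S j) ∈ core S := by
  rw [mem_core_iff_gauge hS hoe]
  intro t
  rw [map_mul, map_mul, map_star, gauge_gen, gauge_gen, gauge_of_mem_core hS hoe hx, star_smul,
    smul_mul_assoc, smul_mul_smul_comm, mul_star_fourier_self, one_smul]

theorem star_gen_mul_mul_gen_mem_core (hS : IsCuntzFamily S) {o e : Fin n} (hoe : o ≠ e)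
    {x : A} (hx : x ∈ core S) (i j : Fin n) :
    star (S i) * x * S j ∈ core S := by
  rw [mem_core_iff_gauge hS hoe]
  intro t
  rw [map_mul, map_mul, map_star, gauge_gen, gauge_gen, gauge_of_mem_core hS hoe hx, star_smul,
    smul_mul_assoc, smul_mul_smul_comm, star_fourier_mul_self, one_smul]

/-- If an automorphism preserves the core, then its unitary lies in the core. The unitaries
`u⋆ γ_t(u)` commute with the core, so they are scalar. -/
theorem mem_core_of_autPreserving (hS : IsCuntzFamily S) {o e : Fin n} (hoe : o ≠ e)
    (hn : 2 ≤ n) {α : A ≃⋆ₐ[ℂ] A} {u : A}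
    (hu : ∀ i, α (S i) = u * S i) (h1 : ∀ x ∈ core S, α x ∈ core S)
    (h2 : ∀ x ∈ core S, α.symm x ∈ core S) : u ∈ core S := by
  have hu1 : star u * u = 1 := star_mul_self_of_map_gen hS (α := (α : A →⋆ₐ[ℂ] A)) hu
  have hu2 : u * star u = 1 := mul_star_self_of_map_gen hS (α := (α : A →⋆ₐ[ℂ] A)) hu
  have hconj : ∀ i j, ∀ x ∈ core S, u * (S i * x * star (S j)) * star u ∈ core S := by
    intro i j x hx
    have : u * (S i * x * star (S j)) * star u = α (S i * α.symm x * star (S j)) := by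
      rw [map_mul, map_mul, map_star, hu, hu, StarAlgEquiv.apply_symm_apply]
      simp only [star_mul, mul_assoc]
    rw [this]
    exact h1 _ (gen_mul_mul_star_gen_mem_core hS hoe (h2 x hx) i j)
  have hscalar : ∀ t, ∃ c : ℂ, gauge hS hoe t u = c • u := by
    intro t
    obtain ⟨v, hv⟩ : ∃ v, v = star u * gauge hS hoe t u := ⟨_, rfl⟩
    have hγ : star (gauge hS hoe t u) * gauge hS hoe t u = 1 := by
      rw [← map_star, ← map_mul, hu1, map_one]
    have hgen : ∀ i j, ∀ x ∈ core S, v * (S i * x * star (S j)) = S i * x * star (S j) * v := by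
      intro i j x hx
      have h3 := gauge_of_mem_core hS hoe (hconj i j x hx) t
      rw [map_mul, map_mul, gauge_of_mem_core hS hoe
        (gen_mul_mul_star_gen_mem_core hS hoe hx i j), map_star] at h3
      obtain ⟨y, hy⟩ : ∃ y, y = S i * x * star (S j) := ⟨_, rfl⟩
      rw [← hy] at h3 ⊢
      calc v * y = star u * (gauge hS hoe t u * y * star (gauge hS hoe t u))
            * gauge hS hoe t u := by
            rw [hv, mul_assoc, mul_assoc, mul_assoc, hγ, mul_one]
        _ = star u * u * y * (star u * gauge hS hoe t u) := by
            rw [h3]; simp only [mul_assoc]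
        _ = y * v := by rw [hu1, one_mul, hv]
    have hcomm : ∀ y ∈ core S, Commute v y := by
      intro y hy
      have : y = ∑ i, ∑ j, S i * (star (S i) * y * S j) * star (S j) := by
        calc y = (∑ i, S i * star (S i)) * y * ∑ j, S j * star (S j) := by
              rw [hS.sum_range, one_mul, mul_one]
          _ = _ := by
              simp only [Finset.sum_mul, Finset.mul_sum, mul_assoc]
              exact Finset.sum_comm
      rw [this]
      refine Commute.sum_right _ _ _ fun i _ => Commute.sum_right _ _ _ fun j _ => ?_
      exact hgen i j _ (star_gen_mul_mul_gen_mem_core hS hoe hy i j)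
    obtain ⟨c, hc⟩ := exists_eq_smul_one_of_commute hS hoe hcomm
    refine ⟨c, ?_⟩
    calc gauge hS hoe t u = u * v := by rw [hv, ← mul_assoc, hu2, one_mul]
      _ = c • u := by rw [hc, mul_smul_comm, mul_one]
  choose c hc using hscalar
  exact mem_core_of_gauge_eq_smul hS hoe hn hu1 hu2 hc

end Cocycle

/-! ### Property (P) for automorphisms that preserve the diagonal and the core -/

section PropertyP

variable {n : ℕ} {A : Type*} [CStarAlgebra A] {S : Fin n → A}

theorem eq_of_commute_of_norm_sub_lt_one {p q : A} (hp : IsIdempotentElem p)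
    (hq : IsIdempotentElem q) (hpq : Commute p q) (h : ‖p - q‖ < 1) : p = q := by
  have h3 : (p - q) * (p - q) * (p - q) = p - q := by
    have h1 : p * p = p := hp
    have h2 : q * q = q := hq
    have h4 : q * p = p * q := hpq.eq.symm
    have h5 : p * q * p = p * q := by rw [mul_assoc, h4, ← mul_assoc, h1]
    have h6 : p * q * q = p * q := by rw [mul_assoc, h2]
    simp only [sub_mul, mul_sub, h1, h2, h4, h5, h6]
    abel
  have h4 : ‖p - q‖ ≤ ‖p - q‖ * ‖p - q‖ * ‖p - q‖ := by
    conv_lhs => rw [← h3]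
    exact (norm_mul_le _ _).trans (by gcongr; exact norm_mul_le _ _)
  have h5 : ‖p - q‖ = 0 := by
    by_contra hne
    have hpos : 0 < ‖p - q‖ := lt_of_le_of_ne (norm_nonneg _) (Ne.symm hne)
    nlinarith [mul_pos hpos hpos, mul_pos hpos (sub_pos.2 h)]
  exact sub_eq_zero.1 (norm_eq_zero.1 h5)

theorem shiftPow_mem_diagonal (hS : IsCuntzFamily S) (k : ℕ) {x : A} (hx : x ∈ diagonal S) :
    shiftPow hS k x ∈ diagonal S := by
  induction k with
  | zero => exact hx
  | succ k ih => exact shift_mem_diagonal hS ih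

theorem isIdempotentElem_proj (hS : IsCuntzFamily S) (μ : List (Fin n)) :
    IsIdempotentElem (proj S μ) := by
  rw [IsIdempotentElem, proj, mul_assoc, star_word_mul_self_assoc hS]

theorem norm_proj_le (hS : IsCuntzFamily S) (μ : List (Fin n)) : ‖proj S μ‖ ≤ 1 := by
  have := norm_mul_mul_star_le (norm_le_one_of_isometry (star_word_mul_self hS μ)) 1
  rw [mul_one] at this
  refine this.trans ?_
  rcases subsingleton_or_nontrivial A with _ | _
  · simp [Subsingleton.elim (1 : A) 0]
  · rw [norm_one]

/-- If `u = α(w)⋆` with `w` in the core, then `u` asymptotically commutes with `α(φᵏ(P_i))`, as `w`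
does with `φᵏ(P_i)`. Hence `α(φᵏ⁺¹(P_i)) = u φ(α(φᵏ(P_i))) u⋆` is as close to the commuting
projection `φ(α(φᵏ(P_i)))` as desired, so that both agree for large `k`. -/
theorem exists_map_shiftPow_proj (hS : IsCuntzFamily S) {α : A ≃⋆ₐ[ℂ] A} {u w : A}
    (hu : ∀ i, α (S i) = u * S i) (hD : ∀ x ∈ diagonal S, α x ∈ diagonal S) (hw : w ∈ core S)
    (hwu : α w = star u) : ∃ m, ∀ k ≥ m, ∀ i : Fin n,
      α (shiftPow hS (k + 1) (proj S [i])) = shift S (α (shiftPow hS k (proj S [i]))) := by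
  have hu1 : star u * u = 1 := star_mul_self_of_map_gen hS (α := (α : A →⋆ₐ[ℂ] A)) hu
  have hu2 : u * star u = 1 := mul_star_self_of_map_gen hS (α := (α : A →⋆ₐ[ℂ] A)) hu
  obtain ⟨m, y, hy, hwy⟩ := exists_coreLevel_norm_sub_lt hw (ε := 1 / 4) (by norm_num)
  refine ⟨m, fun k hk i => ?_⟩
  obtain ⟨f, hf⟩ : ∃ f, f = shiftPow hS (k + 1) (proj S [i]) := ⟨_, rfl⟩
  obtain ⟨q, hq⟩ : ∃ q, q = shift S (α (shiftPow hS k (proj S [i]))) := ⟨_, rfl⟩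
  have hfD : f ∈ diagonal S := by rw [hf]; exact shiftPow_mem_diagonal hS _ (proj_mem_diagonal _)
  have hqD : q ∈ diagonal S := by
    rw [hq]
    exact shift_mem_diagonal hS (hD _ (shiftPow_mem_diagonal hS _ (proj_mem_diagonal _)))
  have hfi : f * f = f := by
    rw [hf, ← map_mul, (isIdempotentElem_proj hS [i]).eq]
  have hqi : q * q = q := by
    rw [hq, ← shift_mul hS, ← map_mul, ← map_mul, (isIdempotentElem_proj hS [i]).eq]
  have hαf : α f = u * q * star u := by
    rw [hf, hq, shiftPow_succ]
    exact map_shift (α : A →⋆ₐ[ℂ] A) hu _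
  have hqα : q = star u * α f * u := by
    rw [hαf]
    calc q = (star u * u) * q * (star u * u) := by rw [hu1, one_mul, mul_one]
      _ = _ := by simp only [mul_assoc]
  have hfn : ‖f‖ ≤ 1 := by
    rw [hf]
    exact (NonUnitalStarAlgHom.norm_apply_le _ _).trans (norm_proj_le hS _)
  rw [← hf, ← hq]
  refine eq_of_commute_of_norm_sub_lt_one (by rw [IsIdempotentElem, ← map_mul, hfi]) hqi
    (diagonal_commute hS (hD f hfD) hqD) ?_
  have hyf : y * f = f * y := by
    rw [hf]; exact commute_coreLevel_shiftPow hS (by omega) hy _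
  have hwf : ‖f * w - w * f‖ < 1 := by
    have h0 : f * w - w * f = f * (w - y) - (w - y) * f := by
      rw [mul_sub, sub_mul, hyf]; abel
    rw [h0]
    have a1 := norm_mul_le f (w - y)
    have a2 := norm_mul_le (w - y) f
    have a3 := norm_sub_le (f * (w - y)) ((w - y) * f)
    nlinarith [norm_nonneg f, norm_nonneg (w - y)]
  have hdiff : α f - q = α (f * w - w * f) * u := by
    rw [map_sub, map_mul, map_mul, hwu, sub_mul, mul_assoc, hu1, mul_one, ← hqα]
  rw [hdiff]
  have hun : ‖u‖ ≤ 1 := norm_le_one_of_isometry hu1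
  have a1 := norm_mul_le (α (f * w - w * f)) u
  have a2 : ‖α (f * w - w * f)‖ ≤ ‖f * w - w * f‖ :=
    NonUnitalStarAlgHom.norm_apply_le α _
  nlinarith [norm_nonneg u, norm_nonneg (α (f * w - w * f))]

theorem coe_diagShift_iterate (hS : IsCuntzFamily S) (k : ℕ) (x : diagonal S) :
    (((diagShift hS)^[k] x : diagonal S) : A) = shiftPow hS k x := by
  induction k with
  | zero => rfl
  | succ k ih =>
    rw [Function.iterate_succ_apply', shiftPow_succ, ← ih]; rfl

theorem eq_sum_smul_proj (hS : IsCuntzFamily S) {x : A} (hx : x ∈ diagonal S)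
    (hx1 : x ∈ coreLevel S 1) : ∃ c : Fin n → ℂ, x = ∑ i, c i • proj S [i] := by
  choose c hc using fun i => (mem_coreLevel_iff hS).1 hx1 [i] [i] rfl rfl
  refine ⟨c, eq_of_mul_word_eq hS 1 fun μ hμ => ?_⟩
  obtain ⟨j, rfl⟩ := List.length_eq_one_iff.1 hμ
  have h1 : (∑ i, c i • proj S [i]) * word S [j] = c j • word S [j] := by
    rw [Finset.sum_mul, Finset.sum_eq_single j]
    · have := proj_mul_word_append hS [j] []
      rw [List.append_nil] at this
      rw [smul_mul_assoc, this]
    · intro i _ hij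
      have := proj_mul_word_append_of_ne hS (μ := [i]) (κ := [j]) rfl (by simpa using hij) []
      rw [List.append_nil] at this
      rw [smul_mul_assoc, this, smul_zero]
    · simp
  rw [h1]
  have h2 : proj S [j] * x * word S [j] = c j • word S [j] := by
    rw [proj, mul_assoc, mul_assoc, ← mul_assoc (star _), hc, mul_smul_comm, mul_one]
  rw [← h2, (diagonal_commute hS (proj_mem_diagonal _) hx).eq, mul_assoc]
  have := proj_mul_word_append hS [j] []
  rw [List.append_nil] at this
  rw [this]

/-- The restriction of the shift to the diagonal as a unital `⋆`-endomorphism. -/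
noncomputable def diagShiftHom (hS : IsCuntzFamily S) : diagonal S →⋆ₐ[ℂ] diagonal S :=
  ((shiftHom hS).comp (diagonal S).subtype).codRestrict _ fun y => shift_mem_diagonal hS y.2

theorem diagShiftHom_apply (hS : IsCuntzFamily S) (x : diagonal S) :
    diagShiftHom hS x = diagShift hS x := rfl

theorem diagShift_iterate (hS : IsCuntzFamily S) (k : ℕ) (x : diagonal S) :
    (diagShift hS)^[k] x = (diagShiftHom hS ^ k) x := by
  induction k with
  | zero => rfl
  | succ k ih => rw [Function.iterate_succ_apply', ih, pow_succ']; rfl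

/-- Property (P) in terms of the projections `P_i`. -/
theorem propertyP_iff (hS : IsCuntzFamily S) {β : diagonal S ≃⋆ₐ[ℂ] diagonal S} :
    PropertyP hS β ↔ ∃ m, ∀ k ≥ m, ∀ i : Fin n,
      β ((diagShift hS)^[k + 1] ⟨proj S [i], proj_mem_diagonal [i]⟩)
        = diagShift hS (β ((diagShift hS)^[k] ⟨proj S [i], proj_mem_diagonal [i]⟩)) := by
  constructor
  · rintro ⟨m, hm⟩
    refine ⟨m, fun k hk i => ?_⟩
    have h1 : proj S [i] ∈ coreLevel S 1 := word_mul_star_word_mem_coreLevel rfl rfl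
    rw [hm (k + 1) (by omega) _ h1, hm k hk _ h1,
      ← Function.iterate_succ_apply' (diagShift hS), Nat.succ_sub hk]
  · rintro ⟨m, hm⟩
    refine ⟨m, fun k hk x hx => ?_⟩
    obtain ⟨j, rfl⟩ := Nat.exists_eq_add_of_le hk
    rw [Nat.add_sub_cancel_left]
    induction j with
    | zero => rfl
    | succ j ih =>
      rw [Function.iterate_succ_apply', ← ih (by omega)]
      obtain ⟨c, hc⟩ := eq_sum_smul_proj hS x.2 hx
      have hx' : x = ∑ i, c i • (⟨proj S [i], proj_mem_diagonal [i]⟩ : diagonal S) := by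
        refine Subtype.ext ?_
        rw [hc]
        simp
      have hP := hm (m + j) (by omega)
      simp only [diagShift_iterate, ← diagShiftHom_apply] at hP ⊢
      rw [hx']
      simp only [map_sum, map_smul]
      exact Finset.sum_congr rfl fun i _ => congrArg (c i • ·) (hP i)

end PropertyP

/-! ### Permutation unitaries -/

section Permutation

open Filter Topology

variable {n : ℕ} {A : Type*} [CStarAlgebra A] {S : Fin n → A}

/-- Left multiplication by `u` maps the words `S_ν`, `|ν| = L`, to each other. For unitaries `u`
this says that `u = ∑ S_{σ(ν)} S_ν⋆` for a permutation `σ` of the multi-indices of length `L`. -/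
def PermutesWords (S : Fin n → A) (L : ℕ) (u : A) : Prop :=
  ∀ ν : List (Fin n), ν.length = L → ∃ μ, μ.length = L ∧ u * word S ν = word S μ

theorem PermutesWords.mono {L M : ℕ} (hLM : L ≤ M) {u : A} (hu : PermutesWords S L u) :
    PermutesWords S M u := by
  intro ν hν
  obtain ⟨μ, hμ, h⟩ := hu (ν.take L) (by simp; omega)
  refine ⟨μ ++ ν.drop L, by simp; omega, ?_⟩
  rw [word_append, ← h, mul_assoc, ← word_append, List.take_append_drop]

theorem PermutesWords.mul {L : ℕ} {u v : A} (hu : PermutesWords S L u)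
    (hv : PermutesWords S L v) : PermutesWords S L (u * v) := by
  intro ν hν
  obtain ⟨μ, hμ, h⟩ := hv ν hν
  obtain ⟨κ, hκ, h'⟩ := hu μ hμ
  exact ⟨κ, hκ, by rw [mul_assoc, h, h']⟩

theorem permutesWords_one (L : ℕ) : PermutesWords S L (1 : A) :=
  fun ν hν => ⟨ν, hν, one_mul _⟩

theorem PermutesWords.shift (hS : IsCuntzFamily S) {L : ℕ} {u : A} (hu : PermutesWords S L u) :
    PermutesWords S (L + 1) (shift S u) := by
  intro ν hν
  match ν with
  | i :: ν =>
    obtain ⟨μ, hμ, h⟩ := hu ν (by simpa using hν)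
    exact ⟨i :: μ, by simp [hμ], by
      rw [word_cons, ← mul_assoc, shift_mul_gen hS, mul_assoc, h, word_cons]⟩

theorem word_injective_of_length [Nontrivial A] (hS : IsCuntzFamily S) {μ ν : List (Fin n)}
    (hl : μ.length = ν.length) (h : word S μ = word S ν) : μ = ν := by
  by_contra hne
  have h1 := star_word_mul_word_of_ne hS hl hne
  rw [← h, star_word_mul_self hS] at h1
  exact one_ne_zero h1

theorem PermutesWords.star [Nontrivial A] (hS : IsCuntzFamily S) {L : ℕ} {u : A}
    (hu1 : star u * u = 1) (hu : PermutesWords S L u) : PermutesWords S L (star u) := by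
  choose! f hf using hu
  have hmaps : Set.MapsTo f (words n L) (words n L) := fun ν hν =>
    Finset.mem_coe.2 (mem_words.2 (hf ν (mem_words.1 hν)).1)
  have hinj : Set.InjOn f (words n L) := by
    intro ν hν κ hκ h
    have h1 := hf ν (mem_words.1 hν)
    have h2 := hf κ (mem_words.1 hκ)
    refine word_injective_of_length hS ((mem_words.1 hν).trans (mem_words.1 hκ).symm) ?_
    rw [← one_mul (word S ν), ← one_mul (word S κ), ← hu1, mul_assoc, mul_assoc, h1.2, h2.2, h]
  intro μ hμ
  obtain ⟨ν, hν, rfl⟩ := Finset.surjOn_of_injOn_of_card_le f hmaps hinj le_rfl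
    (Finset.mem_coe.2 (mem_words.2 hμ))
  refine ⟨ν, mem_words.1 hν, ?_⟩
  rw [← (hf ν (mem_words.1 hν)).2, ← mul_assoc, hu1, one_mul]

theorem PermutesWords.mem_coreLevel (hS : IsCuntzFamily S) {L : ℕ} {u : A}
    (hu : PermutesWords S L u) : u ∈ coreLevel S L := by
  rw [eq_sum_words hS L u]
  refine sum_mem fun ν hν => ?_
  obtain ⟨μ, hμ, h⟩ := hu ν (mem_words.1 hν)
  rw [h]
  exact word_mul_star_word_mem_coreLevel hμ (mem_words.1 hν)

theorem PermutesWords.mem_permUnitaries (hS : IsCuntzFamily S) {L : ℕ} {u : A}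
    (hu : PermutesWords S L u) (h1 : Star.star u * u = 1) (h2 : u * Star.star u = 1) :
    u ∈ permUnitaries S := by
  refine ⟨⟨Unitary.mem_iff.2 ⟨h1, h2⟩, ?_⟩, coreLevel_subset_core (hu.mem_coreLevel hS)⟩
  choose! f hf using hu
  refine ⟨(words n L).card, fun j => f ((words n L).equivFin.symm j),
    fun j => (words n L).equivFin.symm j, ?_⟩
  rw [Equiv.sum_comp (words n L).equivFin.symm
    (fun ν : words n L => word S (f ν) * Star.star (word S (ν : List (Fin n)))),
    Finset.sum_coe_sort (words n L) fun ν => word S (f ν) * Star.star (word S ν)]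
  conv_lhs => rw [eq_sum_words hS L u]
  exact Finset.sum_congr rfl fun ν hν => by rw [(hf ν (mem_words.1 hν)).2]

/-- If a sum of words of equal length is an isometry, then it consists of one word only. -/
theorem exists_sum_word_eq [Nontrivial A] (hS : IsCuntzFamily S) {ι : Type*} (J : Finset ι)
    (κ : ι → List (Fin n)) {L : ℕ} (hκ : ∀ j ∈ J, (κ j).length = L)
    (h : star (∑ j ∈ J, word S (κ j)) * ∑ j ∈ J, word S (κ j) = 1) :
    ∃ j ∈ J, ∑ j ∈ J, word S (κ j) = word S (κ j) := by
  classical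
  have hcount : star (∑ j ∈ J, word S (κ j)) * ∑ j ∈ J, word S (κ j)
      = ((∑ i ∈ J, ∑ j ∈ J, if κ i = κ j then 1 else 0 : ℕ) : ℂ) • (1 : A) := by
    rw [star_sum, Finset.sum_mul_sum, Nat.cast_sum, Finset.sum_smul]
    refine Finset.sum_congr rfl fun i hi => ?_
    rw [Nat.cast_sum, Finset.sum_smul]
    refine Finset.sum_congr rfl fun j hj => ?_
    split_ifs with hij
    · rw [hij, star_word_mul_self hS]; simp
    · rw [star_word_mul_word_of_ne hS ((hκ i hi).trans (hκ j hj).symm) hij]; simp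
  rw [h] at hcount
  have h1 : (∑ i ∈ J, ∑ j ∈ J, if κ i = κ j then 1 else 0 : ℕ) = 1 := by
    have h2 : (((∑ i ∈ J, ∑ j ∈ J, if κ i = κ j then 1 else 0 : ℕ) : ℂ) - 1) • (1 : A) = 0 := by
      rw [sub_smul, ← hcount, one_smul, sub_self]
    rw [smul_eq_zero_iff_left one_ne_zero, sub_eq_zero] at h2
    exact_mod_cast h2
  have hcard : J.card ≤ 1 := by
    rw [← h1, Finset.card_eq_sum_ones]
    refine Finset.sum_le_sum fun i hi => ?_
    refine le_trans ?_ (Finset.single_le_sum (fun _ _ => Nat.zero_le _) hi)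
    simp
  have hne : J.Nonempty := by
    by_contra hemp
    rw [Finset.not_nonempty_iff_eq_empty] at hemp
    simp [hemp] at h1
  obtain ⟨j, rfl⟩ := Finset.card_eq_one.1 (le_antisymm hcard (Finset.card_pos.2 hne))
  exact ⟨j, by simp⟩

theorem coreExp_sum [Nontrivial A] (hS : IsCuntzFamily S) {o e : Fin n} (hoe : o ≠ e) {ι : Type*}
    (J : Finset ι) (f : ι → A) :
    coreExp hS hoe (∑ j ∈ J, f j) = ∑ j ∈ J, coreExp hS hoe (f j) := by
  have := tendsto_finsetSum J fun j _ => tendsto_coreExp hS hoe (f j)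
  refine tendsto_nhds_unique (tendsto_coreExp hS hoe _) (this.congr fun k => ?_)
  rw [Finset.mul_sum, Finset.sum_mul]

theorem coreExp_word_of_length_ne [Nontrivial A] (hS : IsCuntzFamily S) {o e : Fin n}
    (hoe : o ≠ e) {μ ν : List (Fin n)} (hl : μ.length ≠ ν.length) :
    coreExp hS hoe (word S μ * star (word S ν)) = 0 := by
  refine tendsto_nhds_unique (tendsto_coreExp hS hoe _) (tendsto_const_nhds.congr' ?_)
  filter_upwards [eventually_ge_atTop ν.length, eventually_ge_atTop μ.length] with k hk hk'
  exact (star_spread_mul_word_mul_spread hS hoe hk' hk hl).symm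

theorem exists_permutesWords [Nontrivial A] (hS : IsCuntzFamily S) {o e : Fin n} (hoe : o ≠ e)
    {u : A} (hu : u ∈ permUnitaries S) : ∃ L, PermutesWords S L u := by
  classical
  obtain ⟨⟨huu, m, μ, ν, hsum⟩, hcore⟩ := hu
  -- the expectation onto the core deletes the words `S_μ S_ν⋆` with `|μ| ≠ |ν|`
  have hsum' : u = ∑ j with (μ j).length = (ν j).length, word S (μ j) * star (word S (ν j)) := by
    rw [Finset.sum_filter]
    calc u = coreExp hS hoe u :=
          (coreExp_of_gauge hS hoe ((mem_core_iff_gauge hS hoe).1 hcore)).symm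
      _ = ∑ j, coreExp hS hoe (word S (μ j) * star (word S (ν j))) := by
          rw [hsum, coreExp_sum]
      _ = _ := by
          refine Finset.sum_congr rfl fun j _ => ?_
          split_ifs with hl
          · exact coreExp_of_gauge hS hoe ((mem_core_iff_gauge hS hoe).1
              (coreLevel_subset_core (word_mul_star_word_mem_coreLevel hl rfl)))
          · exact coreExp_word_of_length_ne hS hoe hl
  refine ⟨Finset.univ.sup fun j => (ν j).length, fun κ hκ => ?_⟩
  have hle : ∀ j, (ν j).length ≤ κ.length := fun j => by
    rw [hκ]; exact Finset.le_sup (f := fun j => (ν j).length) (Finset.mem_univ j)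
  have hterm : u * word S κ = ∑ j with (μ j).length = (ν j).length ∧ ν j = κ.take (ν j).length,
      word S (μ j ++ κ.drop (ν j).length) := by
    rw [← Finset.filter_filter, Finset.sum_filter, hsum', Finset.sum_mul]
    refine Finset.sum_congr rfl fun j _ => ?_
    have hκs : word S κ = word S (κ.take (ν j).length) * word S (κ.drop (ν j).length) := by
      rw [← word_append, List.take_append_drop]
    rw [mul_assoc]
    split_ifs with h
    · rw [hκs, ← h, star_word_mul_self_assoc hS, word_append]
    · rw [hκs, star_word_mul_word_of_ne_assoc hS (by simp [hle j]) h, mul_zero]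
  have hiso : star (u * word S κ) * (u * word S κ) = 1 := by
    rw [star_mul, mul_assoc, ← mul_assoc (star u), (Unitary.mem_iff.1 huu).1, one_mul,
      star_word_mul_self hS]
  rw [hterm] at hiso ⊢
  have hlen : ∀ j ∈ Finset.univ.filter
      (fun j => (μ j).length = (ν j).length ∧ ν j = κ.take (ν j).length),
      (μ j ++ κ.drop (ν j).length).length = κ.length := fun j hj => by
    have h1 := (Finset.mem_filter.1 hj).2.1
    have h2 := hle j
    simp only [List.length_append, List.length_drop]
    omega
  obtain ⟨j, hj, h⟩ := exists_sum_word_eq hS _ _ hlen hiso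
  exact ⟨_, (hlen j hj).trans hκ, h⟩

theorem commute_of_commute_proj {u : A} (hu1 : star u * u = 1) (hu2 : u * star u = 1)
    (h : ∀ μ, Commute u (proj S μ)) {x : A} (hx : x ∈ diagonal S) : Commute u x := by
  have hcl : IsClosed (StarSubalgebra.centralizer ℂ {u} : Set A) := by
    rw [StarSubalgebra.coe_centralizer]; exact Set.isClosed_centralizer _
  have h1 : diagonal S ≤ StarSubalgebra.centralizer ℂ {u} := diagonal_le hcl fun μ => by
    rw [StarSubalgebra.mem_centralizer_iff]
    rintro _ rfl
    refine ⟨(h μ).eq, ?_⟩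
    have := congrArg star (h μ).eq
    rw [star_mul, star_mul, star_proj] at this
    exact this.symm
  exact ((StarSubalgebra.mem_centralizer_iff ℂ).1 (h1 hx) u rfl).1

theorem proj_cons (i : Fin n) (hS : IsCuntzFamily S) (μ : List (Fin n)) :
    proj S (i :: μ) = proj S [i] * shift S (proj S μ) := by
  have h1 : star (word S [i]) * shift S (proj S μ) = proj S μ * star (word S [i]) :=
    star_word_mul_shiftPow_eq hS (μ := [i]) (k := 1) rfl (proj S μ)
  rw [proj, proj, mul_assoc (word S [i]), h1, word_cons, word_cons, word_nil, mul_one, star_mul,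
    proj]
  simp only [mul_assoc]

/-- The unitary of an endomorphism that fixes the diagonal commutes with the diagonal. -/
theorem commute_of_map_diagonal (hS : IsCuntzFamily S) {α : A →⋆ₐ[ℂ] A} {u : A}
    (hu : ∀ i, α (S i) = u * S i) (hα : ∀ x ∈ diagonal S, α x = x) {x : A}
    (hx : x ∈ diagonal S) : Commute u x := by
  have hu1 := star_mul_self_of_map_gen hS hu
  have hu2 := mul_star_self_of_map_gen hS hu
  refine commute_of_commute_proj hu1 hu2 (fun μ => ?_) hx
  have hconj : ∀ y : A, y = u * y * star u → Commute u y := fun y hy => by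
    rw [commute_iff_eq]
    conv_rhs => rw [hy, mul_assoc, hu1, mul_one]
  cases μ with
  | nil => rw [proj, word_nil, star_one, mul_one]; exact Commute.one_right u
  | cons i μ =>
    rw [proj_cons i hS]
    refine Commute.mul_right (hconj _ ?_) (hconj _ ?_)
    · conv_lhs => rw [← hα _ (proj_mem_diagonal [i])]
      simp only [proj, word_cons, word_nil, mul_one, map_mul, map_star, hu, star_mul, mul_assoc]
    · conv_lhs => rw [← hα _ (shift_mem_diagonal hS (proj_mem_diagonal μ)), map_shift α hu,
        hα _ (proj_mem_diagonal μ)]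

theorem PermutesWords.eq_one [Nontrivial A] (hS : IsCuntzFamily S) {L : ℕ} {u : A}
    (hu : PermutesWords S L u) (hu2 : u * Star.star u = 1)
    (hc : ∀ x ∈ diagonal S, Commute u x) : u = 1 := by
  refine eq_of_mul_word_eq hS L fun ν hν => ?_
  obtain ⟨μ, hμ, h⟩ := hu ν hν
  have hP : proj S μ = proj S ν := by
    rw [proj, ← h, star_mul]
    calc u * word S ν * (Star.star (word S ν) * Star.star u)
        = u * proj S ν * Star.star u := by rw [proj]; simp only [mul_assoc]
      _ = proj S ν := by
          rw [(hc _ (proj_mem_diagonal ν)).eq, mul_assoc, hu2, mul_one]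
  have hμν : μ = ν := by
    by_contra hne
    have h1 := proj_mul_word_append hS ν []
    have h2 := proj_mul_word_append_of_ne hS (hμ.trans hν.symm) hne []
    rw [List.append_nil] at h1 h2
    rw [hP, h1] at h2
    have h3 := star_word_mul_self hS ν
    rw [h2, mul_zero] at h3
    exact zero_ne_one h3
  rw [h, hμν, one_mul]

/-- The unitaries `u_k = u φ(u) ⋯ φᵏ⁻¹(u)`, which implement `λ_u` on the `k`-th level of the
core. -/
noncomputable def cocyclePow (S : Fin n → A) (u : A) : ℕ → A
  | 0 => 1
  | k + 1 => u * shift S (cocyclePow S u k)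

theorem map_word_eq_cocyclePow_mul (hS : IsCuntzFamily S) {α : A →⋆ₐ[ℂ] A} {u : A}
    (hu : ∀ i, α (S i) = u * S i) (μ : List (Fin n)) :
    α (word S μ) = cocyclePow S u μ.length * word S μ := by
  induction μ with
  | nil => simp [cocyclePow]
  | cons i μ ih =>
    rw [word_cons, map_mul, ih, hu, List.length_cons, cocyclePow, mul_assoc, mul_assoc,
      ← mul_assoc (shift S _), shift_mul_gen hS, mul_assoc]

theorem map_coreLevel_eq (hS : IsCuntzFamily S) {α : A →⋆ₐ[ℂ] A} {u : A}
    (hu : ∀ i, α (S i) = u * S i) {k : ℕ} {x : A} (hx : x ∈ coreLevel S k) :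
    α x = cocyclePow S u k * x * star (cocyclePow S u k) := by
  induction hx using Submodule.span_induction with
  | mem x hx =>
    obtain ⟨μ, ν, hμ, hν, rfl⟩ := hx
    rw [map_mul, map_star, map_word_eq_cocyclePow_mul hS hu, map_word_eq_cocyclePow_mul hS hu,
      hμ, hν, star_mul]
    simp only [mul_assoc]
  | zero => simp
  | add x y _ _ hx hy => rw [map_add, hx, hy, mul_add, add_mul]
  | smul a x _ hx => rw [map_smul, hx, mul_smul_comm, smul_mul_assoc]

theorem cocyclePow_star_mul_self (hS : IsCuntzFamily S) {u : A} (hu : star u * u = 1) (k : ℕ) :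
    star (cocyclePow S u k) * cocyclePow S u k = 1 := by
  induction k with
  | zero => simp [cocyclePow]
  | succ k ih =>
    have h : star (shift S (cocyclePow S u k)) * shift S (cocyclePow S u k) = 1 := by
      change star (shiftHom hS _) * shiftHom hS _ = 1
      rw [← map_star, ← map_mul, ih, map_one]
    rw [cocyclePow, star_mul, mul_assoc, ← mul_assoc (star u), hu, one_mul, h]

theorem exists_permutesWords_cocyclePow (hS : IsCuntzFamily S) {u : A} {L : ℕ}
    (hu : PermutesWords S L u) (k : ℕ) : ∃ M, PermutesWords S M (cocyclePow S u k) := by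
  induction k with
  | zero => exact ⟨0, permutesWords_one 0⟩
  | succ k ih =>
    obtain ⟨M, hM⟩ := ih
    exact ⟨max L (M + 1), (hu.mono (le_max_left _ _)).mul
      ((hM.shift hS).mono (le_max_right _ _))⟩

/-- An endomorphism with a permutation unitary maps permutation unitaries to permutation
unitaries. -/
theorem exists_permutesWords_map [Nontrivial A] (hS : IsCuntzFamily S) {α : A →⋆ₐ[ℂ] A} {u w : A}
    (hα : ∀ i, α (S i) = u * S i) {L M : ℕ} (hu : PermutesWords S L u)
    (hw : PermutesWords S M w) : ∃ N, PermutesWords S N (α w) := by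
  have hu1 := star_mul_self_of_map_gen hS hα
  obtain ⟨N, hN⟩ := exists_permutesWords_cocyclePow hS hu M
  have hN' := hN.star hS (cocyclePow_star_mul_self hS hu1 M)
  refine ⟨max M N, ?_⟩
  rw [map_coreLevel_eq hS hα (hw.mem_coreLevel hS)]
  exact ((hN.mono (le_max_right _ _)).mul (hw.mono (le_max_left _ _))).mul
    (hN'.mono (le_max_right _ _))

theorem proj_eq_sum (hS : IsCuntzFamily S) (μ : List (Fin n)) (k : ℕ) :
    proj S μ = ∑ ρ ∈ words n k, proj S (μ ++ ρ) := by
  calc proj S μ = word S μ * (∑ ρ ∈ words n k, proj S ρ) * star (word S μ) := by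
        rw [sum_words_proj hS, mul_one, proj]
    _ = _ := by
        simp only [Finset.mul_sum, Finset.sum_mul, proj, word_append, star_mul, mul_assoc]

theorem map_mem_diagonal_of_permutesWords (hS : IsCuntzFamily S) {α : A →⋆ₐ[ℂ] A} {u : A}
    (hα : ∀ i, α (S i) = u * S i) {L : ℕ} (hu : PermutesWords S L u) {x : A}
    (hx : x ∈ diagonal S) : α x ∈ diagonal S := by
  have hle : diagonal S ≤ (diagonal S).comap α :=
    diagonal_le (isClosed_diagonal.preimage (continuous_starAlgHom α)) fun μ => by
      change α (proj S μ) ∈ diagonal S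
      obtain ⟨M, hM⟩ := exists_permutesWords_cocyclePow hS hu μ.length
      have hP : proj S μ ∈ coreLevel S μ.length := word_mul_star_word_mem_coreLevel rfl rfl
      rw [map_coreLevel_eq hS hα hP, proj_eq_sum hS μ M, Finset.mul_sum, Finset.sum_mul]
      refine sum_mem fun ρ hρ => ?_
      obtain ⟨κ, -, hκ⟩ := hM.mono (Nat.le_add_left M μ.length) (μ ++ ρ)
        (by rw [List.length_append, mem_words.1 hρ])
      have : cocyclePow S u μ.length * proj S (μ ++ ρ) * star (cocyclePow S u μ.length)
          = proj S κ := by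
        rw [proj, proj, ← hκ, star_mul]; simp only [mul_assoc]
      rw [this]
      exact proj_mem_diagonal κ
  exact hle hx

end Permutation

/-! ### Extending automorphisms of the diagonal -/

section Extension

variable {n : ℕ} {A : Type*} [CStarAlgebra A] {S : Fin n → A}

/-- The range projection `P_μ` as an element of the diagonal. -/
noncomputable def diagProj (S : Fin n → A) (μ : List (Fin n)) : diagonal S :=
  ⟨proj S μ, proj_mem_diagonal μ⟩

theorem coe_diagProj (μ : List (Fin n)) : (diagProj S μ : A) = proj S μ := rfl

theorem diagProj_nil : diagProj S [] = 1 := Subtype.ext (by simp [diagProj, proj])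

theorem diagProj_cons (hS : IsCuntzFamily S) (i : Fin n) (μ : List (Fin n)) :
    diagProj S (i :: μ) = diagProj S [i] * diagShiftHom hS (diagProj S μ) :=
  Subtype.ext (proj_cons i hS μ)

theorem diagProj_append (hS : IsCuntzFamily S) (μ ν : List (Fin n)) :
    diagProj S (μ ++ ν) = diagProj S μ * (diagShiftHom hS ^ μ.length) (diagProj S ν) := by
  induction μ with
  | nil => rw [diagProj_nil, one_mul]; rfl
  | cons i μ ih =>
    rw [List.cons_append, diagProj_cons hS, ih, map_mul, ← mul_assoc, ← diagProj_cons,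
      List.length_cons, pow_succ']
    rfl

theorem coe_diagShiftHom_pow (hS : IsCuntzFamily S) (k : ℕ) (x : diagonal S) :
    (((diagShiftHom hS ^ k) x : diagonal S) : A) = shiftPow hS k x := by
  rw [← diagShift_iterate, coe_diagShift_iterate]

theorem diagonal_hom_ext_proj (hS : IsCuntzFamily S) {B : Type*} [CStarAlgebra B]
    {f g : diagonal S →⋆ₐ[ℂ] B} (m : ℕ)
    (h : ∀ μ : List (Fin n), m ≤ μ.length → f (diagProj S μ) = g (diagProj S μ)) : f = g := by
  have hDc : IsClosed (diagonal S : Set A) := isClosed_diagonal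
  have hcl : IsClosed ((StarAlgHom.equalizer f g).map (diagonal S).subtype : Set A) :=
    hDc.isClosedEmbedding_subtypeVal.isClosedMap _
      (isClosed_eq (continuous_starAlgHom f) (continuous_starAlgHom g))
  have hle := diagonal_le hcl fun μ => by
    refine ⟨diagProj S μ, ?_, rfl⟩
    have hsum : diagProj S μ = ∑ ρ ∈ words n m, diagProj S (μ ++ ρ) :=
      Subtype.ext (by simpa [diagProj] using proj_eq_sum hS μ m)
    change f _ = g _
    rw [hsum, map_sum, map_sum]
    exact Finset.sum_congr rfl fun ρ hρ => h _ (by simp [mem_words.1 hρ])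
  ext x
  obtain ⟨y, hy, hyx⟩ := hle x.2
  have : y = x := Subtype.ext hyx
  exact this ▸ hy

theorem diagonal_hom_ext_shift (hS : IsCuntzFamily S) {B : Type*} [CStarAlgebra B]
    {f g : diagonal S →⋆ₐ[ℂ] B}
    (h : ∀ j i, f ((diagShiftHom hS ^ j) (diagProj S [i]))
      = g ((diagShiftHom hS ^ j) (diagProj S [i]))) : f = g := by
  refine diagonal_hom_ext_proj hS 0 fun μ _ => ?_
  have key : ∀ j, f ((diagShiftHom hS ^ j) (diagProj S μ))
      = g ((diagShiftHom hS ^ j) (diagProj S μ)) := by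
    induction μ with
    | nil =>
      intro j
      rw [diagProj_nil, map_one, map_one, map_one]
    | cons i μ ih =>
      intro j
      have hj := ih (by simp) (j + 1)
      rw [pow_succ] at hj
      rw [diagProj_cons hS, map_mul, map_mul, map_mul, h]
      exact congrArg _ hj
  exact key 0

/-- Property (P) for `β` says that `β φ` and `φ β` agree on the range of `φᵐ`. -/
theorem PropertyP.exists_map_shift_eq {hS : IsCuntzFamily S}
    {β : diagonal S ≃⋆ₐ[ℂ] diagonal S} (hβ : PropertyP hS β) :
    ∃ m, ∀ y : diagonal S, β (diagShiftHom hS ((diagShiftHom hS ^ m) y))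
      = diagShiftHom hS (β ((diagShiftHom hS ^ m) y)) := by
  obtain ⟨m, hm⟩ := (propertyP_iff hS).1 hβ
  refine ⟨m, fun y => ?_⟩
  have : ((β : diagonal S →⋆ₐ[ℂ] diagonal S).comp (diagShiftHom hS)).comp (diagShiftHom hS ^ m)
      = ((diagShiftHom hS).comp (β : diagonal S →⋆ₐ[ℂ] diagonal S)).comp
        (diagShiftHom hS ^ m) := by
    have hDc : IsClosed (diagonal S : Set A) := isClosed_diagonal
    refine diagonal_hom_ext_shift (B := diagonal S) hS fun j i => ?_
    have h1 := hm (m + j) (by omega) i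
    rw [diagShift_iterate, diagShift_iterate, ← diagShiftHom_apply, pow_succ', pow_add] at h1
    exact h1
  exact congrArg (fun F : diagonal S →⋆ₐ[ℂ] diagonal S => F y) this

/-- An idempotent at distance less than `1 / 2` from a scalar is `0` or `1`. -/
theorem eq_zero_or_eq_one_of_norm_sub_smul_lt {p : A} (hp : p * p = p) {c : ℂ}
    (h : ‖p - c • 1‖ < 1 / 2) : p = 0 ∨ p = 1 := by
  rcases subsingleton_or_nontrivial A with _ | _
  · exact Or.inl (Subsingleton.elim _ _)
  by_contra! hcon
  obtain ⟨h0, h1⟩ := hcon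
  have h1' : 1 - p ≠ 0 := sub_ne_zero.2 (Ne.symm h1)
  have a1 : (1 - c) • p = p * (p - c • 1) := by
    rw [mul_sub, hp, mul_smul_comm, mul_one, sub_smul, one_smul]
  have a2 : (-c) • (1 - p) = (1 - p) * (p - c • 1) := by
    rw [mul_sub, sub_mul, hp, one_mul, sub_self, mul_smul_comm, mul_one, zero_sub, neg_smul]
  have b1 := norm_mul_le p (p - c • 1)
  have b2 := norm_mul_le (1 - p) (p - c • 1)
  rw [← a1, norm_smul] at b1
  rw [← a2, norm_smul, norm_neg] at b2
  have c1 : ‖1 - c‖ < 1 / 2 := by nlinarith [norm_pos_iff.2 h0]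
  have c2 : ‖c‖ < 1 / 2 := by nlinarith [norm_pos_iff.2 h1']
  have := norm_add_le (1 - c) c
  rw [sub_add_cancel, norm_one] at this
  linarith

/-- Projections of the diagonal are locally constant: each of them is a sum of projections `P_μ`
with `|μ| = L`. -/
theorem exists_level_of_mem_diagonal (hS : IsCuntzFamily S) {p : A} (hp : p ∈ diagonal S)
    (hpp : p * p = p) : ∃ L, ∀ μ : List (Fin n), L ≤ μ.length →
      p * word S μ = 0 ∨ p * word S μ = word S μ := by
  obtain ⟨L, y, hy, hpy⟩ := exists_coreLevel_norm_sub_lt (diagonal_le_coreAlg hS hp)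
    (ε := 1 / 2) (by norm_num)
  refine ⟨L, fun μ hμ => ?_⟩
  obtain ⟨c, hc⟩ := (mem_coreLevel_iff hS).1 (coreLevel_mono hS hμ hy) μ μ rfl rfl
  have hcomm : word S μ * (star (word S μ) * p * word S μ) = p * word S μ := by
    rw [← mul_assoc, ← mul_assoc]
    change proj S μ * p * word S μ = _
    rw [(diagonal_commute hS (proj_mem_diagonal μ) hp).eq, mul_assoc, proj, mul_assoc,
      star_word_mul_self hS, mul_one]
  have hq : star (word S μ) * p * word S μ * (star (word S μ) * p * word S μ)
      = star (word S μ) * p * word S μ := by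
    rw [mul_assoc, hcomm, ← mul_assoc, mul_assoc (star _) p p, hpp]
  have hlt : ‖star (word S μ) * p * word S μ - c • 1‖ < 1 / 2 := by
    rw [← hc, ← sub_mul, ← mul_sub]
    exact (norm_star_mul_mul_le (norm_le_one_of_isometry (star_word_mul_self hS μ)) _).trans_lt hpy
  rcases eq_zero_or_eq_one_of_norm_sub_smul_lt hq hlt with h | h
  · exact Or.inl (by rw [← hcomm, h, mul_zero])
  · exact Or.inr (by rw [← hcomm, h, mul_one])

theorem exists_unitary_of_injOn (hS : IsCuntzFamily S) {L : ℕ} {g : List (Fin n) → List (Fin n)}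
    (hg : Set.MapsTo g (words n L) (words n L)) (hinj : Set.InjOn g (words n L)) :
    ∃ u : A, star u * u = 1 ∧ u * star u = 1 ∧
      ∀ ν : List (Fin n), ν.length = L → u * word S ν = word S (g ν) := by
  have hgl : ∀ {ν}, ν.length = L → (g ν).length = L := fun hν =>
    mem_words.1 (hg (Finset.mem_coe.2 (mem_words.2 hν)))
  obtain ⟨u, hu⟩ : ∃ u : A, u = ∑ ν ∈ words n L, word S (g ν) * star (word S ν) := ⟨_, rfl⟩
  have huw : ∀ ν : List (Fin n), ν.length = L → u * word S ν = word S (g ν) := fun ν hν => by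
    rw [hu]; exact sum_words_mul_word hS L (fun ν => word S (g ν)) hν
  have h1 : star u * u = 1 := by
    refine eq_of_star_word_mul_mul_word_eq hS L fun μ ν hμ hν => ?_
    have : star (word S μ) * (star u * u) * word S ν = star (word S (g μ)) * word S (g ν) := by
      rw [← huw μ hμ, ← huw ν hν, star_mul]; simp only [mul_assoc]
    rw [this, mul_one]
    by_cases h : μ = ν
    · rw [h, star_word_mul_self hS, star_word_mul_self hS]
    · rw [star_word_mul_word_of_ne hS (hμ.trans hν.symm) h,
        star_word_mul_word_of_ne hS ((hgl hμ).trans (hgl hν).symm)]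
      exact fun h' => h (hinj (Finset.mem_coe.2 (mem_words.2 hμ))
        (Finset.mem_coe.2 (mem_words.2 hν)) h')
  refine ⟨u, h1, eq_of_mul_word_eq hS L fun μ hμ => ?_, huw⟩
  obtain ⟨ν, hν, rfl⟩ := Finset.surjOn_of_injOn_of_card_le g hg hinj le_rfl
    (Finset.mem_coe.2 (mem_words.2 hμ))
  rw [← huw ν (mem_words.1 hν), ← mul_assoc, mul_assoc u, h1, mul_one, one_mul]

/-- The images under `α` of the projections `P_i φ(α⁻¹(P_μ))`, for `κ = iμ`. If `λ_u` extends `α`,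
then this is `u P_κ u⋆`. -/
noncomputable def targetProj (hS : IsCuntzFamily S) (α : diagonal S ≃⋆ₐ[ℂ] diagonal S)
    (κ : List (Fin n)) : diagonal S :=
  α (diagProj S (κ.take 1) * diagShiftHom hS (α.symm (diagProj S (κ.drop 1))))

theorem diagProj_mul_self (hS : IsCuntzFamily S) (μ : List (Fin n)) :
    diagProj S μ * diagProj S μ = diagProj S μ :=
  Subtype.ext (isIdempotentElem_proj hS μ).eq

theorem diagonal_mul_comm (hS : IsCuntzFamily S) (x y : diagonal S) : x * y = y * x :=
  Subtype.ext (diagonal_commute hS x.2 y.2).eq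

theorem diagProj_mul_of_ne (hS : IsCuntzFamily S) {μ ν : List (Fin n)} (hl : μ.length = ν.length)
    (hne : μ ≠ ν) : diagProj S μ * diagProj S ν = 0 :=
  Subtype.ext (by
    change proj S μ * proj S ν = 0
    rw [proj, proj, mul_assoc, star_word_mul_word_of_ne_assoc hS hl hne, mul_zero])

theorem diagonal_mul_mul_mul_comm (hS : IsCuntzFamily S) (a b c d : diagonal S) :
    a * b * (c * d) = a * c * (b * d) := by
  rw [mul_assoc, ← mul_assoc b, diagonal_mul_comm hS b c, mul_assoc, ← mul_assoc]

theorem targetProj_mul_self (hS : IsCuntzFamily S) (α : diagonal S ≃⋆ₐ[ℂ] diagonal S)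
    (κ : List (Fin n)) : targetProj hS α κ * targetProj hS α κ = targetProj hS α κ := by
  rw [targetProj, ← map_mul, diagonal_mul_mul_mul_comm hS, diagProj_mul_self hS, ← map_mul,
    ← map_mul, diagProj_mul_self hS]

theorem targetProj_mul_of_ne (hS : IsCuntzFamily S) (α : diagonal S ≃⋆ₐ[ℂ] diagonal S)
    {κ κ' : List (Fin n)} (hl : κ.length = κ'.length) (hne : κ ≠ κ') :
    targetProj hS α κ * targetProj hS α κ' = 0 := by
  rw [targetProj, targetProj, ← map_mul, diagonal_mul_mul_mul_comm hS, ← map_mul, ← map_mul]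
  by_cases h1 : κ.take 1 = κ'.take 1
  · have h2 : κ.drop 1 ≠ κ'.drop 1 := fun h2 => hne (by
      rw [← List.take_append_drop 1 κ, h1, h2, List.take_append_drop])
    rw [diagProj_mul_of_ne hS (by simp [hl]) h2, map_zero, map_zero, mul_zero, map_zero]
  · rw [diagProj_mul_of_ne hS (by simp [hl]) h1, zero_mul, map_zero]

variable [Nontrivial A]

theorem proj_ne_zero (hS : IsCuntzFamily S) (μ : List (Fin n)) : proj S μ ≠ 0 := by
  intro h
  have h1 := proj_mul_word_append hS μ []
  have h2 := star_word_mul_self hS μ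
  rw [List.append_nil, h, zero_mul] at h1
  rw [← h1, mul_zero] at h2
  exact zero_ne_one h2

theorem targetProj_mul_shift_ne_zero (hS : IsCuntzFamily S) {α : diagonal S ≃⋆ₐ[ℂ] diagonal S}
    {m : ℕ} (hm : ∀ y : diagonal S, α.symm (diagShiftHom hS ((diagShiftHom hS ^ m) y))
      = diagShiftHom hS (α.symm ((diagShiftHom hS ^ m) y)))
    {κ : List (Fin n)} (hκ : κ.length = m + 1) (ρ : List (Fin n)) :
    targetProj hS α κ * (diagShiftHom hS ^ (m + 1)) (diagProj S ρ) ≠ 0 := by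
  match κ with
  | i :: μ =>
    have hμ : μ.length = m := by simpa using hκ
    intro h
    have h1 : (diagShiftHom hS ^ (m + 1)) (diagProj S ρ)
        = α (diagShiftHom hS (α.symm ((diagShiftHom hS ^ m) (diagProj S ρ)))) := by
      rw [← hm, StarAlgEquiv.apply_symm_apply, pow_succ']; rfl
    change α (diagProj S [i] * diagShiftHom hS (α.symm (diagProj S μ))) * _ = 0 at h
    rw [h1, ← map_mul, mul_assoc, ← map_mul, ← map_mul, ← hμ, ← diagProj_append hS,
      map_eq_zero_iff α (EquivLike.injective α)] at h
    obtain ⟨b, hb⟩ : ∃ b, b = α.symm (diagProj S (μ ++ ρ)) := ⟨_, rfl⟩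
    have hb0 : (b : A) = 0 := by
      have h2 : proj S [i] * shift S b = 0 := by
        rw [← hb] at h; exact congrArg (fun x : diagonal S => (x : A)) h
      have h3 : star (S i) * (proj S [i] * shift S b) * S i = b := by
        rw [mul_assoc, mul_assoc, shift_mul_gen hS]
        simp only [proj, word_cons, word_nil, mul_one]
        rw [← mul_assoc, ← mul_assoc, ← mul_assoc, hS.isometry, one_mul, hS.isometry, one_mul]
      rw [← h3, h2, mul_zero, zero_mul]
    have hb0' : b = 0 := Subtype.ext hb0
    rw [hb, map_eq_zero_iff α.symm (EquivLike.injective α.symm)] at hb0'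
    exact proj_ne_zero hS (μ ++ ρ) (congrArg (fun x : diagonal S => (x : A)) hb0')

/-- Level by level, `α` permutes multi-indices: let `Q_κ` be the target projections, `|κ| = m + 1`,
and let `r` be so large that all `Q_κ` are constant on cylinders of length `m + 1 + r`. For fixed
`ρ`, `|ρ| = r`, each of the orthogonal projections `Q_κ φᵐ⁺¹(P_ρ) ≠ 0` contains some `P_{κ'ρ}`.
There are as many indices `κ` as `κ'`, so it contains exactly one of them. -/
theorem exists_unitary_of_propertyP (hS : IsCuntzFamily S) {α : diagonal S ≃⋆ₐ[ℂ] diagonal S}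
    {m : ℕ} (hm : ∀ y : diagonal S, α.symm (diagShiftHom hS ((diagShiftHom hS ^ m) y))
      = diagShiftHom hS (α.symm ((diagShiftHom hS ^ m) y))) :
    ∃ (u : A) (L : ℕ), PermutesWords S L u ∧ star u * u = 1 ∧ u * star u = 1 ∧
      (∀ κ : List (Fin n), κ.length = m + 1 → u * proj S κ = targetProj hS α κ * u) ∧
      ∀ y ∈ diagonal S, Commute u (shiftPow hS (m + 1) y) := by
  obtain ⟨r, hr⟩ : ∃ r, ∀ κ : List (Fin n), κ.length = m + 1 → ∀ μ : List (Fin n),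
      m + 1 + r ≤ μ.length → (targetProj hS α κ : A) * word S μ = 0 ∨
        (targetProj hS α κ : A) * word S μ = word S μ := by
    choose f hf using fun κ => exists_level_of_mem_diagonal hS (targetProj hS α κ).2
      (congrArg (fun x : diagonal S => (x : A)) (targetProj_mul_self hS α κ))
    refine ⟨(words n (m + 1)).sup f, fun κ hκ μ hμ => hf κ μ ?_⟩
    have := Finset.le_sup (f := f) (mem_words.2 hκ)
    omega
  have hex : ∀ κ ρ : List (Fin n), κ.length = m + 1 → ρ.length = r →
      ∃ κ' : List (Fin n), κ'.length = m + 1 ∧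
        (targetProj hS α κ : A) * word S (κ' ++ ρ) = word S (κ' ++ ρ) := by
    intro κ ρ hκ hρ
    by_contra! hcon
    refine targetProj_mul_shift_ne_zero hS hm hκ ρ (Subtype.ext ?_)
    refine eq_of_mul_word_eq hS (m + 1) fun κ' hκ' => ?_
    have h0 := (hr κ hκ (κ' ++ ρ) (by rw [List.length_append, hκ', hρ])).resolve_right
      (hcon κ' hκ')
    change (targetProj hS α κ : A) * (((diagShiftHom hS ^ (m + 1)) (diagProj S ρ) : diagonal S) : A)
      * word S κ' = 0 * word S κ'
    rw [coe_diagShiftHom_pow, mul_assoc, shiftPow_mul_word_eq hS hκ', coe_diagProj, proj,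
      ← mul_assoc (word S κ'), ← word_append, ← mul_assoc, h0, zero_mul, zero_mul]
  choose! f hfl hf using hex
  have hfinj : ∀ κ₁ κ₂ ρ : List (Fin n), κ₁.length = m + 1 → κ₂.length = m + 1 → ρ.length = r →
      f κ₁ ρ = f κ₂ ρ → κ₁ = κ₂ := by
    intro κ₁ κ₂ ρ h1 h2 hρ h
    by_contra hne
    have h3 := congrArg (fun x : diagonal S => (x : A))
      (targetProj_mul_of_ne hS α (h1.trans h2.symm) hne)
    change (targetProj hS α κ₁ : A) * targetProj hS α κ₂ = 0 at h3
    have h6 := hf κ₁ ρ h1 hρ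
    have h4 : word S (f κ₂ ρ ++ ρ) = 0 := by
      rw [h, ← hf κ₂ ρ h2 hρ, ← mul_assoc, h3, zero_mul] at h6
      rw [← hf κ₂ ρ h2 hρ, ← h6]
    have h5 := star_word_mul_self hS (f κ₂ ρ ++ ρ)
    rw [h4, mul_zero] at h5
    exact zero_ne_one h5
  obtain ⟨g, hg⟩ : ∃ g : List (Fin n) → List (Fin n), ∀ κ ρ : List (Fin n), κ.length = m + 1 →
      g (κ ++ ρ) = f κ ρ ++ ρ :=
    ⟨fun σ => f (σ.take (m + 1)) (σ.drop (m + 1)) ++ σ.drop (m + 1), fun κ ρ hκ => by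
      simp [← hκ]⟩
  have hsplit : ∀ σ : List (Fin n), σ.length = m + 1 + r →
      ∃ κ ρ : List (Fin n), κ.length = m + 1 ∧ ρ.length = r ∧ σ = κ ++ ρ := fun σ hσ =>
    ⟨σ.take (m + 1), σ.drop (m + 1), by simp [hσ], by simp [hσ],
      (List.take_append_drop _ _).symm⟩
  have hgl : ∀ σ : List (Fin n), σ.length = m + 1 + r → (g σ).length = m + 1 + r := by
    intro σ hσ
    obtain ⟨κ, ρ, hκ, hρ, rfl⟩ := hsplit σ hσ
    rw [hg κ ρ hκ, List.length_append, hfl κ ρ hκ hρ, hρ]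
  obtain ⟨u, hu1, hu2, hu⟩ := exists_unitary_of_injOn hS (L := m + 1 + r) (g := g)
    (fun σ hσ => Finset.mem_coe.2 (mem_words.2 (hgl σ (mem_words.1 hσ)))) (by
      intro σ hσ τ hτ h
      obtain ⟨κ₁, ρ₁, h1, h2, rfl⟩ := hsplit σ (mem_words.1 hσ)
      obtain ⟨κ₂, ρ₂, h3, h4, rfl⟩ := hsplit τ (mem_words.1 hτ)
      rw [hg _ _ h1, hg _ _ h3] at h
      obtain ⟨h5, rfl⟩ := List.append_inj h ((hfl _ _ h1 h2).trans (hfl _ _ h3 h4).symm)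
      rw [hfinj κ₁ κ₂ ρ₁ h1 h3 h2 h5])
  have hu' : ∀ κ ρ : List (Fin n), κ.length = m + 1 → ρ.length = r →
      u * word S (κ ++ ρ) = word S (f κ ρ ++ ρ) := fun κ ρ hκ hρ => by
    rw [hu _ (by rw [List.length_append, hκ, hρ]), hg κ ρ hκ]
  refine ⟨u, m + 1 + r, fun σ hσ => ⟨g σ, hgl σ hσ, hu σ hσ⟩, hu1, hu2, fun κ hκ => ?_,
    fun y hy => ?_⟩
  · refine eq_of_mul_word_eq hS (m + 1 + r) fun σ hσ => ?_
    obtain ⟨κ', ρ, hκ', hρ, rfl⟩ := hsplit σ hσ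
    rw [mul_assoc, mul_assoc, hu' κ' ρ hκ' hρ]
    by_cases h : κ = κ'
    · subst h
      rw [proj_mul_word_append hS, hu' κ ρ hκ hρ, hf κ ρ hκ hρ]
    · rw [proj_mul_word_append_of_ne hS (hκ.trans hκ'.symm) h, mul_zero, ← hf κ' ρ hκ' hρ,
        ← mul_assoc]
      have h3 := congrArg (fun x : diagonal S => (x : A))
        (targetProj_mul_of_ne hS α (hκ.trans hκ'.symm) h)
      change (targetProj hS α κ : A) * targetProj hS α κ' = 0 at h3
      rw [h3, zero_mul]
  · refine eq_of_mul_word_eq hS (m + 1 + r) fun σ hσ => ?_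
    obtain ⟨κ, ρ, hκ, hρ, rfl⟩ := hsplit σ hσ
    have key : ∀ κ : List (Fin n), κ.length = m + 1 → shiftPow hS (m + 1) y * word S (κ ++ ρ)
        = word S (κ ++ ρ) * (star (word S ρ) * y * word S ρ) := by
      intro κ hκ
      have h1 : word S ρ * (star (word S ρ) * y * word S ρ) = y * word S ρ := by
        rw [← mul_assoc, ← mul_assoc]
        change proj S ρ * y * word S ρ = _
        rw [(diagonal_commute hS (proj_mem_diagonal ρ) hy).eq, mul_assoc, proj, mul_assoc,
          star_word_mul_self hS, mul_one]
      rw [word_append, ← mul_assoc, shiftPow_mul_word_eq hS hκ, mul_assoc, ← h1, ← mul_assoc]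
    rw [mul_assoc, key κ hκ, ← mul_assoc, hu' κ ρ hκ hρ, mul_assoc (shiftPow hS _ y),
      hu' κ ρ hκ hρ, key _ (hfl κ ρ hκ hρ)]

/-- An automorphism of the diagonal whose inverse has property (P) extends to the Cuntz algebra, by
an endomorphism with a permutation unitary. -/
theorem exists_extension (hS : IsCuntzFamily S) {o e : Fin n} (hoe : o ≠ e)
    {α : diagonal S ≃⋆ₐ[ℂ] diagonal S} (hα : PropertyP hS α.symm) :
    ∃ (ρ : A →⋆ₐ[ℂ] A) (u : A) (L : ℕ), PermutesWords S L u ∧ (∀ i, ρ (S i) = u * S i) ∧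
      ∀ x : diagonal S, ρ x = α x := by
  obtain ⟨m, hm⟩ := hα.exists_map_shift_eq
  obtain ⟨u, L, hL, hu1, hu2, huQ, huφ⟩ := exists_unitary_of_propertyP hS hm
  obtain ⟨ρ, hρ⟩ := exists_starAlgHom hS hoe (T := fun i => u * S i)
    (fun i => by
      rw [star_mul, mul_assoc, ← mul_assoc (star u), hu1, one_mul, hS.isometry])
    (by
      have : ∀ i, u * S i * star (u * S i) = u * (S i * star (S i)) * star u := fun i => by
        simp only [star_mul, mul_assoc]
      simp only [this]
      rw [← Finset.sum_mul, ← Finset.mul_sum, hS.sum_range, mul_one, hu2])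
  refine ⟨ρ, u, L, hL, hρ, ?_⟩
  -- `Ad(u) φ = α φ α⁻¹` on the diagonal
  let ψ : diagonal S →⋆ₐ[ℂ] diagonal S :=
    ((α : diagonal S →⋆ₐ[ℂ] diagonal S).comp (diagShiftHom hS)).comp
      (α.symm : diagonal S →⋆ₐ[ℂ] diagonal S)
  have hψ : ∀ y, ψ y = α (diagShiftHom hS (α.symm y)) := fun _ => rfl
  have hQ : ∀ i μ, targetProj hS α (i :: μ) = α (diagProj S [i]) * ψ (diagProj S μ) :=
    fun i μ => map_mul α _ _
  have hQi : ∀ i, u * proj S [i] = (α (diagProj S [i]) : A) * u := by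
    intro i
    have hs : ∑ μ ∈ words n m, targetProj hS α (i :: μ) = α (diagProj S [i]) := by
      simp only [hQ]
      rw [← Finset.mul_sum, ← map_sum]
      have : ∑ μ ∈ words n m, diagProj S μ = 1 :=
        Subtype.ext (by simpa [diagProj] using sum_words_proj hS m)
      rw [this, map_one, mul_one]
    rw [proj_eq_sum hS [i] m, Finset.mul_sum, ← hs, AddSubmonoidClass.coe_finsetSum,
      Finset.sum_mul]
    exact Finset.sum_congr rfl fun μ hμ => huQ (i :: μ) (by simp [mem_words.1 hμ])
  have hQμ : ∀ μ : List (Fin n), μ.length = m →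
      u * shift S (proj S μ) = (ψ (diagProj S μ) : A) * u := by
    intro μ hμ
    have hs : ∑ i, targetProj hS α (i :: μ) = ψ (diagProj S μ) := by
      simp only [hQ]
      rw [← Finset.sum_mul, ← map_sum]
      have : ∑ i, diagProj S [i] = 1 :=
        Subtype.ext (by simpa [diagProj, proj, word_cons] using hS.sum_range)
      rw [this, map_one, one_mul]
    have hsh : shift S (proj S μ) = ∑ i, proj S (i :: μ) := by
      simp only [shift, proj, word_cons, star_mul, mul_assoc]
    rw [hsh, Finset.mul_sum, ← hs, AddSubmonoidClass.coe_finsetSum, Finset.sum_mul]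
    exact Finset.sum_congr rfl fun i _ => huQ (i :: μ) (by simp [hμ])
  have hconj : ∀ y : diagonal S, u * shift S y * star u = (ψ y : A) := by
    have hDc : IsClosed (diagonal S : Set A) := isClosed_diagonal
    let U : unitary A := ⟨u, Unitary.mem_iff.2 ⟨hu1, hu2⟩⟩
    have hext : ((Unitary.conjStarAlgAut ℂ A U : A →⋆ₐ[ℂ] A).comp
        ((diagonal S).subtype.comp (diagShiftHom hS))) = (diagonal S).subtype.comp ψ := by
      refine diagonal_hom_ext_proj hS m fun ν hν => ?_
      obtain ⟨μ, η, hμ, rfl⟩ : ∃ μ η : List (Fin n), μ.length = m ∧ ν = μ ++ η :=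
        ⟨ν.take m, ν.drop m, by simp [hν], (List.take_append_drop _ _).symm⟩
      rw [diagProj_append hS, map_mul, map_mul, hμ]
      congr 1
      · change u * shift S (proj S μ) * star u = (ψ (diagProj S μ) : A)
        rw [hQμ μ hμ, mul_assoc, hu2, mul_one]
      · have h1 : ψ ((diagShiftHom hS ^ m) (diagProj S η))
            = diagShiftHom hS ((diagShiftHom hS ^ m) (diagProj S η)) := by
          rw [hψ, ← hm, StarAlgEquiv.apply_symm_apply]
        have h2 : (diagShiftHom hS ((diagShiftHom hS ^ m) (diagProj S η)) : A)
            = shiftPow hS (m + 1) (diagProj S η) := by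
          rw [← coe_diagShiftHom_pow, pow_succ']; rfl
        change u * (diagShiftHom hS ((diagShiftHom hS ^ m) (diagProj S η)) : A) * star u
          = (ψ ((diagShiftHom hS ^ m) (diagProj S η)) : A)
        rw [h1, h2, (huφ _ (diagProj S η).2).eq, mul_assoc, hu2, mul_one]
    exact fun y => congrArg (fun F : diagonal S →⋆ₐ[ℂ] A => F y) hext
  have hproj : ∀ μ, ρ (proj S μ) = α (diagProj S μ) := by
    intro μ
    induction μ with
    | nil =>
      rw [diagProj_nil, map_one, proj, word_nil, star_one, mul_one, map_one]; rfl
    | cons i μ ih =>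
      have h1 : ρ (proj S [i]) = (α (diagProj S [i]) : A) := by
        have : ρ (proj S [i]) = u * proj S [i] * star u := by
          simp only [proj, word_cons, word_nil, mul_one, map_mul, map_star, hρ, star_mul,
            mul_assoc]
        rw [this, hQi, mul_assoc, hu2, mul_one]
      rw [proj_cons i hS, map_mul, h1, map_shift ρ hρ, ih, hconj, hψ,
        StarAlgEquiv.symm_apply_apply, diagProj_cons hS i μ, map_mul]
      rfl
  have hDc : IsClosed (diagonal S : Set A) := isClosed_diagonal
  have hext : ρ.comp (diagonal S).subtype
      = (diagonal S).subtype.comp (α : diagonal S →⋆ₐ[ℂ] diagonal S) :=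
    diagonal_hom_ext_proj hS 0 fun μ _ => hproj μ
  exact fun x => congrArg (fun F : diagonal S →⋆ₐ[ℂ] A => F x) hext

end Extension

/-! ### Restriction of automorphisms to the diagonal -/

section Restriction

variable {n : ℕ} {A : Type*} [CStarAlgebra A] {S : Fin n → A}

theorem mem_autPreserving_iff {B : Set A} {α : A ≃⋆ₐ[ℂ] A} :
    α ∈ autPreserving B ↔ (∀ x ∈ B, α x ∈ B) ∧ ∀ x ∈ B, α.symm x ∈ B := by
  change α '' B = B ↔ _
  constructor
  · intro h
    refine ⟨fun x hx => h ▸ Set.mem_image_of_mem α hx, fun x hx => ?_⟩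
    rw [← h] at hx
    obtain ⟨y, hy, rfl⟩ := hx
    rwa [StarAlgEquiv.symm_apply_apply]
  · rintro ⟨h1, h2⟩
    refine Set.Subset.antisymm (Set.image_subset_iff.2 h1) fun x hx =>
      ⟨α.symm x, h2 x hx, α.apply_symm_apply x⟩

/-- The restriction to the diagonal of automorphisms that preserve it. -/
noncomputable def diagRestrict (S : Fin n → A) :
    autPreserving (diagonal S : Set A) →* (diagonal S ≃⋆ₐ[ℂ] diagonal S) where
  toFun α := StarAlgEquiv.ofStarAlgHom
    ((((α : A ≃⋆ₐ[ℂ] A) : A →⋆ₐ[ℂ] A).comp (diagonal S).subtype).codRestrict (diagonal S)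
      fun x => (mem_autPreserving_iff.1 α.2).1 x x.2)
    ((((α : A ≃⋆ₐ[ℂ] A).symm : A →⋆ₐ[ℂ] A).comp (diagonal S).subtype).codRestrict (diagonal S)
      fun x => (mem_autPreserving_iff.1 α.2).2 x x.2)
    (by ext x; exact (α : A ≃⋆ₐ[ℂ] A).symm_apply_apply (x : A))
    (by ext x; exact (α : A ≃⋆ₐ[ℂ] A).apply_symm_apply (x : A))
  map_one' := rfl
  map_mul' _ _ := rfl

theorem coe_diagRestrict (α : autPreserving (diagonal S : Set A)) (x : diagonal S) :
    ((diagRestrict S α x : diagonal S) : A) = (α : A ≃⋆ₐ[ℂ] A) x := rfl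

theorem comp_apply_gen {α β : A →⋆ₐ[ℂ] A} {u w : A} (hα : ∀ i, α (S i) = u * S i)
    (hβ : ∀ i, β (S i) = w * S i) (i : Fin n) : α.comp β (S i) = α w * u * S i := by
  change α (β (S i)) = _
  rw [hβ, map_mul, hα, mul_assoc]

variable [Nontrivial A]

theorem mem_autPreserving_core (hS : IsCuntzFamily S) {o e : Fin n} (hoe : o ≠ e)
    {α : A ≃⋆ₐ[ℂ] A} {u : A} (hα : ∀ i, α (S i) = u * S i) (hu : u ∈ core S) :
    α ∈ autPreserving (core S) := by
  -- `α` commutes with the gauge action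
  have hcomm : ∀ t x, gauge hS hoe t (α x) = α (gauge hS hoe t x) := by
    intro t
    have : (gauge hS hoe t).comp (α : A →⋆ₐ[ℂ] A) = (α : A →⋆ₐ[ℂ] A).comp (gauge hS hoe t) := by
      refine starAlgHom_ext hS fun i => ?_
      change gauge hS hoe t (α (S i)) = α (gauge hS hoe t (S i))
      rw [hα, map_mul, gauge_of_mem_core hS hoe hu, gauge_gen, map_smul, hα, mul_smul_comm]
    exact fun x => congrArg (fun F : A →⋆ₐ[ℂ] A => F x) this
  refine mem_autPreserving_iff.2 ⟨fun x hx => ?_, fun x hx => ?_⟩ <;>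
    rw [mem_core_iff_gauge hS hoe] at hx ⊢
  · intro t
    rw [hcomm, hx]
  · intro t
    apply EquivLike.injective α
    rw [← hcomm, StarAlgEquiv.apply_symm_apply, hx]

theorem permutativeAut_subset (hS : IsCuntzFamily S) {o e : Fin n} (hoe : o ≠ e)
    {α : A ≃⋆ₐ[ℂ] A} (hα : α ∈ permutativeAut S) :
    α ∈ autPreserving (diagonal S : Set A) ⊓ autPreserving (core S) := by
  obtain ⟨u, hu, hαu⟩ := hα
  refine ⟨mem_autPreserving_iff.2 ?_, mem_autPreserving_core hS hoe hαu hu.2⟩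
  obtain ⟨L, hL⟩ := exists_permutesWords hS hoe hu
  have hD : ∀ x ∈ diagonal S, α x ∈ diagonal S := fun x hx =>
    map_mem_diagonal_of_permutesWords hS (α := (α : A →⋆ₐ[ℂ] A)) hαu hL hx
  -- `α⁻¹(𝒟ₙ)` is abelian and contains the maximal abelian subalgebra `𝒟ₙ`
  refine ⟨hD, fun x hx => mem_diagonal_of_commute hS hoe fun y hy => ?_⟩
  apply EquivLike.injective α
  rw [map_mul, map_mul, StarAlgEquiv.apply_symm_apply]
  exact diagonal_commute hS hx (hD y hy)

theorem autFixing_diagonal_le (hS : IsCuntzFamily S) {o e : Fin n} (hoe : o ≠ e) :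
    autFixing (diagonal S : Set A) ≤
      autPreserving (diagonal S : Set A) ⊓ autPreserving (core S) := by
  intro α hα
  have hαD : ∀ x ∈ diagonal S, α x = x := hα
  refine ⟨mem_autPreserving_iff.2 ⟨fun x hx => ?_, fun x hx => ?_⟩, ?_⟩
  · rw [hαD x hx]; exact hx
  · rw [show α.symm x = x from (autFixing (diagonal S : Set A)).inv_mem hα x hx]
    exact hx
  · have hu := map_gen_eq_cocycle_mul hS (α : A →⋆ₐ[ℂ] A)
    refine mem_autPreserving_core hS hoe hu (diagonal_le_coreAlg hS ?_)
    exact mem_diagonal_of_commute hS hoe fun y hy => commute_of_map_diagonal hS hu hαD hy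

theorem propertyP_diagRestrict (hS : IsCuntzFamily S) (hn : 2 ≤ n) {o e : Fin n} (hoe : o ≠ e)
    {α : A ≃⋆ₐ[ℂ] A} (h1 : α ∈ autPreserving (diagonal S : Set A))
    (h2 : α ∈ autPreserving (core S)) : PropertyP hS (diagRestrict S ⟨α, h1⟩) := by
  have hu := map_gen_eq_cocycle_mul hS (α : A →⋆ₐ[ℂ] A)
  obtain ⟨h2a, h2b⟩ := mem_autPreserving_iff.1 h2
  have huc : cocycle S (α : A →⋆ₐ[ℂ] A) ∈ core S := mem_core_of_autPreserving hS hoe hn hu h2a h2b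
  obtain ⟨m, hm⟩ := exists_map_shiftPow_proj hS (α := α) hu (mem_autPreserving_iff.1 h1).1
    (h2b _ ((coreAlg hS).star_mem' huc)) (α.apply_symm_apply _)
  refine (propertyP_iff hS).2 ⟨m, fun k hk i => Subtype.ext ?_⟩
  have := hm k hk i
  rw [coe_diagRestrict, coe_diagShift_iterate, this]
  change _ = shift S (diagRestrict S ⟨α, h1⟩ _ : A)
  rw [coe_diagRestrict, coe_diagShift_iterate]

theorem diagRestrict_mem (hS : IsCuntzFamily S) (hn : 2 ≤ n) {o e : Fin n} (hoe : o ≠ e)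
    {α : A ≃⋆ₐ[ℂ] A} (h1 : α ∈ autPreserving (diagonal S : Set A))
    (h2 : α ∈ autPreserving (core S)) :
    diagRestrict S ⟨α, h1⟩ ∈ eventuallyShiftCommuting hS := by
  refine ⟨propertyP_diagRestrict hS hn hoe h1 h2, ?_⟩
  rw [← map_inv]
  exact propertyP_diagRestrict hS hn hoe (inv_mem h1) (inv_mem h2)

theorem eq_id_of_permutesWords (hS : IsCuntzFamily S) {α : A →⋆ₐ[ℂ] A} {u : A}
    (hα : ∀ i, α (S i) = u * S i) {L : ℕ} (hu : PermutesWords S L u)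
    (hD : ∀ x ∈ diagonal S, α x = x) (x : A) : α x = x := by
  have h1 : u = 1 := hu.eq_one hS (mul_star_self_of_map_gen hS hα)
    fun y hy => commute_of_map_diagonal hS hα hD hy
  have : α = StarAlgHom.id ℂ A := starAlgHom_ext hS fun i => by
    rw [hα, h1, one_mul]; rfl
  rw [this]; rfl

theorem exists_permutesWords_comp (hS : IsCuntzFamily S) {α : A →⋆ₐ[ℂ] A} {u w : A}
    (hα : ∀ i, α (S i) = u * S i) {L M : ℕ} (hu : PermutesWords S L u)
    (hw : PermutesWords S M w) : ∃ N, PermutesWords S N (α w * u) := by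
  obtain ⟨N, hN⟩ := exists_permutesWords_map hS hα hu hw
  exact ⟨max N L, (hN.mono (le_max_left _ _)).mul (hu.mono (le_max_right _ _))⟩

/-- Every automorphism of the diagonal that, like its inverse, has property (P) extends to an
automorphism in `λ(𝒫ₙ)⁻¹`. The extensions of the automorphism and of its inverse are inverse to
each other, because their compositions fix the diagonal. -/
theorem exists_permutativeAut (hS : IsCuntzFamily S) {o e : Fin n} (hoe : o ≠ e)
    {β : diagonal S ≃⋆ₐ[ℂ] diagonal S} (hβ : β ∈ eventuallyShiftCommuting hS) :
    ∃ α ∈ permutativeAut S, ∀ x : diagonal S, α (x : A) = β x := by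
  obtain ⟨ρ, u, L, hL, hρ, hρβ⟩ := exists_extension hS hoe (α := β) hβ.2
  obtain ⟨σ, v, M, hM, hσ, hσβ⟩ := exists_extension hS hoe (α := β.symm) hβ.1
  obtain ⟨N₁, hN₁⟩ := exists_permutesWords_comp hS hρ hL hM
  obtain ⟨N₂, hN₂⟩ := exists_permutesWords_comp hS hσ hM hL
  have h1 : ∀ x, ρ.comp σ x = x := eq_id_of_permutesWords hS (comp_apply_gen hρ hσ) hN₁
    fun x hx => by
      change ρ (σ ((⟨x, hx⟩ : diagonal S) : A)) = x
      rw [hσβ, hρβ, StarAlgEquiv.apply_symm_apply]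
  have h2 : ∀ x, σ.comp ρ x = x := eq_id_of_permutesWords hS (comp_apply_gen hσ hρ) hN₂
    fun x hx => by
      change σ (ρ ((⟨x, hx⟩ : diagonal S) : A)) = x
      rw [hρβ, hσβ, StarAlgEquiv.symm_apply_apply]
  refine ⟨StarAlgEquiv.ofStarAlgHom ρ σ (StarAlgHom.ext h2) (StarAlgHom.ext h1),
    ⟨u, hL.mem_permUnitaries hS (star_mul_self_of_map_gen hS hρ)
      (mul_star_self_of_map_gen hS hρ), hρ⟩, hρβ⟩

theorem mul_mem_permutativeAut (hS : IsCuntzFamily S) {o e : Fin n} (hoe : o ≠ e)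
    {α β : A ≃⋆ₐ[ℂ] A} (hα : α ∈ permutativeAut S) (hβ : β ∈ permutativeAut S) :
    α * β ∈ permutativeAut S := by
  obtain ⟨u, hu, hαu⟩ := hα
  obtain ⟨w, hw, hβw⟩ := hβ
  obtain ⟨L, hL⟩ := exists_permutesWords hS hoe hu
  obtain ⟨M, hM⟩ := exists_permutesWords hS hoe hw
  obtain ⟨N, hN⟩ := exists_permutesWords_comp hS (α := (α : A →⋆ₐ[ℂ] A)) hαu hL hM
  have h := comp_apply_gen (α := (α : A →⋆ₐ[ℂ] A)) (β := (β : A →⋆ₐ[ℂ] A)) hαu hβw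
  exact ⟨_, hN.mem_permUnitaries hS (star_mul_self_of_map_gen hS h)
    (mul_star_self_of_map_gen hS h), h⟩

theorem eq_of_permutativeAut_of_eqOn (hS : IsCuntzFamily S) {o e : Fin n} (hoe : o ≠ e)
    {α : A ≃⋆ₐ[ℂ] A} (hα : α ∈ permutativeAut S) (hD : ∀ x ∈ diagonal S, α x = x) : α = 1 := by
  obtain ⟨u, hu, hαu⟩ := hα
  obtain ⟨L, hL⟩ := exists_permutesWords hS hoe hu
  exact StarAlgEquiv.ext (eq_id_of_permutesWords hS (α := (α : A →⋆ₐ[ℂ] A)) hαu hL hD)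

/-- The group `λ(𝒫ₙ)⁻¹`. The inverse of one of its elements is again given by a permutation
unitary, because its restriction to the diagonal extends to an element of `λ(𝒫ₙ)⁻¹`. -/
noncomputable def permutativeSubgroup (hS : IsCuntzFamily S) (hn : 2 ≤ n) {o e : Fin n}
    (hoe : o ≠ e) : Subgroup (A ≃⋆ₐ[ℂ] A) where
  carrier := permutativeAut S
  mul_mem' := mul_mem_permutativeAut hS hoe
  one_mem' := ⟨1, (permutesWords_one (S := S) 0).mem_permUnitaries hS (by simp) (by simp),
    fun i => (one_mul (S i)).symm⟩
  inv_mem' {α} hα := by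
    obtain ⟨h1, h2⟩ := permutativeAut_subset hS hoe hα
    obtain ⟨β, hβ, hβα⟩ := exists_permutativeAut hS hoe
      (diagRestrict_mem hS hn hoe (inv_mem h1) (inv_mem h2))
    have : β * α = 1 := eq_of_permutativeAut_of_eqOn hS hoe (mul_mem_permutativeAut hS hoe hβ hα)
      fun x hx => by
        have h3 := hβα ⟨α x, (mem_autPreserving_iff.1 h1).1 x hx⟩
        exact h3.trans (α.symm_apply_apply x)
    rw [← eq_inv_of_mul_eq_one_left this]
    exact hβ

end Restriction

end Cuntz

open Cuntz in
theorem corollary3p8 (n : ℕ) (hn : 2 ≤ n) {A : Type*} [CStarAlgebra A] [Nontrivial A]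
    (S : Fin n → A) (hS : Cuntz.IsCuntzFamily S) :
    ∃ (L : Subgroup (A ≃⋆ₐ[ℂ] A))
      (G : Subgroup (Cuntz.diagonal S ≃⋆ₐ[ℂ] Cuntz.diagonal S)),
      (L : Set (A ≃⋆ₐ[ℂ] A)) = Cuntz.permutativeAut S ∧
      (G : Set (Cuntz.diagonal S ≃⋆ₐ[ℂ] Cuntz.diagonal S)) =
        Cuntz.eventuallyShiftCommuting hS ∧
      (∃ r : L ≃* G, ∀ (α : L) (x : Cuntz.diagonal S),
        (((r α : Cuntz.diagonal S ≃⋆ₐ[ℂ] Cuntz.diagonal S) x : Cuntz.diagonal S) : A) =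
          (α : A ≃⋆ₐ[ℂ] A) (x : A)) ∧
      Cuntz.autFixing (Cuntz.diagonal S : Set A) ≤
        Cuntz.autPreserving (Cuntz.diagonal S : Set A) ⊓
          Cuntz.autPreserving (Cuntz.core S) ∧
      (∃ w : Cuntz.RestrictedWeylGroup S ≃* G,
        ∀ (α : (Cuntz.autPreserving (Cuntz.diagonal S : Set A) ⊓
            Cuntz.autPreserving (Cuntz.core S) : Subgroup (A ≃⋆ₐ[ℂ] A)))
          (x : Cuntz.diagonal S),
          (((w (QuotientGroup.mk α) : Cuntz.diagonal S ≃⋆ₐ[ℂ] Cuntz.diagonal S) x :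
            Cuntz.diagonal S) : A) = (α : A ≃⋆ₐ[ℂ] A) (x : A)) := by
  have hoe : (⟨0, by omega⟩ : Fin n) ≠ ⟨1, by omega⟩ := by simp
  let res := (diagRestrict S).comp (Subgroup.inclusion
    (inf_le_left : autPreserving (diagonal S : Set A) ⊓ autPreserving (core S) ≤ _))
  have hres : ∀ α x, ((res α x : diagonal S) : A) = (α : A ≃⋆ₐ[ℂ] A) x := fun _ _ => rfl
  have hmem : ∀ α ∈ permutativeSubgroup hS hn hoe,
      α ∈ autPreserving (diagonal S : Set A) ⊓ autPreserving (core S) :=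
    fun α hα => permutativeAut_subset hS hoe hα
  have hsurj : ∀ β ∈ eventuallyShiftCommuting hS,
      ∃ α, ∃ hα : α ∈ permutativeSubgroup hS hn hoe, res ⟨α, hmem α hα⟩ = β := by
    intro β hβ
    obtain ⟨α, hα, hαβ⟩ := exists_permutativeAut hS hoe hβ
    exact ⟨α, hα, StarAlgEquiv.ext fun x => Subtype.ext (hαβ x)⟩
  have hG : (res.range : Set (diagonal S ≃⋆ₐ[ℂ] diagonal S)) = eventuallyShiftCommuting hS := by
    refine Set.Subset.antisymm ?_ fun β hβ => ?_
    · rintro _ ⟨⟨α, h1, h2⟩, rfl⟩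
      exact diagRestrict_mem hS hn hoe h1 h2
    · obtain ⟨α, hα, h⟩ := hsurj β hβ
      exact ⟨_, h⟩
  have hker : (autFixing (diagonal S : Set A)).subgroupOf
      (autPreserving (diagonal S : Set A) ⊓ autPreserving (core S)) = res.ker := by
    ext α
    rw [Subgroup.mem_subgroupOf, MonoidHom.mem_ker]
    constructor
    · intro h
      exact StarAlgEquiv.ext fun x => Subtype.ext (h x x.2)
    · intro h x hx
      have h1 := hres α ⟨x, hx⟩
      rw [h] at h1
      exact h1.symm
  refine ⟨permutativeSubgroup hS hn hoe, res.range, rfl, hG, ?_, autFixing_diagonal_le hS hoe, ?_⟩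
  · let f : permutativeSubgroup hS hn hoe →* res.range :=
      res.rangeRestrict.comp (Subgroup.inclusion hmem)
    refine ⟨MulEquiv.ofBijective f ⟨?_, ?_⟩, fun α x => rfl⟩
    · rw [injective_iff_map_eq_one]
      intro α hα
      refine Subtype.ext (eq_of_permutativeAut_of_eqOn hS hoe α.2 fun x hx => ?_)
      have h1 := hres ⟨α, hmem α α.2⟩ ⟨x, hx⟩
      have h2 : res ⟨α, hmem α α.2⟩ = 1 := congrArg Subtype.val hα
      rw [h2] at h1
      exact h1.symm
    · rintro ⟨β, hβ⟩
      obtain ⟨α, hα, h⟩ := hsurj β (hG ▸ hβ)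
      exact ⟨⟨α, hα⟩, Subtype.ext h⟩
  · exact ⟨(QuotientGroup.quotientMulEquivOfEq hker).trans
      (QuotientGroup.quotientKerEquivRange res), fun α x => rfl⟩
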